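/- **Setting.** Let $\mathcal F_N=\ell^2(\mathbb N^N)$ be the bosonic Fock space of $N$ modes, $a_k,a_k^\dagger$ the annihilation and creation operators, $\hat\xi=(a_1,\dots,a_N,a_1^\dagger,\dots,a_N^\dagger)$ and $K=\mathrm{diag}(I,-I)$, so $[\hat\xi_m,\hat\xi_n^\dagger]=K_{mn}$. Let $\mathcal S$ be the dense space of rapidly decreasing vectors (the common domain of all powers of $\sum_k a_k^\dagger a_k$). A *quadratic matrix* is a $2N\times 2N$ matrix $H=\begin{pmatrix}A&B\\ \bar B&\bar A\end{pmatrix}$ with $A=A^\dagger$, $B=B^{T}$, and $\hat H=\hat\xi^\dagger H\hat\xi=\sum_{m,n}H_{mn}\hat\xi_m^\dagger\hat\xi_n$. The complex form of $\mathrm{Sp}(2N,\mathbb R)$ consists of the matrices $S=\begin{pmatrix}\alpha&\beta\\ \bar\beta&\bar\alpha\end{pmatrix}$ with $SKS^\dagger=K$. All products are ordered from left to right. **1. One quadratic Hamiltonian.** For every quadratic matrix $H$ there is exactly one strongly continuous unitary group $e^{-it\hat H}$ whose generator agrees with $-i\hat H$ on $\mathcal S$. For all $t\in\mathbb R$ it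 leaves $\mathcal S$ invariant, and on $\mathcal S$ $$e^{it\hat H}\,\hat\xi\,e^{-it\hat H}=e^{-2itKH}\,\hat\xi ,$$ where $e^{-2itKH}$ is in the complex form of $\mathrm{Sp}(2N,\mathbb R)$. (Thus the Hamiltonian $\tfrac12\hat\xi^\dagger H\hat\xi$ has the symplectic matrix $e^{-iKH}$.) **2. Time-dependent quadratic Hamiltonians.** Let $G_1,\dots,G_m$, $m=N(2N+1)$, be quadratic matrices that are linearly independent over $\mathbb R$. Then every quadratic matrix is a unique real linear combination of them. For continuous $\lambda:\mathbb R\to\mathbb R^m$ and $\hat H(t)=\sum_j\lambda_j(t)\hat G_j$ there is exactly one time-ordered exponential $U(t)=\overleftarrow{T}e^{-i\int_0^t\hat H(s)ds}$, i.e. a family of unitaries mapping $\mathcal S$ to $\mathcal S$ with $U(0)=1$ and $\frac{d}{dt}U(t)\psi=-i\hat H(t)U(t)\psi$ for $\psi\in\mathcal S$. There is a matrix function $M:\mathbb R^m\to\mathbb R^{m\times m}$, depending only on the $G_j$, with $M(0)=I$ and, for $S_j=e^{2if_jKG_j}$ (the matrix with $e^{-if_j\hat G_j}\hat\xi e^{if_j\hat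 G_j}=S_j\hat\xi$), $$S_1^\dagger\cdots S_{j-1}^\dagger\,G_j\,S_{j-1}\cdots S_1=\sum_iM_{ij}(f)\,G_i ,$$ such that the following holds. (a) Let $I\ni0$ be an open interval and $F:I\to\mathbb R^m$ differentiable with $F(0)=0$. Then $$U(t)=\prod_{j=1}^{m}e^{-iF_j(t)\hat G_j}\quad(t\in I)$$ if and only if $F$ solves on $I$ the $N(2N+1)$ coupled first-order equations $$\sum_jM_{ij}(F(t))\,\dot F_j(t)=\lambda_i(t),\qquad i=1,\dots,m,$$ that is, $\sum_j\dot F_j\,S_1^\dagger\cdots S_{j-1}^\dagger G_jS_{j-1}\cdots S_1=\sum_j\lambda_jG_j$. In this case $U(t)^\dagger\hat\xi\,U(t)=\bigl(\prod_{j=1}^me^{-2iF_j(t)KG_j}\bigr)\hat\xi$ on $\mathcal S$ for $t\in I$. (b) There is $\delta>0$, depending only on the $G_j$, such that for every continuous $\lambda$ and every $T>0$ with $|\lambda_j(t)|\,T\le\delta$ for all $j$ and $|t|<T$, these equations have exactly one solution $F$ on $(-T,T)$ with $F(0)=0$. **3. Detector and field mode.** Let $N=2$, with annihilation operators $d$ (harmonic-oscillator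 detector) and $D$ (field mode), let $\Delta\in\mathbb R$, let $h:\mathbb R\to\mathbb C$ be continuous and $$\hat H_I(\tau)=(e^{-i\tau\Delta}d+e^{i\tau\Delta}d^\dagger)(h(\tau)D+\bar h(\tau)D^\dagger).$$ For real $c\ne0$ take the generators $\hat G_1=d^\dagger D^\dagger+dD$, $\hat G_2=-i(dD-d^\dagger D^\dagger)$, $\hat G_3=c(d^{\dagger2}+d^2)$, $\hat G_4=-ic(d^{\dagger2}-d^2)$, $\hat G_5=c(D^{\dagger2}+D^2)$, $\hat G_6=-ic(D^{\dagger2}-D^2)$, $\hat G_7=d^\dagger D+dD^\dagger$, $\hat G_8=-i(dD^\dagger-d^\dagger D)$, $\hat G_9=d^\dagger d+dd^\dagger$, $\hat G_{10}=D^\dagger D+DD^\dagger$. They are $\hat\xi^\dagger G_j\hat\xi$ for ten linearly independent quadratic matrices, and $\hat H_I(\tau)=\sum_j\lambda_j(\tau)\hat G_j$ with $\lambda_1-i\lambda_2=e^{-i\tau\Delta}h(\tau)$, $\lambda_7-i\lambda_8=e^{-i\tau\Delta}\bar h(\tau)$ and all other $\lambda_j=0$. The time-ordered exponential $U(\tau)$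 of $\hat H_I$ exists, and near $\tau=0$ it is a product $\prod_je^{-iF_j(\tau)\hat G_j}$ with differentiable $F_j$, $F_j(0)=0$, the factors being taken in the order $3,4,5,6,1,2,7,8,9,10$ (single-mode squeezing, two-mode squeezing, passive transformations). At every time $\tau$ at which $U(\tau)$ is such a product with real numbers $F_j$, the mean number of detector excitations in the state evolved from the vacuum, $N_d(\tau)=\langle U(\tau)0|d^\dagger d\,|U(\tau)0\rangle$, is $$N_d(\tau)=\tfrac12\left[\mathrm{ch}_1\mathrm{ch}_2\mathrm{ch}_3\mathrm{ch}_4-1\right],\qquad \mathrm{ch}_j=\cosh 2F_j\ (j=1,2),\quad \mathrm{ch}_j=\cosh 4cF_j\ (j=3,4).$$ In particular $\mathrm{ch}_j=\cosh 2F_j$ for all four $j$ if $c=\tfrac12$. -/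

import Mathlib

open Matrix

noncomputable section

/-- Occupation numbers of `N` bosonic modes. -/
abbrev Occ (N : ℕ) : Type := Fin N → ℕ

/-- The bosonic Fock space of `N` modes, in the occupation number basis: `ℓ²(ℕ^N)`. -/
abbrev Fock (N : ℕ) : Type := lp (fun _ : Occ N => ℂ) 2

/-- Linear operators on all coefficient sequences. The mode operators and their polynomials move the
occupation numbers by finitely many steps, so they act on every sequence; they are unbounded as
operators on `Fock N`. -/
abbrev SeqOp (N : ℕ) : Type := Module.End ℂ (Occ N → ℂ)

/-- The annihilation operator `a_k`: `(a_k ψ)(n) = √(n_k + 1) ψ(n + e_k)`. -/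
def annih {N : ℕ} (k : Fin N) : SeqOp N where
  toFun ψ n := (Real.sqrt (n k + 1 : ℝ) : ℂ) * ψ (n + Pi.single k 1)
  map_add' ψ φ := by funext n; simp [mul_add]
  map_smul' c ψ := by funext n; simp [mul_left_comm]

/-- The creation operator `a_k†`: `(a_k† ψ)(n) = √(n_k) ψ(n - e_k)`, which is `0` if `n_k = 0`. -/
def creat {N : ℕ} (k : Fin N) : SeqOp N where
  toFun ψ n := (Real.sqrt (n k : ℝ) : ℂ) * ψ (n - Pi.single k 1)
  map_add' ψ φ := by funext n; simp [mul_add]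
  map_smul' c ψ := by funext n; simp [mul_left_comm]

/-- Matrices indexed by the components of the mode vector. -/
abbrev ModeMatrix (N : ℕ) : Type := Matrix (Fin N ⊕ Fin N) (Fin N ⊕ Fin N) ℂ

/-- The mode vector `ξ = (a_1, …, a_N, a_1†, …, a_N†)`. -/
def modeOp {N : ℕ} : Fin N ⊕ Fin N → SeqOp N := Sum.elim annih creat

/-- The entries of `ξ†`, that is `(a_1†, …, a_N†, a_1, …, a_N)`. -/
def modeOpAdj {N : ℕ} : Fin N ⊕ Fin N → SeqOp N := Sum.elim creat annih

/-- `K = diag(I, -I)`, the matrix of the commutators `[ξ_m, ξ_n†]`. -/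
def symK (N : ℕ) : ModeMatrix N := Matrix.fromBlocks 1 0 0 (-1)

/-- The quadratic operator `ξ† H ξ = ∑ H_mn ξ_m† ξ_n`. -/
def quadOp {N : ℕ} (H : ModeMatrix N) : SeqOp N :=
  ∑ m, ∑ n, H m n • (modeOpAdj m * modeOp n)

/-- The matrices `(A B; B̄ Ā)` with `A` Hermitian and `B` symmetric. -/
def IsQuadMatrix {N : ℕ} (H : ModeMatrix N) : Prop :=
  ∃ A B : Matrix (Fin N) (Fin N) ℂ, Aᴴ = A ∧ Bᵀ = B ∧
    H = Matrix.fromBlocks A B (B.map star) (A.map star)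

/-- The complex form of `Sp(2N, ℝ)`: matrices `S = (α β; β̄ ᾱ)` with `S K S† = K`. -/
def IsComplexSymplectic {N : ℕ} (S : ModeMatrix N) : Prop :=
  (∃ α β : Matrix (Fin N) (Fin N) ℂ,
    S = Matrix.fromBlocks α β (β.map star) (α.map star)) ∧ S * symK N * Sᴴ = symK N

/-- The rapidly decreasing vectors: the common domain of all powers of the total number operator.
This is a dense subspace, stable under all mode operators. -/
def RapidlyDecreasing {N : ℕ} (ψ : Fock N) : Prop :=
  ∀ k : ℕ, Summable fun n : Occ N => (((∑ i, n i : ℕ) : ℝ) ^ k * ‖ψ n‖) ^ 2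

/-- `V` is the strongly continuous one-parameter unitary group `V t = e^{-itA}`: its generator agrees
with `-iA` on the rapidly decreasing vectors. -/
structure IsUnitaryGroup {N : ℕ} (A : SeqOp N) (V : ℝ → Fock N →L[ℂ] Fock N) : Prop where
  zero : V 0 = 1
  add : ∀ s t : ℝ, V (s + t) = V s * V t
  isUnitary : ∀ t : ℝ, V t ∈ unitary (Fock N →L[ℂ] Fock N)
  continuous : ∀ ψ : Fock N, Continuous fun t => V t ψ
  hasDerivAt : ∀ ψ : Fock N, RapidlyDecreasing ψ →
    ∃ φ : Fock N, (φ : Occ N → ℂ) = -Complex.I • A ψ ∧ HasDerivAt (fun t => V t ψ) φ 0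

open Classical in
/-- `unitaryExp A t = e^{-itA}`, for an operator `A` that generates a unitary group. -/
def unitaryExp {N : ℕ} (A : SeqOp N) : ℝ → Fock N →L[ℂ] Fock N :=
  if h : ∃ V, IsUnitaryGroup A V then h.choose else fun _ => 1

/-- The ordered product `e^{-i f_1 A_1} e^{-i f_2 A_2} ⋯ e^{-i f_m A_m}`. -/
def unitaryProd {N m : ℕ} (A : Fin m → SeqOp N) (f : Fin m → ℝ) : Fock N →L[ℂ] Fock N :=
  (List.ofFn fun j => unitaryExp (A j) (f j)).prod

/-- `U` is the time-ordered exponential `U t = T exp(-i ∫_0^t A(s) ds)`: the unitary solution operator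
of `i ∂_t ψ = A(t) ψ` from time `0` to time `t`. -/
structure IsTimeOrderedExp {N : ℕ} (A : ℝ → SeqOp N) (U : ℝ → Fock N →L[ℂ] Fock N) : Prop where
  zero : U 0 = 1
  isUnitary : ∀ t : ℝ, U t ∈ unitary (Fock N →L[ℂ] Fock N)
  rapid : ∀ (t : ℝ) (ψ : Fock N), RapidlyDecreasing ψ → RapidlyDecreasing (U t ψ)
  hasDerivAt : ∀ (t : ℝ) (ψ : Fock N), RapidlyDecreasing ψ →
    ∃ φ : Fock N, (φ : Occ N → ℂ) = -Complex.I • A t (U t ψ) ∧ HasDerivAt (fun s => U s ψ) φ t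

/-- `W† ξ W = S ξ` on the rapidly decreasing vectors, a domain that `W` leaves invariant. -/
def ActsOnModesAs {N : ℕ} (W : Fock N →L[ℂ] Fock N) (S : ModeMatrix N) : Prop :=
  ∀ ψ : Fock N, (RapidlyDecreasing (W ψ) ↔ RapidlyDecreasing ψ) ∧
    (RapidlyDecreasing ψ → ∀ m, ∃ φ : Fock N, (φ : Occ N → ℂ) = modeOp m (W ψ) ∧
      ((ContinuousLinearMap.adjoint W φ : Fock N) : Occ N → ℂ) = ∑ n, S m n • modeOp n ψ)

/-- The matrix `e^{-2ifKG}` of `ξ ↦ e^{ifĜ} ξ e^{-ifĜ}`, where `Ĝ = ξ† G ξ`. -/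
def sympExp {N : ℕ} (G : ModeMatrix N) (f : ℝ) : ModeMatrix N :=
  NormedSpace.exp ((-(2 * Complex.I * (f : ℂ))) • (symK N * G))

/-- The ordered product `e^{-2i f_1 K G_1} ⋯ e^{-2i f_m K G_m}`. -/
def sympProd {N m : ℕ} (G : Fin m → ModeMatrix N) (f : Fin m → ℝ) : ModeMatrix N :=
  (List.ofFn fun j => sympExp (G j) (f j)).prod

/-- The product `S_1† S_2† ⋯ S_{j-1}†`, where `S_i = e^{2i f_i K G_i}` is the matrix of
`ξ ↦ e^{-i f_i Ĝ_i} ξ e^{i f_i Ĝ_i}`. -/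
def leftProd {N m : ℕ} (G : Fin m → ModeMatrix N) (f : Fin m → ℝ) (j : Fin m) : ModeMatrix N :=
  ((List.ofFn fun i => (sympExp (G i) (-f i))ᴴ).take j).prod

/-- The matrix `S_1† ⋯ S_{j-1}† G_j S_{j-1} ⋯ S_1` of the similarity transform
`Û_1 ⋯ Û_{j-1} Ĝ_j Û_{j-1}⁻¹ ⋯ Û_1⁻¹`, where `Û_i = e^{-i f_i Ĝ_i}`. -/
def transformedGen {N m : ℕ} (G : Fin m → ModeMatrix N) (f : Fin m → ℝ) (j : Fin m) :
    ModeMatrix N :=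
  leftProd G f j * G j * (leftProd G f j)ᴴ

/-- The vacuum vector. -/
def vacuum (N : ℕ) : Fock N := lp.single 2 (0 : Occ N) (1 : ℂ)

/-- `ψ` is in the domain of `A`, and `⟨ψ, A ψ⟩ = x`. -/
def HasExpectation {N : ℕ} (A : SeqOp N) (ψ : Fock N) (x : ℝ) : Prop :=
  ∃ φ : Fock N, (φ : Occ N → ℂ) = A ψ ∧ inner ℂ ψ φ = (x : ℂ)

/-- The annihilation operator `d` of the detector. -/
def detD : SeqOp 2 := annih 0

/-- The creation operator `d†` of the detector. -/
def detDdag : SeqOp 2 := creat 0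

/-- The annihilation operator `D` of the field mode. -/
def fldD : SeqOp 2 := annih 1

/-- The creation operator `D†` of the field mode. -/
def fldDdag : SeqOp 2 := creat 1

/-- `Ĥ_I(τ) = (e^{-iτΔ} d + e^{iτΔ} d†) (h(τ) D + h̄(τ) D†)`. -/
def detHam (Δ : ℝ) (h : ℝ → ℂ) (τ : ℝ) : SeqOp 2 :=
  (Complex.exp (-(Complex.I * τ * Δ)) • detD + Complex.exp (Complex.I * τ * Δ) • detDdag) *
    (h τ • fldD + star (h τ) • fldDdag)

/-- The ten quadratic generators `Ĝ_1, …, Ĝ_10` of two modes. The number `c` is the normalisation of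
the single-mode squeezing generators `Ĝ_3, …, Ĝ_6`. -/
def detGen (c : ℝ) : Fin 10 → SeqOp 2 :=
  ![detDdag * fldDdag + detD * fldD,
    -Complex.I • (detD * fldD - detDdag * fldDdag),
    (c : ℂ) • (detDdag ^ 2 + detD ^ 2),
    (c : ℂ) • (-Complex.I • (detDdag ^ 2 - detD ^ 2)),
    (c : ℂ) • (fldDdag ^ 2 + fldD ^ 2),
    (c : ℂ) • (-Complex.I • (fldDdag ^ 2 - fldD ^ 2)),
    detDdag * fldD + detD * fldDdag,
    -Complex.I • (detD * fldDdag - detDdag * fldD),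
    detDdag * detD + detD * detDdag,
    fldDdag * fldD + fldD * fldDdag]

/-- The order of the factors (labels from `0`): single-mode squeezing `Ĝ_3, Ĝ_4, Ĝ_5, Ĝ_6`, two-mode
squeezing `Ĝ_1, Ĝ_2`, passive transformations `Ĝ_7, Ĝ_8, Ĝ_9, Ĝ_10`. -/
def detOrder : Fin 10 → Fin 10 := ![2, 3, 4, 5, 0, 1, 6, 7, 8, 9]

/-- The coefficients `λ_j(τ)` of `Ĥ_I(τ)` with respect to the generators. -/
def detCoeff (Δ : ℝ) (h : ℝ → ℂ) (τ : ℝ) : Fin 10 → ℝ :=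
  ![(Complex.exp (-(Complex.I * τ * Δ)) * h τ).re,
    -(Complex.exp (-(Complex.I * τ * Δ)) * h τ).im,
    0, 0, 0, 0,
    (Complex.exp (-(Complex.I * τ * Δ)) * star (h τ)).re,
    -(Complex.exp (-(Complex.I * τ * Δ)) * star (h τ)).im,
    0, 0]

end

/-! By the canonical commutation relations a quadratic operator acts linearly on the mode vector:
`[ξ_m, ξ†Hξ] = 2 (KHξ)_m` (`mode_mul_quad`). Once the dynamics exists on rapidly decreasing vectors,
the rest reduces to finite matrices.

The analytic core is the existence of the dynamics. Let `wt` be one plus the total number operator.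
Two mode operators together cost one power of `wt` (`norm_mode_mode_le`), and because they change
the number by at most two, the commutator of `wt ^ k` with a quadratic operator is bounded by `wt ^
k` itself, without loss (`exists_norm_commutator_le`). Let `P_L` be the spectral projection of `wt`
on `[0, L]`. The compressed Hamiltonians `P_L Ĥ P_L` are bounded, so their evolutions exist.
Gronwall's inequality bounds these in every weighted norm uniformly in `L`; differences of two
truncations are of order `L^{-1/2}` in the plain norm, and interpolation makes them small in every
weighted norm. The limit solves the full equation (`exists_evolution`). Symmetry of `Ĥ` conserves
the norm of a solution, which gives uniqueness and hence linearity; running time backwards gives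
inverses, and density gives unitary extensions.

Differentiating `∑ S(-t)_mn ξ_n W_t ψ`, with `S(t) = e^{-2itKH}`, shows that it solves the same
equation as `W_t ξ_m ψ`, which is the symplectic action (`IsRapidGroup.mode_mul`). Conjugated
generators are therefore quadratic again, and an ordered product of exponentials has derivative `-i`
times one quadratic operator applied to it, with matrix `∑ Ḟ_j S_1† ⋯ G_j ⋯ S_1`. A quadratic matrix
is determined by its operator, so the product is the time-ordered exponential exactly if this matrix
is `∑ λ_j G_j` (`timeOrderedExp_eq_unitaryProd_iff`). Dimension counting turns this into the
equations for `F`. Their coefficient matrix is continuously differentiable and is the identity at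
the origin, so Picard-Lindelöf applies as long as solutions are confined to a small ball
(`exists_unique_solution_implicit_ode`).

For the detector, `N_d` is the sum of `|β|²` over the creation entries of the detector row of the
symplectic matrix. The symplectic condition gives `∑|α|² - ∑|β|² = 1` for that row, so its Euclidean
norm suffices. Passive factors are unitary, squeezing of the field mode acts trivially on the row at
its place in the order, and each of the four remaining factors multiplies the squared norm by one
hyperbolic cosine. -/

noncomputable section

/-! ### Weights on occupation numbers and rapidly decreasing sequences. -/

section Sequences
variable {N : ℕ}

theorem memℓp_two_iff {ι : Type*} {f : ι → ℂ} :
    Memℓp (E := fun _ => ℂ) f 2 ↔ Summable fun i => ‖f i‖ ^ 2 := by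
  rw [memℓp_gen_iff (by simp)]
  simp

/-- The weight `1 + ∑ n_i` of an occupation number sequence. -/
def occWeight (n : Occ N) : ℝ := ((∑ i, n i : ℕ) : ℝ) + 1

theorem one_le_occWeight (n : Occ N) : 1 ≤ occWeight n := by
  unfold occWeight; linarith [Nat.cast_nonneg (α := ℝ) (∑ i, n i)]

theorem occWeight_pos (n : Occ N) : 0 < occWeight n := zero_lt_one.trans_le (one_le_occWeight n)

theorem occWeight_add_single (n : Occ N) (k : Fin N) :
    occWeight (n + Pi.single k 1) = occWeight n + 1 := by
  simp [occWeight, Finset.sum_add_distrib]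

theorem occ_lt_weight (n : Occ N) (k : Fin N) : (n k : ℝ) + 1 ≤ occWeight n := by
  unfold occWeight
  have : n k ≤ ∑ i, n i := Finset.single_le_sum (fun _ _ => Nat.zero_le _) (Finset.mem_univ k)
  have : (n k : ℝ) ≤ ((∑ i, n i : ℕ) : ℝ) := by exact_mod_cast this
  linarith

theorem occ_sub_add_single {n : Occ N} {k : Fin N} (h : n k ≠ 0) :
    n - Pi.single k 1 + Pi.single k 1 = n := by
  funext i
  by_cases hi : i = k
  · subst hi; simp; omega
  · simp [hi]

theorem occ_add_sub_single (n : Occ N) (k : Fin N) :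
    n + Pi.single k 1 - Pi.single k 1 = n := by
  funext i; simp

theorem occ_add_single_injective (k : Fin N) :
    Function.Injective fun n : Occ N => n + Pi.single k 1 :=
  add_left_injective _

theorem not_mem_range_add_single {n : Occ N} {k : Fin N}
    (h : n ∉ Set.range fun n : Occ N => n + Pi.single k 1) : n k = 0 := by
  by_contra h0
  exact h ⟨n - Pi.single k 1, occ_sub_add_single h0⟩

/-- Sequences that remain square summable after multiplication by every power of the weight. -/
def RapidSeq (f : Occ N → ℂ) : Prop :=
  ∀ k : ℕ, Summable fun n => (occWeight n ^ k * ‖f n‖) ^ 2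

/-- With `t` the total occupation, `(1 + t)^{2k} ≤ 2^{2k} (1 + t^{2k})`. A weight that is at least
one has the advantage that its powers give an increasing scale of norms. -/
theorem rapidlyDecreasing_iff (ψ : Fock N) : RapidlyDecreasing ψ ↔ RapidSeq (ψ : Occ N → ℂ) := by
  constructor
  · intro h k
    have h0 := h 0
    have hk := h k
    refine Summable.of_nonneg_of_le (fun n => sq_nonneg _) (fun n => ?_)
      (((h0.add hk).mul_left ((2 : ℝ) ^ (2 * k))))
    have ht : (0 : ℝ) ≤ ((∑ i, n i : ℕ) : ℝ) := Nat.cast_nonneg _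
    have h1 : occWeight n ^ (2 * k) ≤
        2 ^ (2 * k) * (1 + ((∑ i, n i : ℕ) : ℝ) ^ (2 * k)) := by
      unfold occWeight
      generalize ((∑ i, n i : ℕ) : ℝ) = t at *
      rcases le_total t 1 with h | h
      · calc (t + 1) ^ (2 * k) ≤ 2 ^ (2 * k) := by gcongr; linarith
          _ ≤ _ := le_mul_of_one_le_right (by positivity) (by linarith [pow_nonneg ht (2 * k)])
      · calc (t + 1) ^ (2 * k) ≤ (2 * t) ^ (2 * k) := by gcongr; linarith
          _ = 2 ^ (2 * k) * t ^ (2 * k) := by rw [mul_pow]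
          _ ≤ _ := by gcongr; linarith
    calc (occWeight n ^ k * ‖ψ n‖) ^ 2 = occWeight n ^ (2 * k) * ‖ψ n‖ ^ 2 := by ring
      _ ≤ (2 ^ (2 * k) * (1 + ((∑ i, n i : ℕ) : ℝ) ^ (2 * k))) * ‖ψ n‖ ^ 2 := by gcongr
      _ = _ := by ring
  · intro h k
    refine Summable.of_nonneg_of_le (fun n => sq_nonneg _) (fun n => ?_) (h k)
    have ht : (0 : ℝ) ≤ ((∑ i, n i : ℕ) : ℝ) := Nat.cast_nonneg _
    have : ((∑ i, n i : ℕ) : ℝ) ≤ occWeight n := by unfold occWeight; linarith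
    gcongr

theorem RapidSeq.memℓp {f : Occ N → ℂ} (h : RapidSeq f) : Memℓp (E := fun _ => ℂ) f 2 := by
  rw [memℓp_two_iff]; simpa using h 0

theorem RapidSeq.of_le {f g : Occ N → ℂ} (hf : RapidSeq f) (j : ℕ)
    (h : ∀ n, ‖g n‖ ≤ occWeight n ^ j * ‖f n‖) : RapidSeq g := by
  intro k
  refine Summable.of_nonneg_of_le (fun n => sq_nonneg _) (fun n => ?_) (hf (k + j))
  have := occWeight_pos n
  calc (occWeight n ^ k * ‖g n‖) ^ 2 ≤ (occWeight n ^ k * (occWeight n ^ j * ‖f n‖)) ^ 2 := by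
        gcongr; exact h n
    _ = _ := by ring

theorem RapidSeq.annih {f : Occ N → ℂ} (hf : RapidSeq f) (k : Fin N) :
    RapidSeq (annih k f) := by
  intro j
  refine Summable.of_nonneg_of_le (fun n => sq_nonneg _) (fun n => ?_)
    ((hf (j + 1)).comp_injective (occ_add_single_injective k))
  have hw := one_le_occWeight n
  have h1 : Real.sqrt (n k + 1 : ℝ) ≤ occWeight n := by
    rw [Real.sqrt_le_left (by linarith)]
    nlinarith [occ_lt_weight n k]
  simp only [_root_.annih, LinearMap.coe_mk, AddHom.coe_mk, norm_mul, Complex.norm_real,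
    Function.comp, occWeight_add_single, Real.norm_eq_abs, abs_of_nonneg (Real.sqrt_nonneg _)]
  have hw2 : occWeight n ≤ occWeight n + 1 := by linarith
  calc (occWeight n ^ j * (√(↑(n k) + 1) * ‖f (n + Pi.single k 1)‖)) ^ 2
      ≤ ((occWeight n + 1) ^ j * ((occWeight n + 1) * ‖f (n + Pi.single k 1)‖)) ^ 2 := by
        gcongr; linarith
    _ = _ := by ring

theorem RapidSeq.creat {f : Occ N → ℂ} (hf : RapidSeq f) (k : Fin N) :
    RapidSeq (creat k f) := by
  intro j
  rw [← (occ_add_single_injective k).summable_iff]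
  · refine Summable.of_nonneg_of_le (fun n => sq_nonneg _) (fun n => ?_)
      ((hf (j + 1)).mul_left ((2 : ℝ) ^ (2 * j)))
    have hw := one_le_occWeight n
    have h1 : Real.sqrt (n k + 1 : ℝ) ≤ occWeight n := by
      rw [Real.sqrt_le_left (by linarith)]
      nlinarith [occ_lt_weight n k]
    simp only [_root_.creat, LinearMap.coe_mk, AddHom.coe_mk, norm_mul, Complex.norm_real,
      Function.comp, occWeight_add_single, Real.norm_eq_abs, abs_of_nonneg (Real.sqrt_nonneg _),
      occ_add_sub_single, Pi.add_apply, Pi.single_eq_same, Nat.cast_add, Nat.cast_one]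
    calc ((occWeight n + 1) ^ j * (√(↑(n k) + 1) * ‖f n‖)) ^ 2
        ≤ ((2 * occWeight n) ^ j * (occWeight n * ‖f n‖)) ^ 2 := by
          gcongr; linarith
      _ = _ := by ring
  · intro n hn
    simp [_root_.creat, not_mem_range_add_single hn]

/-- Multiplication by the weight, the operator `1 + ∑ a_k† a_k`. -/
def weightOp (N : ℕ) : SeqOp N where
  toFun f n := (occWeight n : ℂ) * f n
  map_add' f g := by funext n; simp [mul_add]
  map_smul' c f := by funext n; simp [mul_left_comm]

theorem RapidSeq.weight {f : Occ N → ℂ} (hf : RapidSeq f) : RapidSeq (weightOp N f) := by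
  refine hf.of_le 1 fun n => ?_
  simp [weightOp, abs_of_pos (occWeight_pos n)]

theorem RapidSeq.modeOp {f : Occ N → ℂ} (hf : RapidSeq f) (m : Fin N ⊕ Fin N) :
    RapidSeq (modeOp m f) := by
  rcases m with k | k
  · exact hf.annih k
  · exact hf.creat k

theorem modeOpAdj_eq (m : Fin N ⊕ Fin N) : (modeOpAdj m : SeqOp N) = modeOp m.swap := by
  rcases m with k | k <;> rfl

end Sequences

/-! ### The space of rapidly decreasing vectors, commutation relations, adjoints and first bounds.
-/

section Rapid
variable {N : ℕ}

/-- The space of rapidly decreasing vectors. -/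
def rapid (N : ℕ) : Submodule ℂ (Fock N) where
  carrier := {ψ | RapidlyDecreasing ψ}
  zero_mem' := fun k => by simp
  add_mem' := by
    intro a b ha hb
    simp only [Set.mem_ofPred_eq, rapidlyDecreasing_iff] at *
    intro k
    refine Summable.of_nonneg_of_le (fun n => sq_nonneg _) (fun n => ?_)
      (((ha k).add (hb k)).mul_left 2)
    have hw := occWeight_pos n
    have h := norm_add_le (a n) (b n)
    rw [lp.coeFn_add, Pi.add_apply]
    calc (occWeight n ^ k * ‖a n + b n‖) ^ 2 ≤ (occWeight n ^ k * (‖a n‖ + ‖b n‖)) ^ 2 := by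
          gcongr
      _ ≤ _ := by
          nlinarith [sq_nonneg (occWeight n ^ k * ‖a n‖ - occWeight n ^ k * ‖b n‖)]
  smul_mem' := by
    intro c a ha
    simp only [Set.mem_ofPred_eq, rapidlyDecreasing_iff] at *
    intro k
    refine ((ha k).mul_left (‖c‖ ^ 2)).congr fun n => ?_
    rw [lp.coeFn_smul, Pi.smul_apply, norm_smul]
    ring

instance rapidInner (N : ℕ) : Inner ℂ (rapid N) := InnerProductSpace.toInner

theorem mem_rapid {ψ : Fock N} : ψ ∈ rapid N ↔ RapidlyDecreasing ψ := Iff.rfl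

theorem rapidSeq_coe (x : rapid N) : RapidSeq ((x : Fock N) : Occ N → ℂ) :=
  (rapidlyDecreasing_iff _).1 x.2

theorem rapid_ext {x y : rapid N} (h : ∀ n, (x : Fock N) n = (y : Fock N) n) : x = y :=
  Subtype.ext (lp.ext (funext h))

/-- The element of `rapid N` given by a rapidly decreasing sequence. -/
def RapidSeq.toRapid {f : Occ N → ℂ} (hf : RapidSeq f) : rapid N :=
  ⟨⟨f, hf.memℓp⟩, (rapidlyDecreasing_iff _).2 hf⟩

theorem RapidSeq.toRapid_apply {f : Occ N → ℂ} (hf : RapidSeq f) (n : Occ N) :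
    (hf.toRapid : Fock N) n = f n := rfl

/-- The restriction to `rapid N` of an operator that preserves rapid decrease. -/
def rapidRestrict (A : SeqOp N) (hA : ∀ f, RapidSeq f → RapidSeq (A f)) :
    Module.End ℂ (rapid N) where
  toFun x := (hA _ (rapidSeq_coe x)).toRapid
  map_add' x y := rapid_ext fun n => by
    have h := congrFun (A.map_add ((x : Fock N) : Occ N → ℂ) ((y : Fock N) : Occ N → ℂ)) n
    exact h
  map_smul' c x := rapid_ext fun n => by
    have h := congrFun (A.map_smul c ((x : Fock N) : Occ N → ℂ)) n
    exact h

/-- The mode operators on rapidly decreasing vectors. -/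
def mode (m : Fin N ⊕ Fin N) : Module.End ℂ (rapid N) :=
  rapidRestrict (modeOp m) fun _ hf => hf.modeOp m

/-- The weight operator on rapidly decreasing vectors. -/
def wt : Module.End ℂ (rapid N) := rapidRestrict (weightOp N) fun _ hf => hf.weight

theorem coe_mode (m : Fin N ⊕ Fin N) (x : rapid N) :
    ((mode m x : Fock N) : Occ N → ℂ) = modeOp m (x : Fock N) := rfl

theorem mode_inl_apply (k : Fin N) (x : rapid N) (n : Occ N) :
    (mode (Sum.inl k) x : Fock N) n =
      (Real.sqrt (n k + 1 : ℝ) : ℂ) * (x : Fock N) (n + Pi.single k 1) := rfl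

theorem mode_inr_apply (k : Fin N) (x : rapid N) (n : Occ N) :
    (mode (Sum.inr k) x : Fock N) n =
      (Real.sqrt (n k : ℝ) : ℂ) * (x : Fock N) (n - Pi.single k 1) := rfl

theorem wt_apply (x : rapid N) (n : Occ N) :
    (wt x : Fock N) n = (occWeight n : ℂ) * (x : Fock N) n := rfl

theorem wt_pow_apply (k : ℕ) (x : rapid N) (n : Occ N) :
    ((wt ^ k) x : Fock N) n = (occWeight n : ℂ) ^ k * (x : Fock N) n := by
  induction k with
  | zero => simp
  | succ k ih => rw [pow_succ', Module.End.mul_apply, wt_apply, ih, pow_succ']; ring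

/-- The quadratic operator `ξ† H ξ` on rapidly decreasing vectors. -/
def quad (H : ModeMatrix N) : Module.End ℂ (rapid N) :=
  ∑ m, ∑ n, H m n • (mode m.swap * mode n)

theorem coe_quad (H : ModeMatrix N) (x : rapid N) :
    ((quad H x : Fock N) : Occ N → ℂ) = quadOp H (x : Fock N) := by
  unfold quad quadOp
  simp only [LinearMap.sum_apply, LinearMap.smul_apply, Submodule.coe_sum, Submodule.coe_smul,
    lp.coeFn_sum, lp.coeFn_smul, Module.End.mul_apply, coe_mode, modeOpAdj_eq]

theorem rapid_coe_add_apply (x y : rapid N) (n : Occ N) :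
    ((x + y : rapid N) : Fock N) n = (x : Fock N) n + (y : Fock N) n := rfl
theorem rapid_coe_sub_apply (x y : rapid N) (n : Occ N) :
    ((x - y : rapid N) : Fock N) n = (x : Fock N) n - (y : Fock N) n := rfl
theorem rapid_coe_smul_apply (c : ℂ) (x : rapid N) (n : Occ N) :
    ((c • x : rapid N) : Fock N) n = c * (x : Fock N) n := rfl

theorem ofReal_sqrt_mul_self {a : ℝ} (h : 0 ≤ a) :
    ((Real.sqrt a : ℝ) : ℂ) * (Real.sqrt a : ℂ) = a := by
  rw [← Complex.ofReal_mul, Real.mul_self_sqrt h]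

theorem creat_annih_apply (k : Fin N) (x : rapid N) (n : Occ N) :
    (mode (Sum.inr k) (mode (Sum.inl k) x) : Fock N) n = (n k : ℂ) * (x : Fock N) n := by
  rw [mode_inr_apply, mode_inl_apply]
  by_cases h : n k = 0
  · simp [h]
  · rw [occ_sub_add_single h]
    have : (((n - Pi.single k 1 : Occ N) k : ℕ) : ℝ) + 1 = n k := by
      simp only [Pi.sub_apply, Pi.single_eq_same]
      rw [Nat.cast_sub (by omega)]; simp
    rw [this, ← mul_assoc, ofReal_sqrt_mul_self (Nat.cast_nonneg _)]
    simp

theorem annih_creat_apply (k : Fin N) (x : rapid N) (n : Occ N) :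
    (mode (Sum.inl k) (mode (Sum.inr k) x) : Fock N) n = (n k + 1 : ℂ) * (x : Fock N) n := by
  rw [mode_inl_apply, mode_inr_apply, occ_add_sub_single, ← mul_assoc]
  have : (((n + Pi.single k 1 : Occ N) k : ℕ) : ℝ) = n k + 1 := by simp
  rw [this, ofReal_sqrt_mul_self (by positivity)]
  push_cast; ring

theorem mode_comm_annih (k l : Fin N) :
    (mode (Sum.inl k) * mode (Sum.inl l) : Module.End ℂ (rapid N)) =
      mode (Sum.inl l) * mode (Sum.inl k) := by
  ext1 x; refine rapid_ext fun n => ?_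
  simp only [Module.End.mul_apply, mode_inl_apply]
  by_cases h : k = l
  · subst h; rfl
  · rw [add_right_comm]
    simp [h, Ne.symm h]
    ring

theorem mode_comm_creat (k l : Fin N) :
    (mode (Sum.inr k) * mode (Sum.inr l) : Module.End ℂ (rapid N)) =
      mode (Sum.inr l) * mode (Sum.inr k) := by
  ext1 x; refine rapid_ext fun n => ?_
  simp only [Module.End.mul_apply, mode_inr_apply]
  by_cases h : k = l
  · subst h; rfl
  · rw [tsub_right_comm]
    simp [h, Ne.symm h]
    ring

theorem mode_annih_creat (k l : Fin N) :
    (mode (Sum.inl k) * mode (Sum.inr l) : Module.End ℂ (rapid N)) =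
      mode (Sum.inr l) * mode (Sum.inl k) + (if k = l then 1 else 0) := by
  ext1 x; refine rapid_ext fun n => ?_
  by_cases h : k = l
  · subst h
    simp only [if_true, LinearMap.add_apply, Module.End.mul_apply, Module.End.one_apply,
      rapid_coe_add_apply, annih_creat_apply, creat_annih_apply]
    ring
  · simp only [h, if_false, add_zero, Module.End.mul_apply, mode_inl_apply, mode_inr_apply]
    -- Natural subtraction truncates when `n l = 0`, but then the factor `√(n l)` annihilates both
    -- sides.
    by_cases hl : n l = 0
    · simp [h, hl, Ne.symm h]
    · have : n + Pi.single k 1 - Pi.single l 1 = n - Pi.single l 1 + Pi.single k 1 := by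
        conv_lhs => rw [← occ_sub_add_single hl, add_right_comm, occ_add_sub_single]
      rw [this]
      simp [h, Ne.symm h]
      ring

/-- The canonical commutation relations `[ξ_m, ξ_n†] = K_mn`. -/
theorem mode_ccr (m n : Fin N ⊕ Fin N) :
    (mode m * mode n.swap : Module.End ℂ (rapid N)) =
      mode n.swap * mode m + symK N m n • 1 := by
  rcases m with k | k <;> rcases n with l | l <;>
    simp only [Sum.swap_inl, Sum.swap_inr, symK, fromBlocks_apply₁₁, fromBlocks_apply₁₂,
      fromBlocks_apply₂₁, fromBlocks_apply₂₂, Matrix.zero_apply, zero_smul, add_zero]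
  · rw [mode_annih_creat, one_apply]; split_ifs <;> simp
  · exact mode_comm_annih k l
  · exact mode_comm_creat k l
  · rw [mode_annih_creat, Matrix.neg_apply, one_apply]
    by_cases h : k = l
    · subst h; simp only [if_true]; module
    · simp [h, Ne.symm h]

theorem rapid_inner_eq (x y : rapid N) : inner ℂ x y =
    ∑' n, (starRingEnd ℂ) ((x : Fock N) n) * (y : Fock N) n := by
  rw [Submodule.coe_inner, lp.inner_eq_tsum]
  simp [mul_comm]

/-- Shift the summation index by one quantum; the occupation numbers missed by the shift have `n k =
0`, where the creation operator contributes `√0`. -/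
theorem annih_adjoint (k : Fin N) (x y : rapid N) :
    inner ℂ (mode (Sum.inl k) x) y = inner ℂ x (mode (Sum.inr k) y) := by
  have h := (occ_add_single_injective k).tsum_eq
    (f := fun n => (starRingEnd ℂ) ((x : Fock N) n) * (mode (Sum.inr k) y : Fock N) n) (by
      intro n hn
      by_contra h
      simp [mode_inr_apply, not_mem_range_add_single h] at hn)
  rw [rapid_inner_eq, rapid_inner_eq, ← h]
  congr 1; funext n
  rw [mode_inl_apply, mode_inr_apply, occ_add_sub_single]
  simp
  ring

/-- `ξ_m` and `ξ_m†` are adjoint to each other. -/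
theorem mode_adjoint (m : Fin N ⊕ Fin N) (x y : rapid N) :
    inner ℂ (mode m x) y = inner ℂ x (mode m.swap y) := by
  rcases m with k | k
  · exact annih_adjoint k x y
  · rw [← inner_conj_symm (𝕜 := ℂ), Sum.swap_inr, ← annih_adjoint, inner_conj_symm]

/-- The amount by which a mode operator changes the total occupation number. -/
def modeShift : Fin N ⊕ Fin N → ℂ := Sum.elim (fun _ => -1) (fun _ => 1)

/-- This ladder relation is the source of all commutator estimates: passing a mode operator only
shifts the weight by a constant. -/
theorem wt_mode (m : Fin N ⊕ Fin N) :
    (wt * mode m : Module.End ℂ (rapid N)) = mode m * (wt + modeShift m • 1) := by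
  ext1 x; refine rapid_ext fun n => ?_
  rcases m with k | k
  · simp only [Module.End.mul_apply, wt_apply, mode_inl_apply, LinearMap.add_apply,
      rapid_coe_add_apply, occWeight_add_single, LinearMap.smul_apply, Module.End.one_apply,
      rapid_coe_smul_apply, modeShift, Sum.elim_inl]
    push_cast; ring
  · simp only [Module.End.mul_apply, wt_apply, mode_inr_apply, LinearMap.add_apply,
      rapid_coe_add_apply, LinearMap.smul_apply, Module.End.one_apply,
      rapid_coe_smul_apply, modeShift, Sum.elim_inr]
    by_cases h : n k = 0
    · simp [h]
    · have := occWeight_add_single (n - Pi.single k 1) k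
      rw [occ_sub_add_single h] at this
      rw [this]; push_cast; ring

theorem rapid_norm_mono {x y : rapid N} (h : ∀ n, ‖(x : Fock N) n‖ ≤ ‖(y : Fock N) n‖) :
    ‖x‖ ≤ ‖y‖ :=
  lp.norm_mono (by simp) h

theorem wt_symm (x y : rapid N) : inner ℂ (wt x) y = inner ℂ x (wt y) := by
  rw [rapid_inner_eq, rapid_inner_eq]
  congr 1; funext n
  simp [wt_apply]; ring

theorem wt_pow_symm (k : ℕ) (x y : rapid N) :
    inner ℂ ((wt ^ k) x) y = inner ℂ x ((wt ^ k) y) := by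
  induction k generalizing x y with
  | zero => simp
  | succ k ih =>
    rw [pow_succ, Module.End.mul_apply, ih, wt_symm, ← Module.End.mul_apply, ← pow_succ', pow_succ]

theorem norm_wt_pow_mono {i j : ℕ} (h : i ≤ j) (x : rapid N) :
    ‖(wt ^ i) x‖ ≤ ‖(wt ^ j) x‖ := by
  refine rapid_norm_mono fun n => ?_
  rw [wt_pow_apply, wt_pow_apply, norm_mul, norm_mul, norm_pow, norm_pow]
  have h1 : 1 ≤ ‖(occWeight n : ℂ)‖ := by
    rw [Complex.norm_real, Real.norm_eq_abs, abs_of_pos (occWeight_pos n)]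
    exact one_le_occWeight n
  gcongr

theorem norm_le_norm_wt (x : rapid N) : ‖x‖ ≤ ‖wt x‖ := by
  simpa using norm_wt_pow_mono (Nat.zero_le 1) x

/-- Cauchy-Schwarz, with half of the weight moved across the inner product. As an interpolation
inequality it turns convergence in norm, together with boundedness in all weighted norms, into
convergence in all weighted norms. -/
theorem norm_wt_pow_sq_le (k : ℕ) (x : rapid N) :
    ‖(wt ^ k) x‖ ^ 2 ≤ ‖x‖ * ‖(wt ^ (2 * k)) x‖ := by
  have h : ((‖(wt ^ k) x‖ : ℝ) : ℂ) ^ 2 = inner ℂ x ((wt ^ (2 * k)) x) := by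
    rw [two_mul, pow_add, Module.End.mul_apply, ← wt_pow_symm]
    exact (inner_self_eq_norm_sq_to_K (𝕜 := ℂ) _).symm
  calc ‖(wt ^ k) x‖ ^ 2 = ‖((‖(wt ^ k) x‖ : ℝ) : ℂ) ^ 2‖ := by simp
    _ ≤ _ := by rw [h]; exact norm_inner_le_norm _ _

theorem modeShift_norm (m : Fin N ⊕ Fin N) : ‖modeShift m‖ = 1 := by
  rcases m with k | k <;> simp [modeShift]

theorem norm_mode_swap_mode_le (m : Fin N ⊕ Fin N) (x : rapid N) :
    ‖mode m.swap (mode m x)‖ ≤ ‖wt x‖ := by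
  refine rapid_norm_mono fun n => ?_
  rw [wt_apply, norm_mul, Complex.norm_real, Real.norm_eq_abs, abs_of_pos (occWeight_pos n)]
  rcases m with k | k
  · rw [Sum.swap_inl, creat_annih_apply, norm_mul]
    gcongr
    simpa using (by linarith [occ_lt_weight n k] : (n k : ℝ) ≤ occWeight n)
  · rw [Sum.swap_inr, annih_creat_apply, norm_mul]
    gcongr
    have : ‖((n k : ℂ) + 1)‖ = (n k : ℝ) + 1 := by
      rw [← Nat.cast_one, ← Nat.cast_add, Complex.norm_natCast]; simp
    rw [this]; exact occ_lt_weight n k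

theorem norm_mode_sq_le (m : Fin N ⊕ Fin N) (x : rapid N) :
    ‖mode m x‖ ^ 2 ≤ ‖x‖ * ‖mode m.swap (mode m x)‖ := by
  have h : ((‖mode m x‖ : ℝ) : ℂ) ^ 2 = inner ℂ x (mode m.swap (mode m x)) := by
    rw [← mode_adjoint]
    exact (inner_self_eq_norm_sq_to_K (𝕜 := ℂ) _).symm
  calc ‖mode m x‖ ^ 2 = ‖((‖mode m x‖ : ℝ) : ℂ) ^ 2‖ := by simp
    _ ≤ _ := by rw [h]; exact norm_inner_le_norm _ _

theorem norm_mode_le (m : Fin N ⊕ Fin N) (x : rapid N) : ‖mode m x‖ ≤ ‖wt x‖ := by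
  have h := norm_mode_sq_le m x
  have h1 := norm_mode_swap_mode_le m x
  have h2 := norm_le_norm_wt x
  refine le_of_sq_le_sq (h.trans ?_) (norm_nonneg _)
  rw [sq]
  gcongr

theorem norm_wt_mode_le (m : Fin N ⊕ Fin N) (x : rapid N) :
    ‖(wt + modeShift m • 1 : Module.End ℂ (rapid N)) x‖ ≤ 2 * ‖wt x‖ := by
  rw [LinearMap.add_apply, LinearMap.smul_apply, Module.End.one_apply]
  refine (norm_add_le _ _).trans ?_
  rw [norm_smul, modeShift_norm]
  linarith [norm_le_norm_wt x]

end Rapid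

/-! ### Quadratic operators relative to powers of the weight. -/

section QuadraticBounds
variable {N : ℕ}

/-- Both forms are diagonal in the occupation basis, with `n_k` or `n_k + 1` against the weight. A
single mode operator thus costs only half a power of `wt`, so that two of them cost one. -/
theorem norm_mode_sq_le_inner (m : Fin N ⊕ Fin N) (x : rapid N) :
    ‖mode m x‖ ^ 2 ≤ (inner ℂ x (wt x)).re := by
  have h : (‖mode m x‖ ^ 2 : ℝ) = (inner ℂ x (mode m.swap (mode m x))).re := by
    rw [← mode_adjoint]
    exact norm_sq_eq_re_inner (𝕜 := ℂ) (mode m x)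
  rw [h]
  have h1 := Complex.hasSum_re (lp.hasSum_inner (𝕜 := ℂ) (x : Fock N)
    (mode m.swap (mode m x) : Fock N))
  have h2 := Complex.hasSum_re (lp.hasSum_inner (𝕜 := ℂ) (x : Fock N) (wt x : Fock N))
  refine hasSum_le (fun n => ?_) h1 h2
  have hx : 0 ≤ Complex.normSq ((x : Fock N) n) := Complex.normSq_nonneg _
  have e : ∀ r : ℝ, (inner ℂ ((x : Fock N) n) ((r : ℂ) * (x : Fock N) n)).re =
      r * Complex.normSq ((x : Fock N) n) := by
    intro r
    simp [Complex.normSq_apply]; ring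
  have hw : (wt x : Fock N) n = ((occWeight n : ℝ) : ℂ) * (x : Fock N) n := wt_apply x n
  rw [hw, e]
  rcases m with k | k
  · have : (mode (Sum.inl k).swap (mode (Sum.inl k) x) : Fock N) n =
        ((n k : ℝ) : ℂ) * (x : Fock N) n := by
      rw [Sum.swap_inl, creat_annih_apply]; simp
    rw [this, e]
    gcongr
    linarith [occ_lt_weight n k]
  · have : (mode (Sum.inr k).swap (mode (Sum.inr k) x) : Fock N) n =
        ((n k + 1 : ℝ) : ℂ) * (x : Fock N) n := by
      rw [Sum.swap_inr, annih_creat_apply]; simp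
    rw [this, e]
    gcongr
    exact occ_lt_weight n k

/-- With the form bound and the ladder relation, `‖ξ_p ξ_q x‖² ≤ ⟨ξ_q x, wt ξ_q x⟩ = ⟨ξ_q† ξ_q x,
(wt ± 1) x⟩`, and the two vectors have norms at most `‖wt x‖` and `2 ‖wt x‖`. -/
theorem norm_mode_mode_le (p q : Fin N ⊕ Fin N) (x : rapid N) :
    ‖mode p (mode q x)‖ ≤ 2 * ‖wt x‖ := by
  have h := norm_mode_sq_le_inner p (mode q x)
  have h1 : inner ℂ (mode q x) (wt (mode q x)) =
      inner ℂ (mode q.swap (mode q x)) ((wt + modeShift q • 1 : Module.End ℂ (rapid N)) x) := by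
    rw [← Module.End.mul_apply wt, wt_mode, Module.End.mul_apply]
    have := mode_adjoint q.swap (mode q x)
      ((wt + modeShift q • 1 : Module.End ℂ (rapid N)) x)
    rw [Sum.swap_swap] at this
    exact this.symm
  rw [h1] at h
  have h2 : ‖mode p (mode q x)‖ ^ 2 ≤ ‖wt x‖ * (2 * ‖wt x‖) := by
    refine h.trans ((Complex.re_le_norm _).trans ((norm_inner_le_norm _ _).trans ?_))
    gcongr
    · exact norm_mode_swap_mode_le q x
    · exact norm_wt_mode_le q x
  refine le_of_sq_le_sq (h2.trans ?_) (by positivity)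
  nlinarith [norm_nonneg (wt x)]

theorem wt_pow_mode_mode (p q : Fin N ⊕ Fin N) (k : ℕ) :
    (wt ^ k * (mode p * mode q) : Module.End ℂ (rapid N)) =
      (mode p * mode q) * (wt + (modeShift p + modeShift q) • 1) ^ k := by
  have h : SemiconjBy (mode p * mode q : Module.End ℂ (rapid N))
      (wt + (modeShift p + modeShift q) • 1) wt := by
    change (mode p * mode q) * _ = wt * (mode p * mode q)
    rw [← mul_assoc wt, wt_mode, mul_assoc (mode p) (wt + modeShift p • 1), add_mul, wt_mode,
      mul_assoc]
    congr 1
    simp only [mul_add, smul_mul_assoc, one_mul, mul_smul_comm, mul_one]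
    module
  exact ((h.pow_right k).eq).symm

/-- The leading powers cancel, so the difference has degree `k - 1` in `wt`. The range `‖s‖ ≤ 2` is
the largest change of number by two mode operators. -/
theorem exists_norm_shift_pow_sub_le (k : ℕ) : ∃ C : ℝ, 0 ≤ C ∧ ∀ s : ℂ, ‖s‖ ≤ 2 →
    ∀ x : rapid N, ‖((wt + s • 1) ^ k - wt ^ k : Module.End ℂ (rapid N)) (wt x)‖ ≤
      C * ‖(wt ^ k) x‖ := by
  induction k with
  | zero => exact ⟨0, le_rfl, fun s _ x => by simp⟩
  | succ k ih =>
    obtain ⟨C, hC, h⟩ := ih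
    -- The three summands of the recursion `e` below contribute `C`, `2C` and `2`.
    refine ⟨3 * C + 2, by positivity, fun s hs x => ?_⟩
    have e : ((wt + s • 1) ^ (k + 1) - wt ^ (k + 1) : Module.End ℂ (rapid N)) =
        ((wt + s • 1) ^ k - wt ^ k) * wt + s • ((wt + s • 1) ^ k - wt ^ k) + s • wt ^ k := by
      simp only [pow_succ, mul_add, mul_smul_comm, mul_one, sub_mul]
      module
    rw [e]
    simp only [LinearMap.add_apply, LinearMap.smul_apply, Module.End.mul_apply]
    have h1 := h s hs (wt x)
    have h2 := h s hs x
    have e1 : (wt ^ (k + 1)) x = (wt ^ k) (wt x) := by rw [pow_succ]; rfl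
    rw [← e1] at h1 ⊢
    have h3 : ‖(wt ^ k) x‖ ≤ ‖(wt ^ (k + 1)) x‖ := norm_wt_pow_mono (Nat.le_succ k) x
    refine (norm_add_le _ _).trans ((add_le_add_left (norm_add_le _ _) _).trans ?_)
    rw [norm_smul, norm_smul]
    have h4 : ‖s‖ * ‖((wt + s • 1) ^ k - wt ^ k : Module.End ℂ (rapid N)) (wt x)‖ ≤
        2 * (C * ‖(wt ^ (k + 1)) x‖) := by
      gcongr
      exact h2.trans (by gcongr)
    have h5 : ‖s‖ * ‖(wt ^ (k + 1)) x‖ ≤ 2 * ‖(wt ^ (k + 1)) x‖ := by gcongr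
    linarith

/-- The sum of the absolute values of the entries of a matrix. -/
def entrySum (H : ModeMatrix N) : ℝ := ∑ m, ∑ n, ‖H m n‖

theorem entrySum_nonneg (H : ModeMatrix N) : 0 ≤ entrySum H :=
  Finset.sum_nonneg fun _ _ => Finset.sum_nonneg fun _ _ => norm_nonneg _

theorem continuous_entrySum : Continuous (entrySum : ModeMatrix N → ℝ) := by
  unfold entrySum; fun_prop

theorem quad_apply (H : ModeMatrix N) (x : rapid N) :
    quad H x = ∑ m, ∑ n, H m n • mode m.swap (mode n x) := by
  simp [quad, LinearMap.sum_apply]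

theorem norm_sum_smul_le {H : ModeMatrix N} {v : Fin N ⊕ Fin N → Fin N ⊕ Fin N → rapid N} {c : ℝ}
    (h : ∀ m n, ‖v m n‖ ≤ c) : ‖∑ m, ∑ n, H m n • v m n‖ ≤ entrySum H * c := by
  unfold entrySum
  rw [Finset.sum_mul]
  refine norm_sum_le_of_le _ fun m _ => ?_
  rw [Finset.sum_mul]
  refine norm_sum_le_of_le _ fun n _ => ?_
  rw [norm_smul]
  gcongr
  exact h m n

theorem norm_quad_le (H : ModeMatrix N) (x : rapid N) :
    ‖quad H x‖ ≤ entrySum H * (2 * ‖wt x‖) := by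
  rw [quad_apply]
  exact norm_sum_smul_le fun m n => norm_mode_mode_le _ _ _

/-- The commutator consists of terms `ξ† ξ ((wt + s)^k - wt^k)`: one power of `wt` from the mode
operators, `k - 1` from the difference. No power is lost, which is what makes Gronwall's inequality
applicable in each weighted norm. -/
theorem exists_norm_commutator_le (k : ℕ) : ∃ C : ℝ, 0 ≤ C ∧ ∀ (H : ModeMatrix N) (x : rapid N),
    ‖(wt ^ k) (quad H x) - quad H ((wt ^ k) x)‖ ≤ C * entrySum H * ‖(wt ^ k) x‖ := by
  obtain ⟨C, hC, h⟩ := exists_norm_shift_pow_sub_le (N := N) k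
  refine ⟨2 * C, by positivity, fun H x => ?_⟩
  have e : (wt ^ k) (quad H x) - quad H ((wt ^ k) x) =
      ∑ m, ∑ n, H m n • mode m.swap (mode n
        (((wt + (modeShift m.swap + modeShift n) • 1) ^ k - wt ^ k : Module.End ℂ (rapid N)) x)) := by
    rw [quad_apply, quad_apply, map_sum, ← Finset.sum_sub_distrib]
    refine Finset.sum_congr rfl fun m _ => ?_
    rw [map_sum, ← Finset.sum_sub_distrib]
    refine Finset.sum_congr rfl fun n _ => ?_
    rw [map_smul, ← smul_sub]
    congr 1
    have := congrArg (fun A : Module.End ℂ (rapid N) => A x) (wt_pow_mode_mode m.swap n k)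
    simp only [Module.End.mul_apply] at this
    rw [this, LinearMap.sub_apply, map_sub, map_sub]
  rw [e]
  refine (norm_sum_smul_le (c := 2 * (C * ‖(wt ^ k) x‖)) fun m n => ?_).trans (by
    apply le_of_eq; ring)
  refine (norm_mode_mode_le _ _ _).trans ?_
  gcongr
  have hs : ‖modeShift m.swap + modeShift n‖ ≤ 2 := by
    refine (norm_add_le _ _).trans ?_
    rw [modeShift_norm, modeShift_norm]; norm_num
  refine le_trans (le_of_eq ?_) (h _ hs x)
  congr 1
  have hc : Commute (wt : Module.End ℂ (rapid N))
      ((wt + (modeShift m.swap + modeShift n) • 1) ^ k - wt ^ k) := by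
    refine Commute.sub_right (Commute.pow_right ?_ _) (Commute.pow_right (Commute.refl _) _)
    exact (Commute.refl _).add_right ((Commute.one_right _).smul_right _)
  exact congrArg (fun A : Module.End ℂ (rapid N) => A x) hc.eq

theorem exists_norm_wt_pow_quad_le (k : ℕ) :
    ∃ C : ℝ, 0 ≤ C ∧ ∀ (H : ModeMatrix N) (x : rapid N),
      ‖(wt ^ k) (quad H x)‖ ≤ C * entrySum H * ‖(wt ^ (k + 1)) x‖ := by
  obtain ⟨C, hC, h⟩ := exists_norm_commutator_le (N := N) k
  refine ⟨C + 2, by positivity, fun H x => ?_⟩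
  have h1 := h H x
  have h2 := norm_quad_le H ((wt ^ k) x)
  rw [← Module.End.mul_apply wt (wt ^ k), ← pow_succ'] at h2
  have h3 : ‖(wt ^ k) x‖ ≤ ‖(wt ^ (k + 1)) x‖ := norm_wt_pow_mono (Nat.le_succ k) x
  have h4 : C * entrySum H * ‖(wt ^ k) x‖ ≤ C * entrySum H * ‖(wt ^ (k + 1)) x‖ := by
    have := entrySum_nonneg H
    gcongr
  have h5 := norm_le_norm_sub_add ((wt ^ k) (quad H x)) (quad H ((wt ^ k) x))
  linarith

theorem rapid_inner_smul_left (c : ℂ) (x y : rapid N) :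
    inner ℂ (c • x) y = (starRingEnd ℂ) c * inner ℂ x y :=
  inner_smul_left (𝕜 := ℂ) (E := Fock N) (x : Fock N) (y : Fock N) c

theorem rapid_inner_smul_right (c : ℂ) (x y : rapid N) :
    inner ℂ x (c • y) = c * inner ℂ x y :=
  inner_smul_right (𝕜 := ℂ) (E := Fock N) (x : Fock N) (y : Fock N) c

/-- Adjunction reverses each product `ξ_m† ξ_n`, so the conjugated coefficients have to be
transposed. -/
theorem quad_adjoint (H : ModeMatrix N) (x y : rapid N) :
    inner ℂ (quad H x) y = inner ℂ x (quad Hᴴ y) := by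
  rw [quad_apply, quad_apply]
  simp only [sum_inner, inner_sum, rapid_inner_smul_left, rapid_inner_smul_right, mode_adjoint, Sum.swap_swap,
    conjTranspose_apply]
  rw [Finset.sum_comm]
  rfl

theorem IsQuadMatrix.isHermitian {H : ModeMatrix N} (h : IsQuadMatrix H) : Hᴴ = H := by
  obtain ⟨A, B, hA, hB, rfl⟩ := h
  rw [fromBlocks_conjTranspose]
  have h1 : (A.map star)ᴴ = A.map star := by
    conv_rhs => rw [← hA]
    ext i j; simp
  have h2 : Bᴴ = B.map star := by
    conv_rhs => rw [← hB]
    ext i j; simp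
  have h3 : (B.map star)ᴴ = B := by
    conv_rhs => rw [← hB]
    ext i j; simp
  rw [hA, h1, h2, h3]

theorem quad_symm {H : ModeMatrix N} (h : IsQuadMatrix H) (x y : rapid N) :
    inner ℂ (quad H x) y = inner ℂ x (quad H y) := by
  rw [quad_adjoint, h.isHermitian]

end QuadraticBounds

/-! ### Spectral cutoffs of the weight, compressed Hamiltonians and density. -/

section Truncation
variable {N : ℕ}

theorem rapidSeq_cut (L : ℕ) (x : Fock N) :
    RapidSeq fun n => if occWeight n ≤ L then x n else 0 := by
  intro k
  have hx : Summable fun n => ‖x n‖ ^ 2 := memℓp_two_iff.1 (lp.memℓp x)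
  refine Summable.of_nonneg_of_le (fun n => sq_nonneg _) (fun n => ?_)
    (hx.mul_left (((L : ℝ) ^ k) ^ 2))
  rw [← mul_pow]
  have := occWeight_pos n
  dsimp only
  split_ifs with h
  · gcongr
  · simp; positivity

/-- The spectral projection of the weight operator on `[0, L]`. -/
def cut (L : ℕ) : Fock N →ₗ[ℂ] rapid N where
  toFun x := (rapidSeq_cut L x).toRapid
  map_add' x y := rapid_ext fun n => by
    rw [rapid_coe_add_apply]
    simp only [RapidSeq.toRapid_apply, lp.coeFn_add, Pi.add_apply]
    split_ifs <;> simp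
  map_smul' c x := rapid_ext fun n => by
    rw [RingHom.id_apply, rapid_coe_smul_apply]
    simp only [RapidSeq.toRapid_apply, lp.coeFn_smul, Pi.smul_apply]
    split_ifs <;> simp

theorem cut_apply (L : ℕ) (x : Fock N) (n : Occ N) :
    (cut L x : Fock N) n = if occWeight n ≤ L then x n else 0 := rfl

theorem cut_cut {L M : ℕ} (h : L ≤ M) (x : Fock N) : cut M (cut L x : Fock N) = cut L x := by
  refine rapid_ext fun n => ?_
  rw [cut_apply, cut_apply]
  have : (L : ℝ) ≤ M := by exact_mod_cast h
  split_ifs with h1 h2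
  · rfl
  · rfl
  · linarith
  · rfl

theorem wt_pow_cut (L k : ℕ) (x : rapid N) : (wt ^ k) (cut L (x : Fock N)) = cut L ((wt ^ k) x) := by
  refine rapid_ext fun n => ?_
  rw [wt_pow_apply, cut_apply, cut_apply, wt_pow_apply]
  split_ifs <;> simp

theorem norm_wt_pow_cut_le (L k : ℕ) (x : Fock N) : ‖(wt ^ k) (cut L x)‖ ≤ (L : ℝ) ^ k * ‖x‖ := by
  have h : ‖((wt ^ k) (cut L x) : Fock N)‖ ≤ ‖((L : ℂ) ^ k) • x‖ := by
    refine lp.norm_mono (by simp) fun n => ?_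
    rw [wt_pow_apply, cut_apply, lp.coeFn_smul, Pi.smul_apply, norm_mul, norm_smul, norm_pow,
      norm_pow, Complex.norm_real, Real.norm_eq_abs, abs_of_pos (occWeight_pos n),
      Complex.norm_natCast]
    have := occWeight_pos n
    split_ifs with h
    · gcongr
    · simp; positivity
  simpa [norm_smul] using h

theorem norm_cut_le (L : ℕ) (x : Fock N) : ‖cut L x‖ ≤ ‖x‖ := by
  simpa using norm_wt_pow_cut_le L 0 x

theorem cut_symm (L : ℕ) (x y : Fock N) :
    inner ℂ (cut L x : Fock N) y = inner ℂ x (cut L y : Fock N) := by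
  rw [lp.inner_eq_tsum, lp.inner_eq_tsum]
  congr 1; funext n
  rw [cut_apply, cut_apply]
  split_ifs <;> simp

/-- Only components of weight greater than `L` survive in the difference. This is the rate `1/L`
behind the convergence of the truncations. -/
theorem mul_norm_sub_cut_le (L : ℕ) (x : rapid N) :
    (L : ℝ) * ‖x - cut L (x : Fock N)‖ ≤ ‖wt x‖ := by
  have h : ‖(L : ℂ) • (x - cut L (x : Fock N))‖ ≤ ‖wt x‖ := by
    refine rapid_norm_mono fun n => ?_
    rw [rapid_coe_smul_apply, rapid_coe_sub_apply, cut_apply, wt_apply, norm_mul, norm_mul,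
      Complex.norm_real, Real.norm_eq_abs, abs_of_pos (occWeight_pos n),
      Complex.norm_natCast]
    split_ifs with h
    · simp; exact mul_nonneg (occWeight_pos n).le (norm_nonneg _)
    · rw [sub_zero]
      gcongr
      linarith
  simpa [norm_smul] using h

/-- `wt ^ k` on the range of `cut L`, as a bounded operator. -/
def cutWt (L k : ℕ) : Fock N →L[ℂ] Fock N :=
  LinearMap.mkContinuous ((rapid N).subtype ∘ₗ (wt ^ k : Module.End ℂ (rapid N)) ∘ₗ cut L)
    ((L : ℝ) ^ k) (norm_wt_pow_cut_le L k)

theorem cutWt_apply (L k : ℕ) (x : Fock N) :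
    cutWt L k x = ((wt ^ k) (cut L x) : rapid N) := rfl

/-- The compression of a product of two mode operators to the range of `cut L`. -/
def cutTerm (L : ℕ) (p q : Fin N ⊕ Fin N) : Fock N →L[ℂ] Fock N :=
  LinearMap.mkContinuous
    ((rapid N).subtype ∘ₗ cut L ∘ₗ (rapid N).subtype ∘ₗ (mode p * mode q) ∘ₗ cut L)
    (2 * (L : ℝ)) fun x => by
      refine (norm_cut_le L _).trans ((norm_mode_mode_le p q (cut L x)).trans ?_)
      have := norm_wt_pow_cut_le L 1 x
      simp only [pow_one] at this
      rw [mul_assoc]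
      gcongr

/-- The compression of `quad H` to the range of `cut L`. -/
def cutQuad (L : ℕ) (H : ModeMatrix N) : Fock N →L[ℂ] Fock N :=
  ∑ m, ∑ n, H m n • cutTerm L m.swap n

theorem cutQuad_apply (L : ℕ) (H : ModeMatrix N) (x : Fock N) :
    cutQuad L H x = (cut L (quad H (cut L x) : Fock N) : Fock N) := by
  have h : quad H (cut L x) = ∑ m, ∑ n, H m n • mode m.swap (mode n (cut L x)) :=
    quad_apply _ _
  have h2 : ((rapid N).subtype ∘ₗ cut L ∘ₗ (rapid N).subtype) (quad H (cut L x)) =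
      ∑ m, ∑ n, H m n • ((rapid N).subtype ∘ₗ cut L ∘ₗ (rapid N).subtype)
        (mode m.swap (mode n (cut L x))) := by
    rw [h]; simp only [map_sum, map_smul]
  refine Eq.trans ?_ h2.symm
  simp only [cutQuad, _root_.sum_apply, _root_.smul_apply]
  rfl

theorem continuous_cutQuad (L : ℕ) : Continuous (cutQuad L : ModeMatrix N → Fock N →L[ℂ] Fock N) := by
  unfold cutQuad; fun_prop

theorem single_mem_rapid (n : Occ N) (a : ℂ) : (lp.single 2 n a : Fock N) ∈ rapid N := by
  rw [mem_rapid, rapidlyDecreasing_iff]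
  obtain ⟨L, hL⟩ := exists_nat_ge (occWeight n)
  convert rapidSeq_cut L (lp.single 2 n a : Fock N) using 1
  funext m
  rw [lp.coeFn_single]
  by_cases h : m = n
  · subst h; simp [hL]
  · simp [h]

theorem dense_rapid : Dense (rapid N : Set (Fock N)) := by
  intro x
  have h := lp.hasSum_single (p := 2) (by simp) x
  refine mem_closure_of_tendsto h (Filter.Eventually.of_forall fun s => ?_)
  exact Submodule.sum_mem _ fun n _ => single_mem_rapid n _

end Truncation

/-! ### Linear differential equations with bounded coefficients. -/

section LinearODE
open Set

variable {E : Type*} [NormedAddCommGroup E] [NormedSpace ℝ E]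

/-- In the norm weighted by `e^{-2Ct}`, integration against `A` gains a factor `C / (2C) = 1/2`. The
iterates decay geometrically on any compact interval, with no smallness assumption on its length. -/
theorem norm_iterate_le_of_hasDerivAt {A : ℝ → E →L[ℝ] E} {y : ℕ → ℝ → E} {C T D : ℝ}
    (hC : 0 ≤ C) (hA : ∀ t ∈ Icc 0 T, ‖A t‖ ≤ C) (h0 : ∀ t ∈ Icc 0 T, ‖y 0 t‖ ≤ D) (hD : 0 ≤ D)
    (hy : ∀ n t, HasDerivAt (y (n + 1)) (A t (y n t)) t) (hz : ∀ n, y (n + 1) 0 = 0) (n : ℕ) :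
    ∀ t ∈ Icc 0 T, ‖y n t‖ ≤ D * (1 / 2) ^ n * Real.exp (2 * C * t) := by
  induction n with
  | zero =>
    intro t ht
    refine (h0 t ht).trans ?_
    rw [pow_zero, mul_one]
    exact le_mul_of_one_le_right hD (Real.one_le_exp (by have := ht.1; positivity))
  | succ n ih =>
    have hB : ∀ t : ℝ, HasDerivAt (fun t => D * (1 / 2) ^ (n + 1) * Real.exp (2 * C * t))
        (D * (1 / 2) ^ (n + 1) * (Real.exp (2 * C * t) * (2 * C))) t := by
      intro t
      have h1 : HasDerivAt (fun t : ℝ => 2 * C * t) (2 * C) t := by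
        simpa using (hasDerivAt_id t).const_mul (2 * C)
      exact h1.exp.const_mul _
    refine image_norm_le_of_norm_deriv_right_le_deriv_boundary
      (f' := fun t => A t (y n t))
      (fun t _ => (hy n t).continuousAt.continuousWithinAt)
      (fun t _ => (hy n t).hasDerivWithinAt) ?_ hB ?_
    · rw [hz, norm_zero]; positivity
    · intro t ht
      have ht' : t ∈ Icc 0 T := ⟨ht.1, ht.2.le⟩
      calc ‖A t (y n t)‖ ≤ C * (D * (1 / 2) ^ n * Real.exp (2 * C * t)) :=
            (A t).le_of_opNorm_le_of_le (hA t ht') (ih t ht')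
        _ = _ := by ring

theorem exists_hasDerivAt_linear [CompleteSpace E] {A : ℝ → E →L[ℝ] E} (hA : Continuous A)
    (x₀ : E) : ∃ x : ℝ → E, x 0 = x₀ ∧ ∀ t, HasDerivAt x (A t (x t)) t := by
  -- The terms of the Dyson series; the solution is their sum.
  let y : ℕ → ℝ → E := fun n => Nat.rec (fun _ => x₀) (fun _ f t => ∫ s in (0 : ℝ)..t, A s (f s)) n
  have ysucc : ∀ n t, y (n + 1) t = ∫ s in (0 : ℝ)..t, A s (y n s) := fun n t => rfl
  have hcont : ∀ n, Continuous (y n) := by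
    intro n
    induction n with
    | zero => exact continuous_const
    | succ n ih =>
      refine continuous_iff_continuousAt.2 fun t => ?_
      exact ((hA.clm_apply ih).integral_hasStrictDerivAt 0 t).hasDerivAt.continuousAt
  have hy : ∀ n t, HasDerivAt (y (n + 1)) (A t (y n t)) t := fun n t =>
    ((hA.clm_apply (hcont n)).integral_hasStrictDerivAt 0 t).hasDerivAt
  have hz : ∀ n, y (n + 1) 0 = 0 := fun n => by rw [ysucc]; simp
  have hbound : ∀ T : ℝ, 0 ≤ T → ∃ C : ℝ, 0 ≤ C ∧ (∀ t ∈ Icc (-T) T, ‖A t‖ ≤ C) ∧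
      ∀ n, ∀ t ∈ Icc (-T) T, ‖y n t‖ ≤ ‖x₀‖ * (1 / 2) ^ n * Real.exp (2 * C * T) := by
    intro T hT
    obtain ⟨C, hC⟩ := isCompact_Icc.exists_bound_of_continuousOn (s := Icc (-T) T) hA.continuousOn
    have hC0 : 0 ≤ C := (norm_nonneg _).trans (hC 0 ⟨by linarith, hT⟩)
    refine ⟨C, hC0, hC, fun n t ht => ?_⟩
    have key : ∃ s ∈ Icc 0 T, ‖y n t‖ ≤ ‖x₀‖ * (1 / 2) ^ n * Real.exp (2 * C * s) := by
      rcases le_total 0 t with h | h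
      · exact ⟨t, ⟨h, ht.2⟩, norm_iterate_le_of_hasDerivAt (A := A) hC0
          (fun t ht => hC t ⟨by linarith [ht.1], ht.2⟩) (fun _ _ => le_rfl) (norm_nonneg _) hy hz n
          t ⟨h, ht.2⟩⟩
      -- Negative times are reached by reflection, which replaces `A t` by `-A (-t)`.
      · have hr := norm_iterate_le_of_hasDerivAt (A := fun t => -A (-t))
          (y := fun n t => y n (-t)) (T := T) (D := ‖x₀‖) hC0
          (fun t ht => by rw [norm_neg]; exact hC _ ⟨by linarith [ht.2], by linarith [ht.1]⟩)
          (fun _ _ => le_rfl) (norm_nonneg _)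
          (fun n t => by
            have := (hy n (-t)).scomp t (hasDerivAt_neg t)
            simpa [Function.comp_def] using this)
          (fun n => by simpa using hz n) n (-t) ⟨by linarith, by linarith [ht.1]⟩
        exact ⟨-t, ⟨by linarith, by linarith [ht.1]⟩, by simpa using hr⟩
    obtain ⟨s, hs, h⟩ := key
    refine h.trans ?_
    have := hs.2
    gcongr
  have hsum : ∀ t, Summable fun n => y n t := by
    intro t
    obtain ⟨C, hC0, hC, h⟩ := hbound |t| (abs_nonneg t)
    refine Summable.of_norm_bounded (g := fun n => ‖x₀‖ * (1 / 2) ^ n * Real.exp (2 * C * |t|)) ?_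
      fun n => h n t (abs_le.1 le_rfl)
    exact (summable_geometric_two.mul_left _).mul_right _
  refine ⟨fun t => ∑' n, y n t, ?_, fun t => ?_⟩
  · refine tsum_eq_single (f := fun n => y n 0) 0 ?_
    intro n hn
    obtain ⟨m, rfl⟩ := Nat.exists_eq_succ_of_ne_zero hn
    exact hz m
  · obtain ⟨C, hC0, hC, h⟩ := hbound (|t| + 1) (by positivity)
    -- The zeroth term is constant, so the series of derivatives is `A t` applied to the original
    -- series shifted by one.
    let g' : ℕ → ℝ → E := fun n t => Nat.casesOn n 0 fun n => A t (y n t)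
    have hg : ∀ n s, HasDerivAt (y n) (g' n s) s := by
      intro n s
      cases n with
      | zero => exact hasDerivAt_const s x₀
      | succ n => exact hy n s
    have htm : t ∈ Ioo (-(|t| + 1)) (|t| + 1) := by
      rw [mem_Ioo, ← abs_lt]; linarith
    have hd := hasDerivAt_tsum_of_isPreconnected (g := y) (g' := g') (y₀ := t)
      (u := fun n => C * 2 * (‖x₀‖ * (1 / 2) ^ n * Real.exp (2 * C * (|t| + 1))))
      (((summable_geometric_two.mul_left _).mul_right _).mul_left _)
      isOpen_Ioo isPreconnected_Ioo (fun n s _ => hg n s) (fun n s hs => ?_) htm (hsum t) htm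
    · have e : ∑' n, g' n t = A t (∑' n, y n t) := by
        have hs : Summable fun n => g' n t :=
          (summable_nat_add_iff 1).1 (((A t).summable (hsum t)))
        rw [hs.tsum_eq_zero_add, (A t).map_tsum (hsum t)]
        simp [g']
      rwa [e] at hd
    · cases n with
      | zero => change ‖(0 : E)‖ ≤ _; rw [norm_zero]; positivity
      | succ n =>
        have hs' : s ∈ Icc (-(|t| + 1)) (|t| + 1) := ⟨hs.1.le, hs.2.le⟩
        refine ((A s).le_of_opNorm_le_of_le (hC s hs') (h n s hs')).trans (le_of_eq ?_)
        rw [pow_succ]; ring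

theorem norm_le_exp_of_norm_deriv_le {f f' : ℝ → E} {K T : ℝ} (hf : ∀ t, HasDerivAt f (f' t) t)
    (h : ∀ t ∈ Icc (-T) T, ‖f' t‖ ≤ K * ‖f t‖) (hK : 0 ≤ K) :
    ∀ t ∈ Icc (-T) T, ‖f t‖ ≤ ‖f 0‖ * Real.exp (K * T) := by
  intro t ht
  have key : ∀ (g g' : ℝ → E), (∀ t, HasDerivAt g (g' t) t) →
      (∀ t ∈ Icc 0 T, ‖g' t‖ ≤ K * ‖g t‖) → ∀ t ∈ Icc 0 T, ‖g t‖ ≤ ‖g 0‖ * Real.exp (K * T) := by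
    intro g g' hg h t ht
    have := norm_le_gronwallBound_of_norm_deriv_right_le (f := g) (f' := g') (ε := 0) (K := K)
      (δ := ‖g 0‖) (a := 0) (b := T) (fun t _ => (hg t).continuousAt.continuousWithinAt)
      (fun t _ => (hg t).hasDerivWithinAt) le_rfl
      (fun t ht => by simpa using h t ⟨ht.1, ht.2.le⟩) t ht
    rw [gronwallBound_ε0, sub_zero] at this
    refine this.trans ?_
    have := ht.2
    gcongr
  rcases le_total 0 t with h0 | h0
  · exact key f f' hf (fun t ht => h t ⟨by linarith [ht.1, ht.2], ht.2⟩) t ⟨h0, ht.2⟩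
  · have := key (fun t => f (-t)) (fun t => -f' (-t))
      (fun t => by simpa [Function.comp_def] using (hf (-t)).scomp t (hasDerivAt_neg t))
      (fun t ht => by
        rw [norm_neg]; exact h (-t) ⟨by linarith [ht.2], by linarith [ht.1, ht.2]⟩) (-t)
      ⟨by linarith, by linarith [ht.1]⟩
    simpa using this

end LinearODE

/-! ### Evolutions under the compressed Hamiltonians. -/

section Evolution
open Set Filter Topology
variable {N : ℕ}

/-- Differentiability of a curve of rapidly decreasing vectors in all weighted norms. -/
def HasRapidDerivAt (y : ℝ → rapid N) (y' : rapid N) (t : ℝ) : Prop :=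
  ∀ k : ℕ, HasDerivAt (fun s => (((wt ^ k) (y s) : rapid N) : Fock N))
    (((wt ^ k) y' : rapid N) : Fock N) t

theorem hasDerivAt_norm_sq_fock {f : ℝ → Fock N} {f' : Fock N} {t : ℝ} (h : HasDerivAt f f' t) :
    HasDerivAt (fun s => ‖f s‖ ^ 2) (2 * (inner ℂ (f t) f').re) t := by
  have h1 := (h.inner ℂ h)
  have h2 := Complex.reCLM.hasFDerivAt.comp_hasDerivAt t h1
  have e : (Complex.reCLM ∘ fun s => inner ℂ (f s) (f s)) = fun s => ‖f s‖ ^ 2 := by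
    funext s
    exact (norm_sq_eq_re_inner (𝕜 := ℂ) (f s)).symm
  rw [e] at h2
  refine h2.congr_deriv ?_
  have : (inner ℂ f' (f t)).re = (inner ℂ (f t) f').re := inner_re_symm (𝕜 := ℂ) _ _
  rw [Complex.reCLM_apply, Complex.add_re, this]
  ring

/-- A symmetric operator has real expectations. This cancels the main term in every energy estimate
below. -/
theorem re_inner_neg_I_quad {H : ModeMatrix N} (h : IsQuadMatrix H) (z : rapid N) :
    (inner ℂ z (-Complex.I • quad H z)).re = 0 := by
  have h1 := quad_symm h z z
  have h2 : (starRingEnd ℂ) (inner ℂ z (quad H z)) = inner ℂ z (quad H z) := by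
    conv_rhs => rw [← h1]
    exact inner_conj_symm (𝕜 := ℂ) (quad H z) z
  have h3 := Complex.conj_eq_iff_im.1 h2
  rw [rapid_inner_smul_right, Complex.mul_re, h3]
  simp

theorem exists_truncated_evolution {H : ℝ → ModeMatrix N} (hc : Continuous H) (ψ : rapid N)
    (L : ℕ) : ∃ y : ℝ → rapid N, y 0 = cut L (ψ : Fock N) ∧ (∀ t, cut L (y t : Fock N) = y t) ∧
      ∀ t, HasRapidDerivAt y (cut L (-Complex.I • quad (H t) (y t) : rapid N)) t := by
  obtain ⟨x, hx0, hx⟩ := exists_hasDerivAt_linear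
    (A := fun t => (-Complex.I • cutQuad L (H t)).restrictScalars ℝ)
    (by
      have := (continuous_cutQuad (N := N) L).comp hc
      exact (ContinuousLinearMap.continuous_restrictScalars (𝕜 := ℂ) (𝕜' := ℝ)).comp
        (this.const_smul (-Complex.I)))
    (cut L (ψ : Fock N) : Fock N)
  have hA : ∀ t, HasDerivAt x ((cut L (-Complex.I • quad (H t) (cut L (x t)) : rapid N) : rapid N) :
      Fock N) t := by
    intro t
    refine (hx t).congr_deriv ?_
    have : cut L (-Complex.I • quad (H t) (cut L (x t)) : rapid N) =
      -Complex.I • cut L (quad (H t) (cut L (x t)) : Fock N) :=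
        map_smul (cut L) (-Complex.I) (quad (H t) (cut L (x t)) : Fock N)
    rw [this, ContinuousLinearMap.coe_restrictScalars', _root_.smul_apply, cutQuad_apply]
    rfl
  have hk : ∀ k t, HasDerivAt (fun s => (((wt ^ k) (cut L (x s)) : rapid N) : Fock N))
      (((wt ^ k) (cut L (-Complex.I • quad (H t) (cut L (x t)) : rapid N)) : rapid N) : Fock N)
      t := by
    intro k t
    have := ((cutWt L k).restrictScalars ℝ).hasFDerivAt.comp_hasDerivAt t (hA t)
    refine this.congr_deriv ?_
    rw [ContinuousLinearMap.coe_restrictScalars', cutWt_apply, cut_cut le_rfl]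
  -- The vector field depends only on the projection of `x` and takes values in the range of the
  -- projection, so the projected curve solves the same equation.
  refine ⟨fun t => cut L (x t), ?_, fun t => cut_cut le_rfl _, fun t k => hk k t⟩
  change cut L (x 0) = _
  rw [hx0, cut_cut le_rfl]

end Evolution

/-! ### Uniform energy bounds and removal of the cutoff. -/

section EvolutionExistence
open Set Filter Topology
variable {N : ℕ}

theorem HasRapidDerivAt.sub {y z : ℝ → rapid N} {y' z' : rapid N} {t : ℝ}
    (hy : HasRapidDerivAt y y' t) (hz : HasRapidDerivAt z z' t) :
    HasRapidDerivAt (fun s => y s - z s) (y' - z') t := by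
  intro k
  have h := (hy k).sub (hz k)
  have e : ∀ a b : rapid N, (((wt ^ k) (a - b) : rapid N) : Fock N) =
      ((wt ^ k) a : rapid N) - ((wt ^ k) b : rapid N) := fun a b => by rw [map_sub]; rfl
  simp only [e]
  exact h

theorem HasRapidDerivAt.hasDerivAt {y : ℝ → rapid N} {y' : rapid N} {t : ℝ}
    (h : HasRapidDerivAt y y' t) : HasDerivAt (fun s => (y s : Fock N)) (y' : Fock N) t := by
  simpa using h 0

theorem cut_symm' (L : ℕ) (x y : rapid N) :
    inner ℂ (cut L (x : Fock N)) y = inner ℂ x (cut L (y : Fock N)) :=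
  cut_symm L (x : Fock N) (y : Fock N)

/-- `y` solves the evolution equation of the truncated quadratic Hamiltonian. -/
structure IsTruncatedEvolution (H : ℝ → ModeMatrix N) (ψ : rapid N) (L : ℕ) (y : ℝ → rapid N) :
    Prop where
  zero : y 0 = cut L (ψ : Fock N)
  cut : ∀ t, cut L (y t : Fock N) = y t
  deriv : ∀ t, HasRapidDerivAt y (_root_.cut L (-Complex.I • quad (H t) (y t) : rapid N)) t

theorem exists_entrySum_bound {H : ℝ → ModeMatrix N} (hc : Continuous H) (T : ℝ) :
    ∃ h : ℝ, 0 ≤ h ∧ ∀ t ∈ Icc (-T) T, entrySum (H t) ≤ h := by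
  obtain ⟨C, hC⟩ := isCompact_Icc.exists_bound_of_continuousOn (s := Icc (-T) T)
    (continuous_entrySum.comp hc).continuousOn
  exact ⟨max C 0, le_max_right _ _, fun t ht =>
    (le_abs_self _).trans ((hC t ht).trans (le_max_left _ _))⟩

/-- Energy estimate: in the derivative of `‖wt^k y‖²` only the commutator of `wt^k` with the
Hamiltonian has a real part, and it is bounded by `wt^k`. The constants in Gronwall's inequality do
not see `L`. -/
theorem exists_truncated_bound {H : ℝ → ModeMatrix N} (hc : Continuous H)
    (hq : ∀ t, IsQuadMatrix (H t)) (ψ : rapid N) (T : ℝ) (hT : 0 ≤ T) (k : ℕ) :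
    ∃ B : ℝ, 0 ≤ B ∧ ∀ L y, IsTruncatedEvolution H ψ L y → ∀ t ∈ Icc (-T) T,
      ‖(wt ^ k) (y t)‖ ≤ B := by
  obtain ⟨C, hC, hcomm⟩ := exists_norm_commutator_le (N := N) k
  obtain ⟨h, hh, hH⟩ := exists_entrySum_bound hc T
  refine ⟨‖(wt ^ k) ψ‖ * Real.exp (2 * (C * h) * T), by positivity, fun L y hy t ht => ?_⟩
  have hd : ∀ t, HasDerivAt (fun s => ‖(wt ^ k) (y s)‖ ^ 2)
      (2 * (inner ℂ ((wt ^ k) (y t)) ((wt ^ k) (cut L (-Complex.I • quad (H t) (y t) : rapid N)))).re)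
      t := fun t => hasDerivAt_norm_sq_fock (hy.deriv t k)
  have hbd : ∀ t ∈ Icc (-T) T,
      ‖2 * (inner ℂ ((wt ^ k) (y t))
        ((wt ^ k) (cut L (-Complex.I • quad (H t) (y t) : rapid N)))).re‖ ≤
      2 * (C * h) * ‖‖(wt ^ k) (y t)‖ ^ 2‖ := by
    intro t ht
    have e1 : inner ℂ ((wt ^ k) (y t)) ((wt ^ k) (cut L (-Complex.I • quad (H t) (y t) : rapid N))) =
        inner ℂ ((wt ^ k) (y t)) (-Complex.I • quad (H t) ((wt ^ k) (y t))) +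
        inner ℂ ((wt ^ k) (y t)) (-Complex.I • ((wt ^ k) (quad (H t) (y t)) -
          quad (H t) ((wt ^ k) (y t)))) := by
      have : inner ℂ ((wt ^ k) (y t)) (-Complex.I • quad (H t) ((wt ^ k) (y t))) +
        inner ℂ ((wt ^ k) (y t)) (-Complex.I • ((wt ^ k) (quad (H t) (y t)) -
          quad (H t) ((wt ^ k) (y t)))) = inner ℂ ((wt ^ k) (y t))
            (-Complex.I • quad (H t) ((wt ^ k) (y t)) + -Complex.I • ((wt ^ k) (quad (H t) (y t)) -
          quad (H t) ((wt ^ k) (y t)))) := (inner_add_right (𝕜 := ℂ) _ _ _).symm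
      -- The projection commutes with `wt^k`, is symmetric and fixes `y`, so it drops out of the
      -- inner product.
      rw [this, wt_pow_cut, ← cut_symm', ← wt_pow_cut, hy.cut, map_smul, ← smul_add, add_sub_cancel]
    rw [e1, Complex.add_re, re_inner_neg_I_quad (hq t), zero_add, norm_mul, Real.norm_eq_abs,
      Real.norm_eq_abs, Real.norm_eq_abs, abs_two, abs_of_nonneg (sq_nonneg ‖(wt ^ k) (y t)‖)]
    have e2 : ‖-Complex.I • ((wt ^ k) (quad (H t) (y t)) - quad (H t) ((wt ^ k) (y t)))‖ ≤
        C * h * ‖(wt ^ k) (y t)‖ := by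
      rw [norm_smul, norm_neg, Complex.norm_I, one_mul]
      refine (hcomm (H t) (y t)).trans ?_
      have := hH t ht
      gcongr
    have e3 := (Complex.abs_re_le_norm _).trans (norm_inner_le_norm (𝕜 := ℂ) ((wt ^ k) (y t))
      (-Complex.I • ((wt ^ k) (quad (H t) (y t)) - quad (H t) ((wt ^ k) (y t)))))
    calc 2 * _ ≤ 2 * (‖(wt ^ k) (y t)‖ * (C * h * ‖(wt ^ k) (y t)‖)) := by
          gcongr
          exact e3.trans (by gcongr)
      _ = _ := by ring
  have hg := norm_le_exp_of_norm_deriv_le hd hbd (by positivity) t ht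
  rw [norm_pow, norm_pow, norm_norm, norm_norm] at hg
  have h0 : ‖(wt ^ k) (y 0)‖ ≤ ‖(wt ^ k) ψ‖ := by
    rw [hy.zero, wt_pow_cut]; exact norm_cut_le _ _
  -- Gronwall controls the square of the norm by one factor of the exponential; its square is a
  -- convenient larger bound.
  have he : 1 ≤ Real.exp (2 * (C * h) * T) := Real.one_le_exp (by positivity)
  refine le_of_sq_le_sq (hg.trans ?_) (by positivity)
  rw [mul_pow]
  gcongr
  exact le_self_pow₀ he two_ne_zero

theorem norm_cut_sub_cut_le (L M : ℕ) (h : L ≤ M) (v : rapid N) :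
    (L : ℝ) * ‖cut L (v : Fock N) - cut M (v : Fock N)‖ ≤ 2 * ‖wt v‖ := by
  have h1 := mul_norm_sub_cut_le L v
  have h2 := mul_norm_sub_cut_le M v
  have h3 : (L : ℝ) ≤ M := by exact_mod_cast h
  have h4 : (L : ℝ) * ‖v - cut M (v : Fock N)‖ ≤ ‖wt v‖ := le_trans (by gcongr) h2
  have h5 : ‖cut L (v : Fock N) - cut M (v : Fock N)‖ ≤
      ‖v - cut L (v : Fock N)‖ + ‖v - cut M (v : Fock N)‖ := by
    have := norm_sub_le (v - cut M (v : Fock N)) (v - cut L (v : Fock N))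
    rw [sub_sub_sub_cancel_left] at this
    linarith
  have h6 : (0 : ℝ) ≤ L := Nat.cast_nonneg L
  nlinarith

/-- The difference of two truncations is driven only by `(P_L - P_M) Ĥ y`, of size `1/L` times a
bounded weighted norm; the remaining part is skew and does not change the norm. -/
theorem exists_truncated_sub_bound {H : ℝ → ModeMatrix N} (hc : Continuous H)
    (hq : ∀ t, IsQuadMatrix (H t)) (ψ : rapid N) (T : ℝ) (hT : 0 ≤ T) :
    ∃ D : ℝ, 0 ≤ D ∧ ∀ L M y z, L ≤ M → IsTruncatedEvolution H ψ L y →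
      IsTruncatedEvolution H ψ M z → ∀ t ∈ Icc (-T) T, (L : ℝ) * ‖y t - z t‖ ^ 2 ≤ D := by
  obtain ⟨C, hC, hquad⟩ := exists_norm_wt_pow_quad_le (N := N) 1
  obtain ⟨h, hh, hH⟩ := exists_entrySum_bound hc T
  obtain ⟨B0, hB0, hb0⟩ := exists_truncated_bound hc hq ψ T hT 0
  obtain ⟨B2, hB2, hb2⟩ := exists_truncated_bound hc hq ψ T hT 2
  refine ⟨2 * B0 * (2 * ‖wt ψ‖) + 2 * (2 * B0 * (2 * (C * h * B2))) * T, by positivity,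
    fun L M y z hLM hy hz t ht => ?_⟩
  have hL : (0 : ℝ) ≤ L := Nat.cast_nonneg L
  have hδ : ∀ t ∈ Icc (-T) T, ‖y t - z t‖ ≤ 2 * B0 := fun t ht => by
    have h1 := hb0 L y hy t ht
    have h2 := hb0 M z hz t ht
    simp only [pow_zero, Module.End.one_apply] at h1 h2
    linarith [norm_sub_le (y t) (z t)]
  have hd : ∀ t, HasDerivAt (fun s => (L : ℝ) * ‖y s - z s‖ ^ 2)
      (L * (2 * (inner ℂ (y t - z t) (cut L (-Complex.I • quad (H t) (y t) : rapid N) -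
        cut M (-Complex.I • quad (H t) (z t) : rapid N))).re)) t := fun t =>
    (hasDerivAt_norm_sq_fock ((hy.deriv t).sub (hz.deriv t)).hasDerivAt).const_mul _
  have hbd : ∀ t ∈ Icc (-T) T, ‖(L * (2 * (inner ℂ (y t - z t)
      (cut L (-Complex.I • quad (H t) (y t) : rapid N) -
        cut M (-Complex.I • quad (H t) (z t) : rapid N))).re) : ℝ)‖ ≤
      2 * (2 * B0 * (2 * (C * h * B2))) := by
    intro t ht
    -- Since `L ≤ M`, both solutions lie in the range of `P_M`. Hence `P_M` can be moved onto `y -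
    -- z` and disappears, which leaves a symmetric expectation.
    have hcz : cut M ((y t - z t : rapid N) : Fock N) = y t - z t := by
      have : cut M ((y t - z t : rapid N) : Fock N) = cut M (y t : Fock N) - cut M (z t : Fock N) :=
        map_sub (cut M) _ _
      rw [this, hz.cut, ← hy.cut t, cut_cut hLM]
    set v : rapid N := -Complex.I • quad (H t) (y t) with hv
    have e0 : cut L (v : Fock N) - cut M (-Complex.I • quad (H t) (z t) : rapid N) =
        (cut L (v : Fock N) - cut M (v : Fock N)) +
          cut M (-Complex.I • quad (H t) (y t - z t) : rapid N) := by
      have : cut M (-Complex.I • quad (H t) (y t - z t) : rapid N) =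
          cut M (v : Fock N) - cut M (-Complex.I • quad (H t) (z t) : rapid N) := by
        rw [map_sub, smul_sub]
        exact map_sub (cut M) _ _
      rw [this]; abel
    have e1 : inner ℂ (y t - z t) (cut L (v : Fock N) -
          cut M (-Complex.I • quad (H t) (z t) : rapid N)) =
        inner ℂ (y t - z t) (cut L (v : Fock N) - cut M (v : Fock N)) +
        inner ℂ (y t - z t) (-Complex.I • quad (H t) (y t - z t)) := by
      rw [e0]
      refine (inner_add_right (𝕜 := ℂ) _ _ _).trans ?_
      congr 1
      change inner ℂ (y t - z t) (cut M (-Complex.I • quad (H t) (y t - z t) : rapid N)) = _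
      rw [← cut_symm', hcz]
    rw [e1, Complex.add_re, re_inner_neg_I_quad (hq t), add_zero, norm_mul, norm_mul,
      Real.norm_eq_abs, Real.norm_eq_abs, Real.norm_eq_abs, abs_two, abs_of_nonneg hL]
    have e2 := (Complex.abs_re_le_norm _).trans (norm_inner_le_norm (𝕜 := ℂ) (y t - z t)
      (cut L (v : Fock N) - cut M (v : Fock N)))
    have e3 := norm_cut_sub_cut_le L M hLM v
    have e4 : ‖wt v‖ ≤ C * h * B2 := by
      rw [hv, map_smul, norm_smul, norm_neg, Complex.norm_I, one_mul]
      have h1 := hquad (H t) (y t)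
      rw [pow_one] at h1
      refine h1.trans ?_
      have h2 := hH t ht
      have h3 := hb2 L y hy t ht
      gcongr
    calc (L : ℝ) * (2 * _) ≤ L * (2 * (‖y t - z t‖ * ‖cut L (v : Fock N) - cut M (v : Fock N)‖)) := by
          gcongr
      _ = 2 * (‖y t - z t‖ * (L * ‖cut L (v : Fock N) - cut M (v : Fock N)‖)) := by ring
      _ ≤ 2 * (2 * B0 * (2 * (C * h * B2))) := by
          exact mul_le_mul_of_nonneg_left (mul_le_mul (hδ t ht) (e3.trans (by linarith))
            (by positivity) (by positivity)) (by norm_num)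
  have hmv := (convex_Icc (-T) T).norm_image_sub_le_of_norm_hasDerivWithin_le
    (fun s _ => (hd s).hasDerivWithinAt) hbd (x := 0) (y := t) ⟨by linarith, hT⟩ ht
  have h0 : (L : ℝ) * ‖y 0 - z 0‖ ^ 2 ≤ 2 * B0 * (2 * ‖wt ψ‖) := by
    have h1 := norm_cut_sub_cut_le L M hLM ψ
    rw [← hy.zero, ← hz.zero] at h1
    have h2 := hδ 0 ⟨by linarith, hT⟩
    calc (L : ℝ) * ‖y 0 - z 0‖ ^ 2 = ‖y 0 - z 0‖ * (L * ‖y 0 - z 0‖) := by ring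
      _ ≤ _ := by gcongr
  have h1 := (Real.le_norm_self _).trans hmv
  rw [sub_zero, Real.norm_eq_abs] at h1
  have h2 : |t| ≤ T := abs_le.2 ht
  have h3 : 2 * (2 * B0 * (2 * (C * h * B2))) * |t| ≤ 2 * (2 * B0 * (2 * (C * h * B2))) * T := by
    gcongr
  linarith

/-- Multiplication by a weight is a closed operator: convergence of coordinates identifies the limit
of `wt^k y_L` as `wt^k` times the limit of `y_L`. -/
theorem exists_rapid_limit {y : ℕ → rapid N}
    (h : ∀ k, CauchySeq fun L => (((wt ^ k) (y L) : rapid N) : Fock N)) :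
    ∃ x : rapid N, ∀ k, Tendsto (fun L => (((wt ^ k) (y L) : rapid N) : Fock N)) atTop
      (𝓝 ((wt ^ k) x : rapid N)) := by
  choose z hz using fun k => cauchySeq_tendsto_of_complete (h k)
  have hcoord : ∀ k n, Tendsto (fun L => ((wt ^ k) (y L) : Fock N) n) atTop (𝓝 (z k n)) := by
    intro k n
    exact ((lp.lipschitzWith_one_eval (E := fun _ : Occ N => ℂ) 2 n).continuous.tendsto _).comp (hz k)
  have hzk : ∀ k n, z k n = (occWeight n : ℂ) ^ k * z 0 n := by
    intro k n
    refine tendsto_nhds_unique (hcoord k n) ?_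
    have := (hcoord 0 n).const_mul ((occWeight n : ℂ) ^ k)
    refine this.congr fun L => ?_
    rw [wt_pow_apply, wt_pow_apply, pow_zero, one_mul]
  have hr : RapidSeq (z 0 : Occ N → ℂ) := by
    intro k
    have := memℓp_two_iff.1 (lp.memℓp (z k))
    refine this.congr fun n => ?_
    rw [hzk, norm_mul, norm_pow, Complex.norm_real, Real.norm_eq_abs, abs_of_pos (occWeight_pos n)]
  refine ⟨hr.toRapid, fun k => ?_⟩
  convert hz k
  refine lp.ext (funext fun n => ?_)
  rw [wt_pow_apply, hzk]
  rfl

theorem exists_evolution {H : ℝ → ModeMatrix N} (hc : Continuous H)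
    (hq : ∀ t, IsQuadMatrix (H t)) (ψ : rapid N) :
    ∃ x : ℝ → rapid N, x 0 = ψ ∧ ∀ t, HasRapidDerivAt x (-Complex.I • quad (H t) (x t)) t := by
  have hy0 : ∀ L, ∃ y, IsTruncatedEvolution H ψ L y := fun L => by
    obtain ⟨y, h1, h2, h3⟩ := exists_truncated_evolution hc ψ L
    exact ⟨y, h1, h2, h3⟩
  choose y hy using hy0
  have hcauchy : ∀ T : ℝ, 0 ≤ T → ∀ k : ℕ, ∀ ε > 0, ∃ L₀ : ℕ, ∀ L M, L₀ ≤ L → L ≤ M →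
      ∀ t ∈ Icc (-T) T, ‖(wt ^ k) (y L t - y M t)‖ ≤ ε := by
    intro T hT k ε hε
    obtain ⟨D, hD, hd⟩ := exists_truncated_sub_bound hc hq ψ T hT
    obtain ⟨B, hB, hb⟩ := exists_truncated_bound hc hq ψ T hT (2 * k)
    -- Interpolation gives `‖wt^k (y_L - y_M)‖⁴ ≤ ‖y_L - y_M‖² (2B)² ≤ D (2B)² / L`, which must not
    -- exceed `ε⁴`.
    obtain ⟨L₀, hL₀⟩ := exists_nat_gt (D * (2 * B) ^ 2 / ε ^ 4)
    refine ⟨L₀, fun L M hL hLM t ht => ?_⟩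
    have h1 := hd L M (y L) (y M) hLM (hy L) (hy M) t ht
    have h2 := norm_wt_pow_sq_le k (y L t - y M t)
    have h3 : ‖(wt ^ (2 * k)) (y L t - y M t)‖ ≤ 2 * B := by
      rw [map_sub]
      linarith [norm_sub_le ((wt ^ (2 * k)) (y L t)) ((wt ^ (2 * k)) (y M t)),
        hb L (y L) (hy L) t ht, hb M (y M) (hy M) t ht]
    have h4 : D * (2 * B) ^ 2 / ε ^ 4 < L := hL₀.trans_le (by exact_mod_cast hL)
    have hLpos : (0 : ℝ) < L := lt_of_le_of_lt (by positivity) h4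
    rw [div_lt_iff₀ (by positivity)] at h4
    have h5 : ‖(wt ^ k) (y L t - y M t)‖ ^ 2 ≤ ‖y L t - y M t‖ * (2 * B) := h2.trans (by gcongr)
    have h6 : (‖(wt ^ k) (y L t - y M t)‖ ^ 2) ^ 2 ≤ (‖y L t - y M t‖ * (2 * B)) ^ 2 := by gcongr
    have h7 : (L : ℝ) * ‖(wt ^ k) (y L t - y M t)‖ ^ 4 ≤ L * ε ^ 4 := by
      calc (L : ℝ) * ‖(wt ^ k) (y L t - y M t)‖ ^ 4
          = L * (‖(wt ^ k) (y L t - y M t)‖ ^ 2) ^ 2 := by ring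
        _ ≤ L * (‖y L t - y M t‖ * (2 * B)) ^ 2 := by gcongr
        _ = (L * ‖y L t - y M t‖ ^ 2) * (2 * B) ^ 2 := by ring
        _ ≤ D * (2 * B) ^ 2 := by gcongr
        _ ≤ _ := h4.le
    have h8 := le_of_mul_le_mul_left h7 hLpos
    exact le_of_pow_le_pow_left₀ (by norm_num) hε.le h8
  have hlim : ∀ t, ∃ x : rapid N, ∀ k, Tendsto (fun L => (((wt ^ k) (y L t) : rapid N) : Fock N))
      atTop (𝓝 ((wt ^ k) x : rapid N)) := by
    intro t
    refine exists_rapid_limit fun k => Metric.cauchySeq_iff'.2 fun ε hε => ?_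
    obtain ⟨L₀, h⟩ := hcauchy |t| (abs_nonneg t) k (ε / 2) (half_pos hε)
    refine ⟨L₀, fun M hM => ?_⟩
    have h1 := h L₀ M le_rfl hM t (abs_le.1 le_rfl)
    rw [map_sub] at h1
    rw [dist_comm, dist_eq_norm]
    exact lt_of_le_of_lt h1 (half_lt_self hε)
  choose x hx using hlim
  have hunif : ∀ T : ℝ, 0 ≤ T → ∀ k : ℕ, ∀ ε > 0, ∃ L₀ : ℕ, ∀ L, L₀ ≤ L →
      ∀ t ∈ Icc (-T) T, ‖(wt ^ k) (y L t - x t)‖ ≤ ε := by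
    intro T hT k ε hε
    obtain ⟨L₀, h⟩ := hcauchy T hT k ε hε
    refine ⟨L₀, fun L hL t ht => ?_⟩
    have h1 : Tendsto (fun M => ‖(((wt ^ k) (y L t) : rapid N) : Fock N) -
        (((wt ^ k) (y M t) : rapid N) : Fock N)‖) atTop
        (𝓝 ‖(((wt ^ k) (y L t) : rapid N) : Fock N) - (((wt ^ k) (x t) : rapid N) : Fock N)‖) :=
      (tendsto_const_nhds.sub (hx t k)).norm
    have h2 : ‖(wt ^ k) (y L t - x t)‖ = ‖(((wt ^ k) (y L t) : rapid N) : Fock N) -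
        (((wt ^ k) (x t) : rapid N) : Fock N)‖ := by rw [map_sub]; rfl
    rw [h2]
    refine le_of_tendsto h1 (eventually_atTop.2 ⟨L, fun M hM => ?_⟩)
    have := h L M hL hM t ht
    rw [map_sub] at this
    exact this
  refine ⟨x, ?_, fun t k => ?_⟩
  · have h1 := hx 0 0
    have h2 : Tendsto (fun L => (((wt ^ 0) (y L 0) : rapid N) : Fock N)) atTop
        (𝓝 (ψ : Fock N)) := by
      rw [tendsto_iff_norm_sub_tendsto_zero]
      have hb : ∀ L : ℕ, 0 < L → ‖(((wt ^ 0) (y L 0) : rapid N) : Fock N) - ψ‖ ≤ ‖wt ψ‖ / L := by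
        intro L hL
        have h3 := mul_norm_sub_cut_le L ψ
        rw [← (hy L).zero, norm_sub_rev] at h3
        rw [le_div_iff₀ (by exact_mod_cast hL), mul_comm]
        simpa using h3
      refine squeeze_zero' (Eventually.of_forall fun L => norm_nonneg _)
        (eventually_atTop.2 ⟨1, fun L hL => hb L hL⟩) ?_
      exact tendsto_const_div_atTop_nhds_zero_nat _
    have := tendsto_nhds_unique h1 h2
    exact Subtype.ext (by simpa using this)
  · set T := |t| + 1 with hT
    have hT0 : 0 ≤ T := by positivity
    have htm : t ∈ Ioo (-T) T := by rw [mem_Ioo, ← abs_lt]; linarith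
    obtain ⟨C, hC, hquad⟩ := exists_norm_wt_pow_quad_le (N := N) k
    obtain ⟨C1, hC1, hquad1⟩ := exists_norm_wt_pow_quad_le (N := N) (k + 1)
    obtain ⟨h, hh, hH⟩ := exists_entrySum_bound hc T
    -- The Hamiltonian costs one power of the weight and the rate of the cutoff another, hence `k +
    -- 2`.
    obtain ⟨B, hB, hb⟩ := exists_truncated_bound hc hq ψ T hT0 (k + 2)
    have hbx : ∀ t ∈ Icc (-T) T, ‖(wt ^ (k + 2)) (x t)‖ ≤ B := fun t ht =>
      le_of_tendsto (hx t (k + 2)).norm (Eventually.of_forall fun L => hb L (y L) (hy L) t ht)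
    refine hasDerivAt_of_tendstoUniformlyOn (l := atTop) (s := Ioo (-T) T)
      (f := fun (L : ℕ) s => (((wt ^ k) (y L s) : rapid N) : Fock N))
      (f' := fun L s => (((wt ^ k) (cut L (-Complex.I • quad (H s) (y L s) : rapid N)) : rapid N) :
        Fock N))
      (g' := fun s => (((wt ^ k) (-Complex.I • quad (H s) (x s)) : rapid N) : Fock N))
      isOpen_Ioo ?_ (Eventually.of_forall fun L s _ => (hy L).deriv s k) (fun s _ => hx s k) htm
    rw [Metric.tendstoUniformlyOn_iff]
    intro ε hε
    -- Adding one to `C * h` keeps the denominator positive when the bound vanishes.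
    obtain ⟨L₁, hL₁⟩ := hunif T hT0 (k + 1) (ε / (4 * (C * h + 1))) (by positivity)
    obtain ⟨L₂, hL₂⟩ := exists_nat_gt (4 * (C1 * h * B) / ε)
    refine eventually_atTop.2 ⟨max L₁ (max L₂ 1), fun L hL s hs => ?_⟩
    have hs' : s ∈ Icc (-T) T := ⟨hs.1.le, hs.2.le⟩
    have h1 := hL₁ L (le_trans (le_max_left _ _) hL) s hs'
    have hLpos : (0 : ℝ) < L := by
      have : 1 ≤ L := le_trans (le_trans (le_max_right _ _) (le_max_right _ _)) hL
      exact_mod_cast this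
    have h2 : 4 * (C1 * h * B) / ε < L := hL₂.trans_le (by
      have : L₂ ≤ L := le_trans (le_trans (le_max_left _ _) (le_max_right _ _)) hL
      exact_mod_cast this)
    set u : rapid N := (wt ^ k) (quad (H s) (x s)) with hu
    -- The error has two parts: what the cutoff removes from `wt^k Ĥ x`, small by the rate `1/L`,
    -- and the projection of `wt^k Ĥ (y_L - x)`, small by uniform convergence one weight higher.
    have e1 : (wt ^ k) (-Complex.I • quad (H s) (x s)) -
        (wt ^ k) (cut L (-Complex.I • quad (H s) (y L s) : rapid N)) =
        -Complex.I • ((u - cut L (u : Fock N)) -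
          cut L (((wt ^ k) (quad (H s) (y L s - x s)) : rapid N) : Fock N)) := by
      have a1 : cut L (((wt ^ k) (quad (H s) (y L s - x s)) : rapid N) : Fock N) =
          cut L (((wt ^ k) (quad (H s) (y L s)) : rapid N) : Fock N) - cut L (u : Fock N) := by
        rw [map_sub, map_sub]; exact map_sub (cut L) _ _
      have a2 : (wt ^ k) (cut L (-Complex.I • quad (H s) (y L s) : rapid N)) =
          -Complex.I • cut L (((wt ^ k) (quad (H s) (y L s)) : rapid N) : Fock N) := by
        rw [wt_pow_cut, map_smul]; exact map_smul (cut L) _ _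
      rw [a1, a2, map_smul, ← hu]
      module
    have e2 : dist (((wt ^ k) (-Complex.I • quad (H s) (x s)) : rapid N) : Fock N)
        (((wt ^ k) (cut L (-Complex.I • quad (H s) (y L s) : rapid N)) : rapid N) : Fock N) =
        ‖(u - cut L (u : Fock N)) - cut L (((wt ^ k) (quad (H s) (y L s - x s)) : rapid N) : Fock N)‖ := by
      rw [dist_eq_norm]
      change ‖(wt ^ k) (-Complex.I • quad (H s) (x s)) -
        (wt ^ k) (cut L (-Complex.I • quad (H s) (y L s) : rapid N))‖ = _
      rw [e1, norm_smul, norm_neg, Complex.norm_I, one_mul]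
    rw [e2]
    have e3 : ‖cut L (((wt ^ k) (quad (H s) (y L s - x s)) : rapid N) : Fock N)‖ ≤ ε / 4 := by
      refine (norm_cut_le _ _).trans ((hquad (H s) (y L s - x s)).trans ?_)
      have b1 : C * entrySum (H s) * ‖(wt ^ (k + 1)) (y L s - x s)‖ ≤
          (C * h + 1) * (ε / (4 * (C * h + 1))) := by
        have := hH s hs'
        gcongr
        have : C * entrySum (H s) ≤ C * h := by gcongr
        linarith
      refine b1.trans (le_of_eq ?_)
      have : C * h + 1 ≠ 0 := by positivity
      field_simp
    have e4 : ‖u - cut L (u : Fock N)‖ ≤ ε / 4 := by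
      have b1 := mul_norm_sub_cut_le L u
      have b2 : ‖wt u‖ ≤ C1 * h * B := by
        rw [hu, ← Module.End.mul_apply, ← pow_succ']
        refine (hquad1 (H s) (x s)).trans ?_
        have := hH s hs'
        have := hbx s hs'
        gcongr
      rw [div_lt_iff₀ hε] at h2
      have b3 : (L : ℝ) * ‖u - cut L (u : Fock N)‖ ≤ L * (ε / 4) := by linarith
      exact le_of_mul_le_mul_left b3 hLpos
    refine lt_of_le_of_lt (norm_sub_le _ _) ?_
    linarith

end EvolutionExistence

/-! ### Uniqueness, unitary propagators and one-parameter groups. -/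

section Propagators
open Set Filter Topology
variable {N : ℕ}

theorem evolution_norm_eq {I : Set ℝ} (hI : I.OrdConnected) {H : ℝ → ModeMatrix N}
    (hq : ∀ t, IsQuadMatrix (H t)) {x : ℝ → rapid N}
    (hx : ∀ t ∈ I, HasDerivAt (fun s => (x s : Fock N)) (-Complex.I • quad (H t) (x t) : rapid N) t)
    {a b : ℝ} (ha : a ∈ I) (hb : b ∈ I) : ‖x b‖ = ‖x a‖ := by
  have h := hI.convex.norm_image_sub_le_of_norm_hasDerivWithin_le (C := 0)
    (f := fun s => ‖(x s : Fock N)‖ ^ 2)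
    (f' := fun t => 2 * (inner ℂ (x t) (-Complex.I • quad (H t) (x t))).re)
    (fun t ht => (hasDerivAt_norm_sq_fock (hx t ht)).hasDerivWithinAt)
    (fun t _ => by rw [re_inner_neg_I_quad (hq t)]; simp) ha hb
  rw [zero_mul, norm_le_zero_iff, sub_eq_zero] at h
  exact (pow_left_inj₀ (norm_nonneg _) (norm_nonneg _) two_ne_zero).1 h

/-- The difference of two solutions is a solution, so its norm is constant. Differentiability in the
plain norm is enough, and the argument works on any interval, as the local product formula requires.
-/
theorem evolution_unique {I : Set ℝ} (hI : I.OrdConnected) {H : ℝ → ModeMatrix N}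
    (hq : ∀ t, IsQuadMatrix (H t)) {x y : ℝ → rapid N}
    (hx : ∀ t ∈ I, HasDerivAt (fun s => (x s : Fock N)) (-Complex.I • quad (H t) (x t) : rapid N) t)
    (hy : ∀ t ∈ I, HasDerivAt (fun s => (y s : Fock N)) (-Complex.I • quad (H t) (y t) : rapid N) t)
    {a b : ℝ} (ha : a ∈ I) (hb : b ∈ I) (hab : x a = y a) : x b = y b := by
  have h := evolution_norm_eq hI hq (x := fun s => x s - y s) (fun t ht => by
    have h1 := (hx t ht).sub (hy t ht)
    refine h1.congr_deriv ?_
    rw [map_sub, smul_sub]; rfl) ha hb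
  simp only [hab, sub_self, norm_zero, norm_eq_zero] at h
  exact sub_eq_zero.1 h

theorem IsQuadMatrix.real_smul {H : ModeMatrix N} (h : IsQuadMatrix H) (c : ℝ) :
    IsQuadMatrix (c • H) := by
  obtain ⟨A, B, hA, hB, rfl⟩ := h
  refine ⟨c • A, c • B, ?_, ?_, ?_⟩
  · rw [conjTranspose_smul, hA]; simp
  · rw [transpose_smul, hB]
  · rw [fromBlocks_smul]
    congr 1 <;> (ext i j; simp)

theorem IsQuadMatrix.add {H H' : ModeMatrix N} (h : IsQuadMatrix H) (h' : IsQuadMatrix H') :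
    IsQuadMatrix (H + H') := by
  obtain ⟨A, B, hA, hB, rfl⟩ := h
  obtain ⟨A', B', hA', hB', rfl⟩ := h'
  refine ⟨A + A', B + B', ?_, ?_, ?_⟩
  · rw [conjTranspose_add, hA, hA']
  · rw [transpose_add, hB, hB']
  · rw [fromBlocks_add]
    congr 1 <;> (ext i j; simp)

theorem isQuadMatrix_zero : IsQuadMatrix (0 : ModeMatrix N) :=
  ⟨0, 0, by simp, by simp, by
    ext (i | i) (j | j) <;> simp⟩

variable (N) in
/-- The real vector space of quadratic matrices. -/
def quadSubmodule : Submodule ℝ (ModeMatrix N) where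
  carrier := {H | IsQuadMatrix H}
  add_mem' h h' := IsQuadMatrix.add h h'
  zero_mem' := isQuadMatrix_zero
  smul_mem' c _ h := IsQuadMatrix.real_smul h c

theorem IsQuadMatrix.sum_smul {ι : Type*} [Fintype ι] {G : ι → ModeMatrix N}
    (hG : ∀ j, IsQuadMatrix (G j)) (c : ι → ℝ) : IsQuadMatrix (∑ j, c j • G j) :=
  Submodule.sum_mem (quadSubmodule N) fun j _ => (quadSubmodule N).smul_mem (c j) (hG j)

theorem IsQuadMatrix.neg {H : ModeMatrix N} (h : IsQuadMatrix H) : IsQuadMatrix (-H) :=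
  (quadSubmodule N).neg_mem h

theorem quad_add (H H' : ModeMatrix N) : quad (H + H') = quad H + quad H' := by
  simp [quad, add_smul, Finset.sum_add_distrib]

theorem quad_neg (H : ModeMatrix N) : quad (-H) = -quad H := by
  refine eq_neg_of_add_eq_zero_left ?_
  rw [← quad_add, neg_add_cancel]
  simp [quad]

/-- Linearity in the initial vector comes from uniqueness, since sums and multiples of solutions are
solutions. -/
theorem exists_linear_propagator {H : ℝ → ModeMatrix N} (hc : Continuous H)
    (hq : ∀ t, IsQuadMatrix (H t)) : ∃ U : ℝ → Module.End ℂ (rapid N), U 0 = 1 ∧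
      ∀ ψ t, HasRapidDerivAt (fun s => U s ψ) (-Complex.I • quad (H t) (U t ψ)) t := by
  choose x hx0 hx using exists_evolution hc hq
  have hxd : ∀ ψ, ∀ t ∈ univ, HasDerivAt (fun s => (x ψ s : Fock N))
      (-Complex.I • quad (H t) (x ψ t) : rapid N) t := fun ψ t _ => (hx ψ t).hasDerivAt
  refine ⟨fun t => { toFun := fun ψ => x ψ t, map_add' := fun ψ φ => ?_, map_smul' := fun c ψ => ?_ },
    LinearMap.ext fun ψ => hx0 ψ, hx⟩
  · refine evolution_unique ordConnected_univ hq (y := fun s => x ψ s + x φ s) (hxd _)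
      (fun t ht => ((hxd ψ t ht).add (hxd φ t ht)).congr_deriv ?_) (mem_univ 0) (mem_univ t) ?_
    · rw [map_add, smul_add]; rfl
    · simp [hx0]
  · refine evolution_unique ordConnected_univ hq (y := fun s => c • x ψ s) (hxd _)
      (fun t ht => ((hxd ψ t ht).const_smul c).congr_deriv ?_) (mem_univ 0) (mem_univ t) ?_
    · rw [map_smul, smul_comm]; rfl
    · simp [hx0]

theorem exists_propagator {H : ℝ → ModeMatrix N} (hc : Continuous H)
    (hq : ∀ t, IsQuadMatrix (H t)) : ∃ U V : ℝ → Module.End ℂ (rapid N), U 0 = 1 ∧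
      (∀ ψ t, HasRapidDerivAt (fun s => U s ψ) (-Complex.I • quad (H t) (U t ψ)) t) ∧
      ∀ t, U t * V t = 1 ∧ V t * U t = 1 := by
  obtain ⟨U, hU0, hU⟩ := exists_linear_propagator hc hq
  -- The evolution run backwards from time `t`, with Hamiltonian `-H (t - s)`, inverts `U t`; both
  -- compositions follow from uniqueness.
  have hback := fun t : ℝ => exists_linear_propagator (H := fun s => -H (t - s)) (by fun_prop)
    (fun s => (hq (t - s)).neg)
  choose V hV0 hV using hback
  refine ⟨U, fun t => V t t, hU0, hU, fun t => ⟨LinearMap.ext fun φ => ?_, LinearMap.ext fun ψ => ?_⟩⟩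
  · have h := evolution_unique ordConnected_univ hq (x := fun s => U s (V t t φ))
      (y := fun s => V t (t - s) φ) (fun s _ => (hU _ s).hasDerivAt) (fun s _ => ?_)
      (mem_univ 0) (mem_univ t) (by simp [hU0])
    · simpa [hV0] using h
    · have h1 := (hV t φ (t - s)).hasDerivAt.scomp s ((hasDerivAt_id s).const_sub t)
      refine h1.congr_deriv ?_
      rw [sub_sub_cancel, quad_neg, LinearMap.neg_apply, smul_neg]
      simp
  · have h := evolution_unique ordConnected_univ (H := fun s => -H (t - s))
      (fun s => (hq (t - s)).neg) (x := fun s => V t s (U t ψ))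
      (y := fun s => U (t - s) ψ) (fun s _ => (hV t _ s).hasDerivAt) (fun s _ => ?_)
      (mem_univ 0) (mem_univ t) (by simp [hV0])
    · simpa [hU0] using h
    · have h1 := (hU ψ (t - s)).hasDerivAt.scomp s ((hasDerivAt_id s).const_sub t)
      refine h1.congr_deriv ?_
      rw [quad_neg, LinearMap.neg_apply, smul_neg]
      simp

theorem clm_ext_rapid {A B : Fock N →L[ℂ] Fock N} (h : ∀ ψ : rapid N, A ψ = B ψ) : A = B := by
  refine ContinuousLinearMap.ext fun x => ?_
  exact congrFun (Continuous.ext_on dense_rapid A.continuous B.continuous fun ψ hψ => h ⟨ψ, hψ⟩) x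

theorem exists_extension {W : Module.End ℂ (rapid N)} (hW : ∀ ψ, ‖W ψ‖ = ‖ψ‖) :
    ∃ u : Fock N →L[ℂ] Fock N, (∀ ψ : rapid N, u ψ = W ψ) ∧ ∀ x, ‖u x‖ = ‖x‖ := by
  have hd : DenseRange (rapid N).subtype := by
    rw [DenseRange, Submodule.coe_subtype, Subtype.range_coe]
    exact dense_rapid
  have hu := LinearMap.extendOfNorm_eq (f := (rapid N).subtype ∘ₗ W) (e := (rapid N).subtype) hd
    ⟨1, fun x => by simpa using (hW x).le⟩
  refine ⟨((rapid N).subtype ∘ₗ W).extendOfNorm (rapid N).subtype, hu, fun x => ?_⟩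
  refine congrFun (Continuous.ext_on dense_rapid (ContinuousLinearMap.continuous _).norm
    continuous_norm fun ψ hψ => ?_) x
  have := hu ⟨ψ, hψ⟩
  exact (congrArg norm this).trans (hW ⟨ψ, hψ⟩)

/-- An isometry satisfies `u* u = 1`, and a right inverse must then be `u*`. -/
theorem mem_unitary_of_norm {u v : Fock N →L[ℂ] Fock N} (hu : ∀ x, ‖u x‖ = ‖x‖)
    (huv : u * v = 1) : u ∈ unitary (Fock N →L[ℂ] Fock N) := by
  have h1 : star u * u = 1 := (ContinuousLinearMap.norm_map_iff_adjoint_comp_self u).1 hu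
  have h2 : star u = v := by
    calc star u = star u * (u * v) := by rw [huv, mul_one]
      _ = v := by rw [← mul_assoc, h1, one_mul]
  exact Unitary.mem_iff.2 ⟨h1, by rw [h2, huv]⟩

theorem exists_unitary_extension {W V : Module.End ℂ (rapid N)} (hW : ∀ ψ, ‖W ψ‖ = ‖ψ‖)
    (h : W * V = 1) : ∃ u ∈ unitary (Fock N →L[ℂ] Fock N), ∀ ψ : rapid N, u ψ = W ψ := by
  have hWV : ∀ ψ, W (V ψ) = ψ := fun ψ => LinearMap.congr_fun h ψ
  have hV : ∀ ψ, ‖V ψ‖ = ‖ψ‖ := fun ψ => by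
    rw [← hW (V ψ), hWV]
  obtain ⟨u, hu, hun⟩ := exists_extension hW
  obtain ⟨v, hv, hvn⟩ := exists_extension hV
  refine ⟨u, mem_unitary_of_norm (v := v) hun (clm_ext_rapid fun ψ => ?_), hu⟩
  rw [mul_apply_eq_comp, hv, hu, hWV]; rfl

theorem unitary_norm_map {u : Fock N →L[ℂ] Fock N} (hu : u ∈ unitary (Fock N →L[ℂ] Fock N))
    (x : Fock N) : ‖u x‖ = ‖x‖ :=
  (ContinuousLinearMap.norm_map_iff_adjoint_comp_self u).2 (Unitary.mem_iff.1 hu).1 x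

theorem coe_eq_neg_I_smul_quadOp {H : ModeMatrix N} {ψ : rapid N} {φ : Fock N} :
    (φ : Occ N → ℂ) = -Complex.I • quadOp H ψ ↔ φ = (-Complex.I • quad H ψ : rapid N) := by
  have h : (((-Complex.I • quad H ψ : rapid N) : Fock N) : Occ N → ℂ) =
      -Complex.I • quadOp H (ψ : Fock N) := by
    rw [← coe_quad]; rfl
  rw [← h]
  exact ⟨fun e => lp.ext e, fun e => by rw [e]⟩

/-- The restriction of a time-ordered exponential to the rapidly decreasing vectors. -/
theorem timeOrderedExp_hasDerivAt {H : ℝ → ModeMatrix N} {U : ℝ → Fock N →L[ℂ] Fock N}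
    (hU : IsTimeOrderedExp (fun t => quadOp (H t)) U) (ψ : rapid N) (t : ℝ) :
    HasDerivAt (fun s => U s ψ)
      ((-Complex.I • quad (H t) ⟨U t ψ, hU.rapid t ψ ψ.2⟩ : rapid N) : Fock N) t := by
  obtain ⟨φ, h1, h2⟩ := hU.hasDerivAt t ψ ψ.2
  rw [← (coe_eq_neg_I_smul_quadOp (ψ := ⟨U t ψ, hU.rapid t ψ ψ.2⟩)).1 h1]
  exact h2

theorem timeOrderedExp_unique_on {I : Set ℝ} (hI : I.OrdConnected) (h0 : (0 : ℝ) ∈ I)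
    {H : ℝ → ModeMatrix N} (hq : ∀ t, IsQuadMatrix (H t)) {U : ℝ → Fock N →L[ℂ] Fock N}
    (hU : IsTimeOrderedExp (fun t => quadOp (H t)) U) {ψ : rapid N} {y : ℝ → rapid N}
    (hy0 : y 0 = ψ) (hy : ∀ t ∈ I, HasDerivAt (fun s => (y s : Fock N))
      (-Complex.I • quad (H t) (y t) : rapid N) t) {t : ℝ} (ht : t ∈ I) : U t ψ = y t := by
  have := evolution_unique hI hq (x := fun s => ⟨U s ψ, hU.rapid s ψ ψ.2⟩) (y := y)
    (fun t _ => timeOrderedExp_hasDerivAt hU ψ t) hy h0 ht (by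
      rw [hy0]; exact Subtype.ext (by simp [hU.zero]))
  exact congrArg Subtype.val this

theorem existsUnique_timeOrderedExp {H : ℝ → ModeMatrix N} (hc : Continuous H)
    (hq : ∀ t, IsQuadMatrix (H t)) :
    ∃! U : ℝ → Fock N →L[ℂ] Fock N, IsTimeOrderedExp (fun t => quadOp (H t)) U := by
  obtain ⟨W, V, hW0, hW, hWV⟩ := exists_propagator hc hq
  have hn : ∀ t ψ, ‖W t ψ‖ = ‖ψ‖ := fun t ψ => by
    rw [evolution_norm_eq ordConnected_univ hq (x := fun s => W s ψ)
      (fun t _ => (hW ψ t).hasDerivAt) (mem_univ 0) (mem_univ t), hW0]; rfl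
  choose U hU hUW using fun t => exists_unitary_extension (hn t) (hWV t).1
  have hUd : ∀ (ψ : rapid N) t, HasDerivAt (fun s => U s ψ)
      ((-Complex.I • quad (H t) (W t ψ) : rapid N) : Fock N) t := fun ψ t => by
    simp only [hUW]; exact (hW ψ t).hasDerivAt
  refine ⟨U, ⟨?_, hU, fun t ψ hψ => ?_, fun t ψ hψ => ?_⟩, fun U' hU' => ?_⟩
  · exact clm_ext_rapid fun ψ => by rw [hUW, hW0]; rfl
  · rw [hUW t ⟨ψ, hψ⟩]; exact (W t ⟨ψ, hψ⟩).2
  · refine ⟨_, ?_, hUd ⟨ψ, hψ⟩ t⟩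
    rw [hUW t ⟨ψ, hψ⟩]
    exact coe_eq_neg_I_smul_quadOp.2 rfl
  · funext t
    refine clm_ext_rapid fun ψ => ?_
    rw [hUW]
    exact timeOrderedExp_unique_on ordConnected_univ (mem_univ 0) hq hU' (y := fun s => W s ψ) (by rw [hW0]; rfl)
      (fun t _ => (hW ψ t).hasDerivAt) (mem_univ t)

/-- A product rule for families differentiable only on particular vectors: the remainder of `x`
passes through `W s` isometrically, and strong continuity at `x'` replaces continuity of `W` in
operator norm. -/
theorem hasDerivAt_strong_mul {W : ℝ → Fock N →L[ℂ] Fock N} {x : ℝ → Fock N} {x' w : Fock N} {t : ℝ}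
    (hW : ∀ s y, ‖W s y‖ = ‖y‖) (hx : HasDerivAt x x' t)
    (hw : HasDerivAt (fun s => W s (x t)) w t) (hc : ContinuousAt (fun s => W s x') t) :
    HasDerivAt (fun s => W s (x s)) (w + W t x') t := by
  rw [hasDerivAt_iff_isLittleO] at hx hw ⊢
  have h1 : (fun s => W s (x s - x t - (s - t) • x')) =o[𝓝 t] fun s => s - t :=
    Asymptotics.IsLittleO.of_norm_left (by
      simp only [hW]; exact hx.norm_left)
  have h2 : (fun s => (s - t) • (W s x' - W t x')) =o[𝓝 t] fun s => s - t := by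
    have h3 : (fun s => W s x' - W t x') =o[𝓝 t] fun _ => (1 : ℝ) := by
      rw [Asymptotics.isLittleO_one_iff, tendsto_sub_nhds_zero_iff]
      exact hc
    simpa using (Asymptotics.isBigO_refl (fun s => s - t) (𝓝 t)).smul_isLittleO h3
  refine ((hw.add h1).add h2).congr_left fun s => ?_
  have e : W s ((s - t) • x') = (s - t) • W s x' := by
    exact ((W s).restrictScalars ℝ).map_smul (s - t) x'
  rw [map_sub, map_sub, e, smul_sub, smul_add]
  abel

theorem IsUnitaryGroup.hasDerivAt_rapid {H : ModeMatrix N} {V : ℝ → Fock N →L[ℂ] Fock N}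
    (hV : IsUnitaryGroup (quadOp H) V) (ψ : rapid N) (t : ℝ) :
    HasDerivAt (fun s => V s ψ) (V t ((-Complex.I • quad H ψ : rapid N) : Fock N)) t := by
  obtain ⟨φ, h1, h2⟩ := hV.hasDerivAt ψ ψ.2
  rw [(coe_eq_neg_I_smul_quadOp (ψ := ψ)).1 h1] at h2
  have h3 : HasDerivAt (fun s => V (s - t) ψ)
      ((-Complex.I • quad H ψ : rapid N) : Fock N) t := by
    have h2' : HasDerivAt (fun s => V s ψ)
      ((-Complex.I • quad H ψ : rapid N) : Fock N) (t - t) := by rwa [sub_self]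
    exact h2'.comp_sub_const t t
  have h4 := ((V t).restrictScalars ℝ).hasFDerivAt.comp_hasDerivAt t h3
  refine (h4.congr_deriv rfl).congr_of_eventuallyEq (Eventually.of_forall fun s => ?_)
  have := hV.add t (s - t)
  rw [add_sub_cancel] at this
  change V s ψ = V t (V (s - t) ψ)
  rw [this]; rfl

/-- An abstract group is not known to preserve rapid decrease, so `evolution_unique` does not apply
to `V t ψ`. Instead `V (-s) (y s)` is constant: its two derivative terms cancel, and both only
involve the rapidly decreasing vector `y s`. -/
theorem IsUnitaryGroup.apply_eq {H : ModeMatrix N}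
    {V : ℝ → Fock N →L[ℂ] Fock N} (hV : IsUnitaryGroup (quadOp H) V) {ψ : rapid N}
    {y : ℝ → rapid N} (hy0 : y 0 = ψ) (hy : ∀ t, HasDerivAt (fun s => (y s : Fock N))
      (-Complex.I • quad H (y t) : rapid N) t) (t : ℝ) : V t ψ = y t := by
  have hd : ∀ t, HasDerivAt (fun s => V (-s) (y s)) 0 t := by
    intro t
    have h1 : HasDerivAt (fun s => V (-s) (y t : Fock N))
        (-V (-t) ((-Complex.I • quad H (y t) : rapid N) : Fock N)) t := by
      simpa [Function.comp_def] using (hV.hasDerivAt_rapid (y t) (-t)).scomp t (hasDerivAt_neg t)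
    have h2 := hasDerivAt_strong_mul (W := fun s => V (-s))
      (fun s y => unitary_norm_map (hV.isUnitary _) y) (hy t) h1
      ((hV.continuous _).comp continuous_neg).continuousAt
    simpa using h2
  have hconst := is_const_of_deriv_eq_zero (f := fun s => V (-s) (y s : Fock N))
    (fun t => (hd t).differentiableAt) (fun t => (hd t).deriv) t 0
  have h0 : V t (V (-t) (y t : Fock N)) = y t := by
    have := hV.add t (-t)
    rw [add_neg_cancel, hV.zero] at this
    exact (DFunLike.congr_fun this (y t : Fock N)).symm
  simp only [neg_zero, hV.zero, hy0] at hconst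
  rw [← h0, hconst]; rfl

theorem existsUnique_unitaryGroup {H : ModeMatrix N} (hq : IsQuadMatrix H) :
    ∃! V : ℝ → Fock N →L[ℂ] Fock N, IsUnitaryGroup (quadOp H) V := by
  obtain ⟨W, W', hW0, hW, hWV⟩ := exists_propagator (H := fun _ => H) continuous_const fun _ => hq
  have hn : ∀ t ψ, ‖W t ψ‖ = ‖ψ‖ := fun t ψ => by
    rw [evolution_norm_eq ordConnected_univ (fun _ => hq) (x := fun s => W s ψ)
      (fun t _ => (hW ψ t).hasDerivAt) (mem_univ 0) (mem_univ t), hW0]; rfl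
  choose U hU hUW using fun t => exists_unitary_extension (hn t) (hWV t).1
  have hUd : ∀ (ψ : rapid N) t, HasDerivAt (fun s => U s ψ)
      ((-Complex.I • quad H (W t ψ) : rapid N) : Fock N) t := fun ψ t => by
    simp only [hUW]; exact (hW ψ t).hasDerivAt
  have h0 : U 0 = 1 := clm_ext_rapid fun ψ => by rw [hUW, hW0]; rfl
  refine ⟨U, ⟨h0, fun s t => ?_, hU, fun x => ?_, fun ψ hψ => ?_⟩, fun U' hU' => ?_⟩
  · refine clm_ext_rapid fun ψ => ?_
    rw [mul_apply_eq_comp, hUW, hUW, hUW]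
    refine congrArg Subtype.val (evolution_unique ordConnected_univ (fun _ => hq)
      (x := fun s => W (s + t) ψ) (y := fun s => W s (W t ψ)) (fun s _ => ?_)
      (fun s _ => (hW _ s).hasDerivAt) (mem_univ 0) (mem_univ s) (by rw [zero_add, hW0]; rfl))
    simpa [Function.comp_def] using (hW ψ (s + t)).hasDerivAt.scomp s ((hasDerivAt_id s).add_const t)
  -- Strong continuity passes from the dense rapidly decreasing vectors to all vectors because the
  -- operators are isometries.
  · rw [Metric.continuous_iff]
    intro t ε hε
    obtain ⟨ψ, hψ, hd⟩ := Metric.mem_closure_iff.1 (dense_rapid x) (ε / 3) (by positivity)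
    obtain ⟨δ, hδ, hδ'⟩ := Metric.continuousAt_iff.1 (hUd ⟨ψ, hψ⟩ t).continuousAt (ε / 3)
      (by positivity)
    refine ⟨δ, hδ, fun s hs => ?_⟩
    have h1 : ∀ s, dist (U s x) (U s ψ) = dist x ψ := fun s => by
      rw [dist_eq_norm, ← map_sub, unitary_norm_map (hU s), dist_eq_norm]
    have h2 := dist_triangle4 (U s x) (U s ψ) (U t ψ) (U t x)
    have h3 := hδ' hs
    rw [dist_comm (U t ψ), h1, h1] at h2
    simp only at h3
    linarith
  · refine ⟨_, ?_, hUd ⟨ψ, hψ⟩ 0⟩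
    rw [hW0]
    exact coe_eq_neg_I_smul_quadOp.2 rfl
  · funext t
    refine clm_ext_rapid fun ψ => ?_
    rw [hUW]
    exact hU'.apply_eq (y := fun s => W s ψ) (by rw [hW0]; rfl) (fun t => (hW ψ t).hasDerivAt) t

end Propagators

/-! ### Block structure and symplecticity of the matrix exponentials. -/

section DoubledMatrices
variable {N : ℕ}

/-- Matrices of the block form `(α β; β̄ ᾱ)`. -/
def IsDoubled (S : ModeMatrix N) : Prop := ∀ m n, S m.swap n.swap = star (S m n)

theorem isDoubled_iff {S : ModeMatrix N} : IsDoubled S ↔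
    ∃ α β : Matrix (Fin N) (Fin N) ℂ, S = fromBlocks α β (β.map star) (α.map star) := by
  constructor
  · intro h
    refine ⟨S.toBlocks₁₁, S.toBlocks₁₂, ?_⟩
    conv_lhs => rw [← fromBlocks_toBlocks S]
    congr 1
    · ext i j; exact h (Sum.inl i) (Sum.inr j)
    · ext i j; exact h (Sum.inl i) (Sum.inl j)
  · rintro ⟨α, β, rfl⟩ (i | i) (j | j) <;> simp

theorem isQuadMatrix_iff {H : ModeMatrix N} : IsQuadMatrix H ↔ IsDoubled H ∧ Hᴴ = H := by
  constructor
  · intro h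
    refine ⟨isDoubled_iff.2 ?_, h.isHermitian⟩
    obtain ⟨A, B, _, _, h⟩ := h
    exact ⟨A, B, h⟩
  · rintro ⟨h1, h2⟩
    obtain ⟨A, B, rfl⟩ := isDoubled_iff.1 h1
    rw [fromBlocks_conjTranspose, fromBlocks_inj] at h2
    refine ⟨A, B, h2.1, ?_, rfl⟩
    conv_rhs => rw [← h2.2.1]
    ext i j; simp

theorem IsQuadMatrix.swap_swap {H : ModeMatrix N} (h : IsQuadMatrix H) (m n : Fin N ⊕ Fin N) :
    H m.swap n.swap = H n m := by
  rw [(isQuadMatrix_iff.1 h).1 m n]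
  exact congrFun (congrFun (isQuadMatrix_iff.1 h).2 n) m

theorem sum_swap {M : Type*} [AddCommMonoid M] (f : Fin N ⊕ Fin N → M) :
    ∑ m : Fin N ⊕ Fin N, f m.swap = ∑ m, f m :=
  (Equiv.sumComm (Fin N) (Fin N)).sum_comp f

theorem IsDoubled.mul {S T : ModeMatrix N} (hS : IsDoubled S) (hT : IsDoubled T) :
    IsDoubled (S * T) := by
  intro m n
  rw [mul_apply, mul_apply, ← sum_swap, star_sum]
  refine Finset.sum_congr rfl fun k _ => ?_
  rw [hS, hT, star_mul']

theorem IsDoubled.conjTranspose {S : ModeMatrix N} (hS : IsDoubled S) : IsDoubled Sᴴ := by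
  intro m n
  rw [conjTranspose_apply, hS, conjTranspose_apply]

theorem isDoubled_one : IsDoubled (1 : ModeMatrix N) := by
  intro m n
  by_cases h : m = n
  · subst h; simp
  · rw [one_apply_ne h, one_apply_ne fun h' => h (Sum.swap_rightInverse.injective h')]
    simp

theorem IsQuadMatrix.conj {G S : ModeMatrix N} (hG : IsQuadMatrix G) (hS : IsDoubled S) :
    IsQuadMatrix (S * G * Sᴴ) := by
  rw [isQuadMatrix_iff] at hG ⊢
  refine ⟨(hS.mul hG.1).mul hS.conjTranspose, ?_⟩
  rw [conjTranspose_mul, conjTranspose_mul, hG.2, conjTranspose_conjTranspose, Matrix.mul_assoc]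

theorem symK_conjTranspose : (symK N)ᴴ = symK N := by
  simp [symK, fromBlocks_conjTranspose]

theorem symK_mul_symK : symK N * symK N = 1 := by
  simp [symK, fromBlocks_multiply]

/-- The matrix `J` that exchanges annihilation and creation operators. -/
def swapJ (N : ℕ) : ModeMatrix N := fromBlocks 0 1 1 0

theorem swapJ_mul_self : swapJ N * swapJ N = 1 := by
  simp [swapJ, fromBlocks_multiply]

theorem isUnit_swapJ : IsUnit (swapJ N) :=
  ⟨⟨swapJ N, swapJ N, swapJ_mul_self, swapJ_mul_self⟩, rfl⟩

theorem swapJ_inv : (swapJ N)⁻¹ = swapJ N := inv_eq_left_inv swapJ_mul_self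

/-- Written as `J S J = S̄`, the block condition is a conjugation identity, which passes through the
exponential. The entrywise conjugate appears as transpose of the adjoint, since both have known
exponentials. -/
theorem isDoubled_iff_swapJ {S : ModeMatrix N} :
    IsDoubled S ↔ swapJ N * S * swapJ N = (Sᴴ)ᵀ := by
  have h : swapJ N * S * swapJ N =
      fromBlocks S.toBlocks₂₂ S.toBlocks₂₁ S.toBlocks₁₂ S.toBlocks₁₁ := by
    conv_lhs => rw [← fromBlocks_toBlocks S]
    simp [swapJ, fromBlocks_multiply]
  rw [h]
  constructor
  · intro hS
    ext (i | i) (j | j)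
    · exact hS (Sum.inl i) (Sum.inl j)
    · exact hS (Sum.inl i) (Sum.inr j)
    · exact hS (Sum.inr i) (Sum.inl j)
    · exact hS (Sum.inr i) (Sum.inr j)
  · intro e m n
    have e1 := congrFun (congrFun e m) n
    rcases m with i | i <;> rcases n with j | j <;> exact e1

/-- `J` anticommutes with `K`, and this sign matches the one from conjugating the factor `i`: `J
(-2itKH) J` is the complex conjugate of `-2itKH`. -/
theorem isDoubled_sympExp {H : ModeMatrix N} (h : IsQuadMatrix H) (t : ℝ) :
    IsDoubled (sympExp H t) := by
  rw [isDoubled_iff_swapJ]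
  unfold sympExp
  have e := exp_conj (swapJ N) ((-(2 * Complex.I * (t : ℂ))) • (symK N * H)) isUnit_swapJ
  rw [swapJ_inv] at e
  rw [← e, ← exp_conjTranspose, ← exp_transpose]
  congr 1
  have h1 := isDoubled_iff_swapJ.1 (isQuadMatrix_iff.1 h).1
  have h2 : swapJ N * symK N = -(symK N * swapJ N) := by
    simp [swapJ, symK, fromBlocks_multiply, fromBlocks_neg]
  rw [conjTranspose_smul, transpose_smul, conjTranspose_mul, transpose_mul, ← h1,
    symK_conjTranspose]
  have h3 : (symK N)ᵀ = symK N := by simp [symK, fromBlocks_transpose]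
  rw [h3, Matrix.mul_smul, Matrix.smul_mul, ← Matrix.mul_assoc, h2]
  simp [Matrix.mul_assoc]

theorem sympExp_zero (H : ModeMatrix N) : sympExp H 0 = 1 := by
  simp [sympExp]

theorem sympExp_add (H : ModeMatrix N) (s t : ℝ) : sympExp H (s + t) = sympExp H s * sympExp H t := by
  unfold sympExp
  rw [← exp_add_of_commute _ _ (((Commute.refl _).smul_left _).smul_right _), ← add_smul]
  congr 2
  push_cast; ring

theorem sympExp_mul_neg (H : ModeMatrix N) (t : ℝ) : sympExp H t * sympExp H (-t) = 1 := by
  rw [← sympExp_add, add_neg_cancel, sympExp_zero]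

/-- Since `K (KH)† K = KH`, conjugating the adjoint of the exponential by `K` gives the inverse: `K
S† K = S⁻¹`. -/
theorem sympExp_symplectic {H : ModeMatrix N} (h : IsQuadMatrix H) (t : ℝ) :
    sympExp H t * symK N * (sympExp H t)ᴴ = symK N := by
  have e : symK N * (sympExp H t)ᴴ * symK N = sympExp H (-t) := by
    unfold sympExp
    have e := exp_conj (symK N) ((-(2 * Complex.I * (t : ℂ))) • (symK N * H))ᴴ
      ⟨⟨symK N, symK N, symK_mul_symK, symK_mul_symK⟩, rfl⟩
    rw [inv_eq_left_inv symK_mul_symK] at e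
    rw [← exp_conjTranspose, ← e]
    congr 1
    rw [conjTranspose_smul, conjTranspose_mul, h.isHermitian, symK_conjTranspose,
      Matrix.mul_smul, Matrix.smul_mul, Matrix.mul_assoc, Matrix.mul_assoc, symK_mul_symK,
      Matrix.mul_one]
    congr 1
    simp
  calc sympExp H t * symK N * (sympExp H t)ᴴ
      = sympExp H t * (symK N * (sympExp H t)ᴴ * symK N) * symK N := by
        simp only [Matrix.mul_assoc, symK_mul_symK, Matrix.mul_one]
    _ = symK N := by rw [e, sympExp_mul_neg, Matrix.one_mul]

theorem isComplexSymplectic_sympExp {H : ModeMatrix N} (h : IsQuadMatrix H) (t : ℝ) :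
    IsComplexSymplectic (sympExp H t) :=
  ⟨isDoubled_iff.1 (isDoubled_sympExp h t), sympExp_symplectic h t⟩

section
attribute [local instance] Matrix.linftyOpNormedRing Matrix.linftyOpNormedAlgebra

theorem hasDerivAt_sympExp_apply (H : ModeMatrix N) (t : ℝ) (m n : Fin N ⊕ Fin N) :
    HasDerivAt (fun s => sympExp H s m n)
      ((sympExp H t * (-(2 * Complex.I) • (symK N * H))) m n) t := by
  have h := hasDerivAt_exp_smul_const (𝕂 := ℝ) (-(2 * Complex.I) • (symK N * H)) t
  have h2 := (hasDerivAt_pi.1 ((hasDerivAt_pi.1 h) m)) n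
  have e : ∀ s : ℝ, sympExp H s = NormedSpace.exp (s • (-(2 * Complex.I) • (symK N * H))) := by
    intro s
    unfold sympExp
    congr 1
    ext i j
    simp
    ring
  simp only [e]
  exact h2

end

end DoubledMatrices

/-! ### The linear action of quadratic unitaries on the mode operators. -/

section ModeTransformation
open Set Filter Topology
variable {N : ℕ}

/-- Commuting past `ξ_p† ξ_q` leaves two contractions. The symmetry `H_{m̄ n̄} = H_{nm}` of a
quadratic matrix, with bars for the exchange of annihilation and creation, makes their sums equal,
hence the factor two. -/
theorem mode_mul_quad {H : ModeMatrix N} (h : IsQuadMatrix H) (m : Fin N ⊕ Fin N) :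
    mode m * quad H = quad H * mode m + (2 : ℂ) • ∑ n, (symK N * H) m n • mode n := by
  have h1 : ∀ p q : Fin N ⊕ Fin N, mode m * (mode p.swap * mode q) =
      (mode p.swap * mode q) * mode m + (symK N m p • mode q + symK N m q.swap • mode p.swap) := by
    intro p q
    have e2 := mode_ccr m q.swap
    rw [Sum.swap_swap] at e2
    rw [← mul_assoc, mode_ccr, add_mul, mul_assoc (mode p.swap) (mode m), e2, mul_add]
    simp only [smul_mul_assoc, one_mul, mul_smul_comm, mul_one, mul_assoc]
    abel
  have h2 : mode m * quad H = quad H * mode m +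
      ∑ p, ∑ q, H p q • (symK N m p • mode q + symK N m q.swap • mode p.swap) := by
    simp only [quad, Finset.mul_sum, Finset.sum_mul, mul_smul_comm, smul_mul_assoc, h1, smul_add,
      Finset.sum_add_distrib]
  rw [h2]
  congr 1
  have h3 : ∑ p, ∑ q, H p q • symK N m p • (mode q : Module.End ℂ (rapid N)) =
      ∑ n, (symK N * H) m n • mode n := by
    rw [Finset.sum_comm]
    refine Finset.sum_congr rfl fun q _ => ?_
    rw [mul_apply, Finset.sum_smul]
    refine Finset.sum_congr rfl fun p _ => ?_
    rw [smul_smul, mul_comm]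
  have h4 : ∑ p : Fin N ⊕ Fin N, ∑ q, H p q • symK N m q.swap •
      (mode p.swap : Module.End ℂ (rapid N)) = ∑ n, (symK N * H) m n • mode n := by
    rw [← sum_swap]
    refine Finset.sum_congr rfl fun p _ => ?_
    rw [← sum_swap, mul_apply, Finset.sum_smul]
    refine Finset.sum_congr rfl fun q _ => ?_
    rw [Sum.swap_swap, Sum.swap_swap, h.swap_swap, smul_smul, mul_comm]
  simp only [smul_add, Finset.sum_add_distrib, h3, h4]
  exact (two_smul ℂ _).symm

theorem HasRapidDerivAt.mode {y : ℝ → rapid N} {y' : rapid N} {t : ℝ}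
    (h : HasRapidDerivAt y y' t) (m : Fin N ⊕ Fin N) :
    HasDerivAt (fun s => (mode m (y s) : Fock N)) (mode m y' : Fock N) t := by
  have h1 := h 1
  simp only [pow_one] at h1
  rw [hasDerivAt_iff_isLittleO] at h1 ⊢
  refine Asymptotics.IsBigO.trans_isLittleO (Asymptotics.IsBigO.of_bound 1
    (Eventually.of_forall fun s => ?_)) h1
  rw [one_mul]
  have e : ∀ A : Module.End ℂ (rapid N), (A (y s) : Fock N) - A (y t) - (s - t) • (A y' : Fock N) =
      (A (y s - y t - ((s - t : ℝ) : ℂ) • y') : rapid N) := by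
    intro A
    rw [map_sub, map_sub, map_smul]; rfl
  rw [e, e]
  exact norm_mode_le m _

/-- `W` is the restriction of the unitary group of `quad H` to the rapidly decreasing vectors. -/
structure IsRapidGroup (H : ModeMatrix N) (W : ℝ → Module.End ℂ (rapid N)) : Prop where
  zero : W 0 = 1
  deriv : ∀ ψ t, HasRapidDerivAt (fun s => W s ψ) (-Complex.I • quad H (W t ψ)) t
  mul_neg : ∀ t, W t * W (-t) = 1
  coe : ∀ t (ψ : rapid N), unitaryExp (quadOp H) t ψ = W t ψ

theorem isUnitaryGroup_unitaryExp {H : ModeMatrix N} (hq : IsQuadMatrix H) :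
    IsUnitaryGroup (quadOp H) (unitaryExp (quadOp H)) := by
  have h := (existsUnique_unitaryGroup hq).exists
  rw [unitaryExp, dif_pos h]
  exact h.choose_spec

theorem exists_isRapidGroup {H : ModeMatrix N} (hq : IsQuadMatrix H) : ∃ W, IsRapidGroup H W := by
  obtain ⟨W, V, hW0, hW, -⟩ := exists_propagator (H := fun _ => H) continuous_const fun _ => hq
  have hg := isUnitaryGroup_unitaryExp hq
  have hc : ∀ t (ψ : rapid N), unitaryExp (quadOp H) t ψ = W t ψ := fun t ψ =>
    hg.apply_eq (y := fun s => W s ψ) (by rw [hW0]; rfl) (fun t => (hW ψ t).hasDerivAt) t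
  refine ⟨W, hW0, hW, fun t => LinearMap.ext fun ψ => Subtype.ext ?_, hc⟩
  rw [Module.End.mul_apply, ← hc, ← hc, ← mul_apply_eq_comp, ← hg.add, add_neg_cancel, hg.zero]
  rfl

theorem IsRapidGroup.mode_mul {H : ModeMatrix N} (hq : IsQuadMatrix H)
    {W : ℝ → Module.End ℂ (rapid N)} (hW : IsRapidGroup H W) (t : ℝ) (m : Fin N ⊕ Fin N) :
    mode m * W t = W t * ∑ n, sympExp H t m n • mode n := by
  -- The derivative of `S(-t)` cancels the commutator `2KH`, so the left side applied to `ψ` solves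
  -- the evolution equation; so does the right side, with the same initial value `ξ_m ψ`.
  have key : ∀ t m, ∑ n, sympExp H (-t) m n • (mode n * W t) = W t * mode m := by
    intro t m
    ext1 ψ
    have hd : ∀ s n, HasDerivAt (fun s => sympExp H (-s) m n • (mode n (W s ψ) : Fock N))
        (sympExp H (-s) m n • (mode n (-Complex.I • quad H (W s ψ)) : Fock N) +
          (-(sympExp H (-s) * (-(2 * Complex.I) • (symK N * H))) m n) • (mode n (W s ψ) : Fock N))
        s := by
      intro s n
      have h1 : HasDerivAt (fun s => sympExp H (-s) m n)
          (-(sympExp H (-s) * (-(2 * Complex.I) • (symK N * H))) m n) s := by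
        simpa [Function.comp_def] using
          (hasDerivAt_sympExp_apply H (-s) m n).scomp s (hasDerivAt_neg s)
      exact h1.smul ((hW.deriv ψ s).mode n)
    have hx : ∀ s ∈ univ, HasDerivAt
        (fun s => ((∑ n, sympExp H (-s) m n • mode n (W s ψ) : rapid N) : Fock N))
        ((-Complex.I • quad H (∑ n, sympExp H (-s) m n • mode n (W s ψ)) : rapid N) : Fock N) s := by
      intro s _
      have h1 := HasDerivAt.fun_sum fun n (_ : n ∈ Finset.univ) => hd s n
      have e : ∀ s, ((∑ n, sympExp H (-s) m n • mode n (W s ψ) : rapid N) : Fock N) =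
          ∑ n, sympExp H (-s) m n • (mode n (W s ψ) : Fock N) := fun s => by
        rw [Submodule.coe_sum]; rfl
      simp only [e]
      refine h1.congr_deriv ?_
      have e2 : ∀ n, mode n (quad H (W s ψ)) = quad H (mode n (W s ψ)) +
          (2 : ℂ) • ∑ p, (symK N * H) n p • mode p (W s ψ) := by
        intro n
        have := LinearMap.congr_fun (mode_mul_quad hq n) (W s ψ)
        simpa [LinearMap.sum_apply] using this
      have e3 : ∑ n, (sympExp H (-s) m n • mode n (-Complex.I • quad H (W s ψ)) +
          (-(sympExp H (-s) * (-(2 * Complex.I) • (symK N * H))) m n) • mode n (W s ψ)) =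
          -Complex.I • quad H (∑ n, sympExp H (-s) m n • mode n (W s ψ)) := by
        have e4 : ∑ n, (-(sympExp H (-s) * (-(2 * Complex.I) • (symK N * H))) m n) •
            mode n (W s ψ) = ∑ n, sympExp H (-s) m n • (2 * Complex.I) •
              ∑ p, (symK N * H) n p • mode p (W s ψ) := by
          simp only [mul_apply (M := sympExp H (-s)), Finset.smul_sum, Finset.sum_smul,
            ← Finset.sum_neg_distrib]
          rw [Finset.sum_comm]
          refine Finset.sum_congr rfl fun p _ => Finset.sum_congr rfl fun n _ => ?_
          rw [smul_smul, smul_smul, Matrix.smul_apply]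
          congr 1
          simp; ring
        rw [Finset.sum_add_distrib, e4, map_sum, Finset.smul_sum, ← Finset.sum_add_distrib]
        refine Finset.sum_congr rfl fun n _ => ?_
        rw [map_smul, e2, map_smul]
        module
      rw [← e3, Submodule.coe_sum]; rfl
    have := evolution_unique ordConnected_univ (fun _ => hq) hx
      (fun s _ => (hW.deriv (mode m ψ) s).hasDerivAt) (mem_univ 0) (mem_univ t) (by
        simp only [neg_zero, sympExp_zero, hW.zero, Module.End.one_apply]
        rw [Finset.sum_eq_single m] <;> simp +contextual [one_apply, eq_comm])
    simpa [LinearMap.sum_apply] using this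
  rw [Finset.mul_sum]
  simp only [mul_smul_comm, ← key]
  calc mode m * W t = ∑ p, (1 : ModeMatrix N) m p • (mode p * W t) := by
        rw [Finset.sum_eq_single m] <;> simp +contextual [one_apply, eq_comm]
    _ = ∑ p, (∑ n, sympExp H t m n * sympExp H (-t) n p) • (mode p * W t) := by
        rw [← sympExp_mul_neg H t]; simp only [mul_apply]
    _ = _ := by
        simp only [Finset.sum_smul, Finset.smul_sum, smul_smul]
        rw [Finset.sum_comm]

/-- `W` is unitary, maps the rapidly decreasing vectors onto themselves, and acts by `S` on the mode
operators. -/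
structure ImplementsWith (W : Fock N →L[ℂ] Fock N) (S : ModeMatrix N)
    (w v : Module.End ℂ (rapid N)) : Prop where
  isUnitary : W ∈ unitary (Fock N →L[ℂ] Fock N)
  coe : ∀ ψ : rapid N, W ψ = w ψ
  mul_inv : w * v = 1
  mode_mul : ∀ m, mode m * w = w * ∑ n, S m n • mode n

theorem implementsWith_one : ImplementsWith (1 : Fock N →L[ℂ] Fock N) 1 1 1 where
  isUnitary := one_mem _
  coe _ := rfl
  mul_inv := mul_one 1
  mode_mul m := by
    rw [mul_one, one_mul, Finset.sum_eq_single m] <;> simp +contextual [one_apply, eq_comm]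

theorem ImplementsWith.mul {W W' : Fock N →L[ℂ] Fock N} {S S' : ModeMatrix N}
    {w v w' v' : Module.End ℂ (rapid N)} (h : ImplementsWith W S w v)
    (h' : ImplementsWith W' S' w' v') : ImplementsWith (W * W') (S * S') (w * w') (v' * v) where
  isUnitary := mul_mem h.isUnitary h'.isUnitary
  coe ψ := by rw [mul_apply_eq_comp, h'.coe, h.coe]; rfl
  mul_inv := by rw [mul_assoc, ← mul_assoc w', h'.mul_inv, one_mul, h.mul_inv]
  mode_mul m := by
    rw [← mul_assoc, h.mode_mul, mul_assoc, mul_assoc, Finset.sum_mul]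
    congr 1
    simp only [smul_mul_assoc, h'.mode_mul, Finset.mul_sum, mul_smul_comm, mul_apply,
      Finset.sum_smul, Finset.smul_sum, smul_smul]
    rw [Finset.sum_comm]

theorem ImplementsWith.actsOnModesAs {W : Fock N →L[ℂ] Fock N} {S : ModeMatrix N}
    {w v : Module.End ℂ (rapid N)} (h : ImplementsWith W S w v) : ActsOnModesAs W S := by
  have hadj : ∀ x, ContinuousLinearMap.adjoint W (W x) = x := fun x =>
    DFunLike.congr_fun (Unitary.mem_iff.1 h.isUnitary).1 x
  intro ψ
  refine ⟨⟨fun hψ => ?_, fun hψ => ?_⟩, fun hψ m => ?_⟩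
  -- If `W ψ` is rapidly decreasing, then it is also the image of a rapidly decreasing vector, which
  -- equals `ψ` by injectivity.
  · have e : W (v ⟨W ψ, hψ⟩) = W ψ := by
      rw [h.coe, ← Module.End.mul_apply, h.mul_inv]; rfl
    have e2 : (v ⟨W ψ, hψ⟩ : Fock N) = ψ := by
      rw [← hadj (v ⟨W ψ, hψ⟩), e, hadj]
    rw [← e2]; exact (v ⟨W ψ, hψ⟩).2
  · have := (w ⟨ψ, hψ⟩).2
    rw [← h.coe] at this
    exact this
  · refine ⟨mode m (w ⟨ψ, hψ⟩), ?_, ?_⟩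
    · rw [coe_mode, ← h.coe]
    · rw [← Module.End.mul_apply, h.mode_mul, Module.End.mul_apply, ← h.coe, hadj,
        LinearMap.sum_apply, Submodule.coe_sum, lp.coeFn_sum]
      rfl

theorem IsRapidGroup.implementsWith {H : ModeMatrix N} (hq : IsQuadMatrix H)
    {W : ℝ → Module.End ℂ (rapid N)} (hW : IsRapidGroup H W) (t : ℝ) :
    ImplementsWith (unitaryExp (quadOp H) t) (sympExp H t) (W t) (W (-t)) where
  isUnitary := (isUnitaryGroup_unitaryExp hq).isUnitary t
  coe := hW.coe t
  mul_inv := hW.mul_neg t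
  mode_mul := hW.mode_mul hq t

theorem unitaryProd_succ {m : ℕ} (A : Fin (m + 1) → SeqOp N) (f : Fin (m + 1) → ℝ) :
    unitaryProd A f =
      unitaryExp (A 0) (f 0) * unitaryProd (fun j => A j.succ) (fun j => f j.succ) := by
  simp [unitaryProd, List.ofFn_succ]

theorem sympProd_succ {m : ℕ} (G : Fin (m + 1) → ModeMatrix N) (f : Fin (m + 1) → ℝ) :
    sympProd G f = sympExp (G 0) (f 0) * sympProd (fun j => G j.succ) (fun j => f j.succ) := by
  simp [sympProd, List.ofFn_succ]

theorem exists_implementsWith_unitaryProd {m : ℕ} {G : Fin m → ModeMatrix N}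
    (hG : ∀ j, IsQuadMatrix (G j)) (f : Fin m → ℝ) :
    ∃ w v, ImplementsWith (unitaryProd (fun j => quadOp (G j)) f) (sympProd G f) w v := by
  induction m with
  | zero => exact ⟨1, 1, by simpa [unitaryProd, sympProd] using implementsWith_one⟩
  | succ m ih =>
    obtain ⟨w, v, h⟩ := ih (fun j => hG j.succ) fun j => f j.succ
    obtain ⟨W, hW⟩ := exists_isRapidGroup (hG 0)
    rw [unitaryProd_succ, sympProd_succ]
    exact ⟨_, _, (hW.implementsWith (hG 0) (f 0)).mul h⟩

end ModeTransformation

/-! ### Faithfulness, conjugation and dimension of the quadratic operators. -/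

section QuadraticMatrices
variable {N : ℕ}

theorem end_smul_one_eq_zero {c : ℂ} (h : c • (1 : Module.End ℂ (rapid N)) = 0) : c = 0 := by
  have h1 := LinearMap.congr_fun h ⟨vacuum N, single_mem_rapid 0 1⟩
  have h2 := congrArg (fun x : rapid N => (x : Fock N) 0) h1
  have h3 : c * (vacuum N : Fock N) 0 = 0 := h2
  simpa [vacuum] using h3

/-- A quadratic matrix is determined by its quadratic operator. -/
theorem eq_zero_of_quad_eq_zero {X : ModeMatrix N} (hX : IsQuadMatrix X) (h : quad X = 0) :
    X = 0 := by
  have h1 : ∀ m, ∑ n, (symK N * X) m n • (mode n : Module.End ℂ (rapid N)) = 0 := by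
    intro m
    have := mode_mul_quad hX m
    rw [h, mul_zero, zero_mul, zero_add] at this
    exact (smul_eq_zero.1 this.symm).resolve_left two_ne_zero
  -- A second commutator, now with `ξ_p†`, reduces the vanishing linear combination of mode
  -- operators to a multiple of the identity.
  have h2 : symK N * X * symK N = 0 := by
    ext m p
    refine end_smul_one_eq_zero (N := N) ?_
    have e1 : (∑ n, (symK N * X) m n • (mode n : Module.End ℂ (rapid N))) * mode p.swap =
        mode p.swap * (∑ n, (symK N * X) m n • mode n) + (symK N * X * symK N) m p • 1 := by
      simp only [Finset.sum_mul, Finset.mul_sum, smul_mul_assoc, mul_smul_comm, mode_ccr, smul_add,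
        Finset.sum_add_distrib, mul_apply (M := symK N * X), Finset.sum_smul, smul_smul]
    rw [h1, zero_mul, mul_zero, zero_add] at e1
    exact e1.symm
  calc X = symK N * (symK N * X * symK N) * symK N := by
        simp only [Matrix.mul_assoc, symK_mul_symK, Matrix.mul_one]
        rw [← Matrix.mul_assoc, symK_mul_symK, Matrix.one_mul]
    _ = 0 := by rw [h2, Matrix.mul_zero, Matrix.zero_mul]

theorem quad_injective {X Y : ModeMatrix N} (hX : IsQuadMatrix X) (hY : IsQuadMatrix Y)
    (h : quad X = quad Y) : X = Y := by
  rw [← sub_eq_zero]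
  refine eq_zero_of_quad_eq_zero (sub_eq_add_neg X Y ▸ hX.add hY.neg) ?_
  rw [sub_eq_add_neg, quad_add, quad_neg, h, add_neg_cancel]

/-- Each mode operator crosses `W f` at the price of `S = e^{2ifKH}`. The doubled form of `S` makes
the adjoint mode operators cross with its conjugate, so the matrix becomes `S† G S`. -/
theorem IsRapidGroup.mul_quad {H : ModeMatrix N} (hq : IsQuadMatrix H)
    {W : ℝ → Module.End ℂ (rapid N)} (hW : IsRapidGroup H W) (f : ℝ) (G : ModeMatrix N) :
    W f * quad G = quad ((sympExp H (-f))ᴴ * G * ((sympExp H (-f))ᴴ)ᴴ) * W f := by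
  set S := sympExp H (-f) with hS
  have hSd : IsDoubled S := isDoubled_sympExp hq (-f)
  have h1 : ∀ m, W f * mode m = ∑ n, S m n • (mode n * W f) := by
    intro m
    have e := hW.mode_mul hq (-f) m
    have e1 : W (-f) * W f = 1 := by simpa using hW.mul_neg (-f)
    calc W f * mode m = W f * (mode m * W (-f)) * W f := by
          rw [mul_assoc, mul_assoc, e1, mul_one]
      _ = (W f * W (-f)) * (∑ n, S m n • mode n) * W f := by
          rw [e]; simp only [mul_assoc, hS]
      _ = _ := by
          rw [hW.mul_neg, one_mul, Finset.sum_mul]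
          simp only [smul_mul_assoc]
  have h2 : ∀ m, W f * mode m.swap = ∑ n : Fin N ⊕ Fin N, star (S m n) • (mode n.swap * W f) := by
    intro m
    rw [h1, ← sum_swap]
    refine Finset.sum_congr rfl fun n _ => ?_
    rw [hSd]
  have h3 : ∀ p q, W f * (mode p.swap * mode q) =
      ∑ k, ∑ l, (star (S p k) * S q l) • (mode k.swap * mode l * W f) := by
    intro p q
    rw [← mul_assoc, h2, Finset.sum_mul]
    refine Finset.sum_congr rfl fun k _ => ?_
    rw [smul_mul_assoc, mul_assoc, h1, Finset.mul_sum, Finset.smul_sum]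
    refine Finset.sum_congr rfl fun l _ => ?_
    rw [mul_smul_comm, smul_smul, mul_assoc]
  have h4 : W f * quad G = ∑ p, ∑ q, ∑ k, ∑ l,
      (G p q * (star (S p k) * S q l)) • (mode k.swap * mode l * W f) := by
    simp only [quad, Finset.mul_sum, mul_smul_comm, h3, Finset.smul_sum, smul_smul]
  have h5 : ∀ k l, (Sᴴ * G * Sᴴᴴ) k l = ∑ p, ∑ q, G p q * (star (S p k) * S q l) := by
    intro k l
    rw [conjTranspose_conjTranspose, mul_apply, Finset.sum_comm]
    refine Finset.sum_congr rfl fun q _ => ?_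
    rw [mul_apply, Finset.sum_mul]
    refine Finset.sum_congr rfl fun p _ => ?_
    rw [conjTranspose_apply]; ring
  rw [h4, quad, Finset.sum_mul]
  simp only [Finset.sum_mul, smul_mul_assoc, h5, Finset.sum_smul]
  calc _ = ∑ p, ∑ k, ∑ l, ∑ q,
        (G p q * (star (S p k) * S q l)) • (mode k.swap * mode l * W f) := by
        refine Finset.sum_congr rfl fun p _ => ?_
        rw [Finset.sum_comm]
        refine Finset.sum_congr rfl fun k _ => Finset.sum_comm
    _ = _ := by
        rw [Finset.sum_comm]
        refine Finset.sum_congr rfl fun k _ => Finset.sum_comm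

variable (N) in
/-- Real coordinates of a quadratic matrix. -/
def quadCoords : quadSubmodule N →ₗ[ℝ] (Fin N × Fin N → ℝ) × (Sym2 (Fin N) → ℂ) where
  toFun H := (fun p => ((H : ModeMatrix N) (Sum.inl p.1) (Sum.inl p.2)).re +
      ((H : ModeMatrix N) (Sum.inl p.1) (Sum.inl p.2)).im,
    fun s => (H : ModeMatrix N) (Sum.inl s.out.1) (Sum.inr s.out.2))
  map_add' H H' := by
    ext <;> simp; ring
  map_smul' c H := by
    ext <;> simp; ring

/-- For Hermitian `A` the real part is symmetric and the imaginary part antisymmetric, so their sum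
over all ordered pairs determines both; symmetric `B` needs one entry per unordered pair. The count
is `N² + N(N+1) = N(2N+1)`. -/
theorem quadCoords_injective : Function.Injective (quadCoords N) := by
  rw [← LinearMap.ker_eq_bot, LinearMap.ker_eq_bot']
  rintro ⟨H, A, B, hA, hB, rfl⟩ h
  have h1 : ∀ i j, (A i j).re + (A i j).im = 0 := fun i j => congrFun (congrArg Prod.fst h) (i, j)
  have h2 : ∀ s : Sym2 (Fin N), B s.out.1 s.out.2 = 0 := fun s => congrFun (congrArg Prod.snd h) s
  have hA0 : A = 0 := by
    ext i j
    have e : star (A j i) = A i j := congrFun (congrFun hA i) j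
    have er : (A j i).re = (A i j).re := by rw [← e]; simp
    have ei : -(A j i).im = (A i j).im := by rw [← e]; simp
    have h3 := h1 i j
    have h4 := h1 j i
    exact Complex.ext (by simp; linarith) (by simp; linarith)
  have hB0 : B = 0 := by
    ext i j
    have e : B j i = B i j := congrFun (congrFun hB i) j
    have h3 := h2 s(i, j)
    have h4 : s((s(i, j)).out.1, (s(i, j)).out.2) = s(i, j) := Quot.out_eq _
    rcases Sym2.eq_iff.1 h4 with ⟨h5, h6⟩ | ⟨h5, h6⟩
    · rw [h5, h6] at h3; exact h3
    · rw [h5, h6, e] at h3; exact h3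
  refine Subtype.ext ?_
  subst hA0 hB0
  ext (i | i) (j | j) <;> simp

theorem finrank_quadSubmodule_le : Module.finrank ℝ (quadSubmodule N) ≤ N * (2 * N + 1) := by
  refine (LinearMap.finrank_le_finrank_of_injective (quadCoords_injective (N := N))).trans ?_
  rw [Module.finrank_prod, Module.finrank_pi_fintype, Module.finrank_pi_fintype]
  simp only [Module.finrank_self, Complex.finrank_real_complex, Finset.sum_const, Finset.card_univ,
    Fintype.card_prod, Fintype.card_fin, smul_eq_mul, Sym2.card, Nat.choose_two_right,
    Nat.add_sub_cancel]
  have : (N + 1) * N / 2 * 2 = (N + 1) * N :=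
    Nat.div_mul_cancel (by rw [mul_comm]; exact (Nat.even_mul_succ_self N).two_dvd)
  rw [this]
  apply le_of_eq; ring

theorem exists_quadBasis {G : Fin (N * (2 * N + 1)) → ModeMatrix N} (hG : ∀ j, IsQuadMatrix (G j))
    (hli : LinearIndependent ℝ G) :
    ∃ b : Module.Basis (Fin (N * (2 * N + 1))) ℝ (quadSubmodule N), ∀ j, (b j : ModeMatrix N) = G j := by
  let G' : Fin (N * (2 * N + 1)) → quadSubmodule N := fun j => ⟨G j, hG j⟩
  have hli' : LinearIndependent ℝ G' := LinearIndependent.of_comp (quadSubmodule N).subtype hli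
  have hcard : Fintype.card (Fin (N * (2 * N + 1))) = Module.finrank ℝ (quadSubmodule N) := by
    refine le_antisymm hli'.fintype_card_le_finrank ?_
    rw [Fintype.card_fin]
    exact finrank_quadSubmodule_le
  by_cases h0 : Nonempty (Fin (N * (2 * N + 1)))
  · refine ⟨basisOfLinearIndependentOfCardEqFinrank hli' hcard, fun j => ?_⟩
    rw [coe_basisOfLinearIndependentOfCardEqFinrank]
  -- Without modes there are no generators, and the space of quadratic matrices is trivial.
  · have h1 : IsEmpty (Fin (N * (2 * N + 1))) := not_nonempty_iff.1 h0
    have h2 : Module.finrank ℝ (quadSubmodule N) = 0 := by rw [← hcard]; simp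
    have h3 : Subsingleton (quadSubmodule N) := Module.finrank_zero_iff.1 h2
    exact ⟨Module.Basis.empty _, fun j => (h1.false j).elim⟩

end QuadraticMatrices

/-! ### Differentiation of ordered products and comparison with the time-ordered exponential. -/

section OrderedProducts
open Set Filter Topology
variable {N : ℕ}

theorem leftProd_zero {m : ℕ} (G : Fin (m + 1) → ModeMatrix N) (f : Fin (m + 1) → ℝ) :
    leftProd G f 0 = 1 := by
  simp [leftProd]

theorem leftProd_succ {m : ℕ} (G : Fin (m + 1) → ModeMatrix N) (f : Fin (m + 1) → ℝ) (j : Fin m) :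
    leftProd G f j.succ = (sympExp (G 0) (-f 0))ᴴ *
      leftProd (fun j => G j.succ) (fun j => f j.succ) j := by
  simp [leftProd, List.ofFn_succ]

theorem isDoubled_leftProd {m : ℕ} {G : Fin m → ModeMatrix N} (hG : ∀ j, IsQuadMatrix (G j))
    (f : Fin m → ℝ) (j : Fin m) : IsDoubled (leftProd G f j) := by
  induction m with
  | zero => exact j.elim0
  | succ m ih =>
    refine Fin.cases ?_ (fun j => ?_) j
    · rw [leftProd_zero]; exact isDoubled_one
    · rw [leftProd_succ]
      exact (isDoubled_sympExp (hG 0) _).conjTranspose.mul (ih (fun j => hG j.succ) _ j)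

theorem isQuadMatrix_transformedGen {m : ℕ} {G : Fin m → ModeMatrix N}
    (hG : ∀ j, IsQuadMatrix (G j)) (f : Fin m → ℝ) (j : Fin m) :
    IsQuadMatrix (transformedGen G f j) :=
  (hG j).conj (isDoubled_leftProd hG f j)

theorem sum_transformedGen_succ {m : ℕ} (G : Fin (m + 1) → ModeMatrix N) (f : Fin (m + 1) → ℝ)
    (c : Fin (m + 1) → ℝ) : ∑ j, c j • transformedGen G f j = c 0 • G 0 +
      (sympExp (G 0) (-f 0))ᴴ * (∑ j : Fin m, c j.succ •
        transformedGen (fun j => G j.succ) (fun j => f j.succ) j) *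
        ((sympExp (G 0) (-f 0))ᴴ)ᴴ := by
  rw [Fin.sum_univ_succ, Finset.mul_sum, Finset.sum_mul]
  congr 1
  · simp [transformedGen, leftProd_zero]
  · refine Finset.sum_congr rfl fun j _ => ?_
    rw [Matrix.mul_smul, Matrix.smul_mul, transformedGen, leftProd_succ, conjTranspose_mul,
      transformedGen]
    simp only [Matrix.mul_assoc]

theorem quad_real_smul (c : ℝ) (H : ModeMatrix N) : quad (c • H) = (c : ℂ) • quad H := by
  simp only [quad, Finset.smul_sum, Matrix.smul_apply, smul_smul]
  rfl

/-- The derivative of an ordered product of exponentials of quadratic operators. -/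
theorem hasDerivAt_unitaryProd {m : ℕ} {G : Fin m → ModeMatrix N} (hG : ∀ j, IsQuadMatrix (G j))
    {F : ℝ → Fin m → ℝ} {F' : Fin m → ℝ} {t : ℝ} (hF : HasDerivAt F F' t) (ψ φ : rapid N)
    (hφ : unitaryProd (fun j => quadOp (G j)) (F t) ψ = φ) :
    HasDerivAt (fun s => unitaryProd (fun j => quadOp (G j)) (F s) ψ)
      ((-Complex.I • quad (∑ j, F' j • transformedGen G (F t) j) φ : rapid N) : Fock N) t := by
  induction m generalizing φ with
  | zero =>
    have e : ∀ s, unitaryProd (fun j => quadOp (G j)) (F s) = 1 := fun s => by simp [unitaryProd]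
    simp only [e]
    refine (hasDerivAt_const t _).congr_deriv ?_
    simp [quad]
  | succ m ih =>
    have hF0 : HasDerivAt (fun s => F s 0) (F' 0) t := hasDerivAt_pi.1 hF 0
    have hFs : HasDerivAt (fun s (j : Fin m) => F s j.succ) (fun j => F' j.succ) t :=
      hasDerivAt_pi.2 fun j => hasDerivAt_pi.1 hF j.succ
    obtain ⟨w, v, hw⟩ := exists_implementsWith_unitaryProd (G := fun j : Fin m => G j.succ)
      (fun j => hG j.succ) (fun j => F t j.succ)
    have h1 := ih (G := fun j => G j.succ) (fun j => hG j.succ) hFs (w ψ) (hw.coe ψ)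
    obtain ⟨W, hW⟩ := exists_isRapidGroup (hG 0)
    have hg := isUnitaryGroup_unitaryExp (hG 0)
    set X := ∑ j : Fin m, F' j.succ • transformedGen (fun j => G j.succ) (fun j => F t j.succ) j
      with hX
    have hφ' : φ = W (F t 0) (w ψ) := by
      refine Subtype.ext ?_
      rw [← hφ, unitaryProd_succ, mul_apply_eq_comp, hw.coe, hW.coe]
    have h2 : HasDerivAt (fun s => unitaryExp (quadOp (G 0)) (F s 0)
        (unitaryProd (fun j : Fin m => quadOp (G j.succ)) (fun j => F t j.succ) ψ))
        (F' 0 • ((-Complex.I • quad (G 0) φ : rapid N) : Fock N)) t := by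
      rw [hw.coe, hφ']
      simp only [hW.coe]
      exact (hW.deriv (w ψ) (F t 0)).hasDerivAt.scomp t hF0
    -- The first factor contributes its own generator. The derivative of the tail, given by
    -- induction, is then carried through the first factor, which conjugates its matrix.
    have h3 := hasDerivAt_strong_mul (fun s y => unitary_norm_map (hg.isUnitary (F s 0)) y) h1 h2
      (((hg.continuous _).continuousAt).comp (f := fun s => F s 0) hF0.continuousAt)
    have e : (fun s => unitaryProd (fun j => quadOp (G j)) (F s) ψ) = fun s =>
        unitaryExp (quadOp (G 0)) (F s 0)
          (unitaryProd (fun j : Fin m => quadOp (G j.succ)) (fun j => F s j.succ) ψ) := by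
      funext s; rw [unitaryProd_succ]; rfl
    rw [e]
    refine h3.congr_deriv ?_
    rw [hW.coe, sum_transformedGen_succ, ← hX]
    have e2 : W (F t 0) (-Complex.I • quad X (w ψ)) = -Complex.I •
        quad ((sympExp (G 0) (-F t 0))ᴴ * X * ((sympExp (G 0) (-F t 0))ᴴ)ᴴ) φ := by
      rw [map_smul, ← Module.End.mul_apply, hW.mul_quad (hG 0), Module.End.mul_apply, hφ']
    rw [e2, quad_add, quad_real_smul, LinearMap.add_apply, LinearMap.smul_apply, smul_add,
      smul_comm (-Complex.I) (F' 0 : ℂ)]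
    rfl

theorem unitaryProd_zero {m : ℕ} {G : Fin m → ModeMatrix N} (hG : ∀ j, IsQuadMatrix (G j)) :
    unitaryProd (fun j => quadOp (G j)) 0 = 1 := by
  unfold unitaryProd
  refine List.prod_eq_one fun x hx => ?_
  obtain ⟨j, rfl⟩ := List.mem_ofFn.1 hx
  exact (isUnitaryGroup_unitaryExp (hG j)).zero

/-- The ordered product of exponentials is the time-ordered exponential exactly if the transformed
generators combine to the Hamiltonian. -/
theorem timeOrderedExp_eq_unitaryProd_iff {m : ℕ} {G : Fin m → ModeMatrix N}
    (hG : ∀ j, IsQuadMatrix (G j)) {H : ℝ → ModeMatrix N} (hH : ∀ t, IsQuadMatrix (H t))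
    {U : ℝ → Fock N →L[ℂ] Fock N} (hU : IsTimeOrderedExp (fun t => quadOp (H t)) U) {I : Set ℝ}
    (hIo : IsOpen I) (hIc : I.OrdConnected) (h0 : (0 : ℝ) ∈ I) {F F' : ℝ → Fin m → ℝ}
    (hF0 : F 0 = 0) (hF : ∀ t ∈ I, HasDerivAt F (F' t) t) :
    (∀ t ∈ I, U t = unitaryProd (fun j => quadOp (G j)) (F t)) ↔
      ∀ t ∈ I, ∑ j, F' t j • transformedGen G (F t) j = H t := by
  choose w v hw using fun t => exists_implementsWith_unitaryProd hG (F t)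
  have hX : ∀ t, IsQuadMatrix (∑ j, F' t j • transformedGen G (F t) j) := fun t =>
    IsQuadMatrix.sum_smul (fun j => isQuadMatrix_transformedGen hG (F t) j) _
  have hd : ∀ t ∈ I, ∀ ψ : rapid N, HasDerivAt (fun s => (w s ψ : Fock N))
      ((-Complex.I • quad (∑ j, F' t j • transformedGen G (F t) j) (w t ψ) : rapid N) : Fock N)
      t := by
    intro t ht ψ
    have := hasDerivAt_unitaryProd hG (hF t ht) ψ (w t ψ) ((hw t).coe ψ)
    simpa only [(hw _).coe] using this
  constructor
  · intro h t ht
    refine quad_injective (hX t) (hH t) ?_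
    have h1 : ∀ ψ, quad (∑ j, F' t j • transformedGen G (F t) j) (w t ψ) = quad (H t) (w t ψ) := by
      intro ψ
      have h2 := timeOrderedExp_hasDerivAt hU ψ t
      have h3 : (⟨U t ψ, hU.rapid t ψ ψ.2⟩ : rapid N) = w t ψ :=
        Subtype.ext (by change U t ψ = _; rw [h t ht, (hw t).coe])
      rw [h3] at h2
      have h4 := (hd t ht ψ).congr_of_eventuallyEq (f₁ := fun s => U s ψ) (by
        filter_upwards [hIo.mem_nhds ht] with s hs
        rw [h s hs, (hw s).coe])
      have h5 := smul_right_injective _ (neg_ne_zero.2 Complex.I_ne_zero)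
        (Subtype.ext (h4.unique h2))
      exact h5
    -- The two quadratic operators agree on the range of `w t`, which is all of `rapid N` because `w
    -- t` has a right inverse.
    refine LinearMap.ext fun χ => ?_
    have h2 := h1 (v t χ)
    rwa [← Module.End.mul_apply (w t), (hw t).mul_inv] at h2
  · intro h t ht
    refine clm_ext_rapid fun ψ => ?_
    rw [(hw t).coe]
    refine timeOrderedExp_unique_on hIc h0 hH hU (y := fun s => w s ψ) ?_
      (fun s hs => ?_) ht
    · refine Subtype.ext ?_
      rw [← (hw 0).coe, hF0, unitaryProd_zero hG]; rfl
    · rw [← h s hs]; exact hd s hs ψ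

end OrderedProducts

/-! ### Existence and uniqueness for implicit equations with small data. -/

section ImplicitODE
open Set Filter Topology
variable {E : Type*} [NormedAddCommGroup E] [NormedSpace ℝ E]

/-- The line `r x / T` is a barrier below `r`: wherever the norm meets it, the curve is still in the
ball and moves more slowly than the slope `r / T`. -/
theorem norm_le_of_norm_deriv_lt_right {y y' : ℝ → E} {r T : ℝ} (hr : 0 < r) (hT : 0 < T)
    (h0 : y 0 = 0) (hy : ∀ t ∈ Ico 0 T, HasDerivAt y (y' t) t)
    (hb : ∀ t ∈ Ico 0 T, ‖y t‖ ≤ r → ‖y' t‖ < r / T) {t : ℝ} (ht : t ∈ Ico 0 T) : ‖y t‖ ≤ r := by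
  have hle : ∀ x, x < T → r / T * x ≤ r := fun x hx => by
    rw [div_mul_eq_mul_div, div_le_iff₀ hT]
    exact mul_le_mul_of_nonneg_left hx.le hr.le
  have h := image_norm_le_of_norm_deriv_right_lt_deriv_boundary (f := y) (f' := y') (a := 0) (b := t)
    (B := fun x => r / T * x) (B' := fun _ => r / T)
    (fun x hx => (hy x ⟨hx.1, hx.2.trans_lt ht.2⟩).continuousAt.continuousWithinAt)
    (fun x hx => (hy x ⟨hx.1, hx.2.trans ht.2⟩).hasDerivWithinAt)
    (by simp [h0]) (fun x => by simpa using (hasDerivAt_id x).const_mul (r / T))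
    (fun x hx he => hb x ⟨hx.1, hx.2.trans ht.2⟩ (he.trans_le (hle x (hx.2.trans ht.2))))
    ⟨ht.1, le_rfl⟩
  exact h.trans (hle t ht.2)

/-- A curve through the origin stays in a ball as long as its speed there is small. -/
theorem norm_le_of_norm_deriv_lt {y y' : ℝ → E} {r T : ℝ} (hr : 0 < r) (hT : 0 < T)
    (h0 : y 0 = 0) (hy : ∀ t ∈ Ioo (-T) T, HasDerivAt y (y' t) t)
    (hb : ∀ t ∈ Ioo (-T) T, ‖y t‖ ≤ r → ‖y' t‖ < r / T) {t : ℝ} (ht : t ∈ Ioo (-T) T) :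
    ‖y t‖ ≤ r := by
  rcases le_total 0 t with h | h
  · exact norm_le_of_norm_deriv_lt_right hr hT h0 (fun s hs => hy s ⟨by linarith [hs.1], hs.2⟩)
      (fun s hs => hb s ⟨by linarith [hs.1], hs.2⟩) ⟨h, ht.2⟩
  · have hneg : ∀ s ∈ Ico 0 T, -s ∈ Ioo (-T) T := fun s hs => ⟨by linarith [hs.2], by linarith [hs.1]⟩
    have := norm_le_of_norm_deriv_lt_right (y := fun s => y (-s)) (y' := fun s => -y' (-s)) hr hT
      (by simpa using h0)
      (fun s hs => by
        simpa [Function.comp_def] using (hy (-s) (hneg s hs)).scomp s (hasDerivAt_neg s))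
      (fun s hs => by simpa using hb (-s) (hneg s hs)) (t := -t) ⟨by linarith, by linarith [ht.1]⟩
    simpa using this

variable [CompleteSpace E]

/-- An implicit differential equation `L(y) ẏ = λ(t)` with `L(0)` invertible has exactly one solution
through the origin on `(-T, T)`, if `T ‖λ‖` is small. -/
theorem exists_unique_solution_implicit_ode (L : E → E →L[ℝ] E) (hL : ContDiffAt ℝ 1 L 0)
    (h0 : IsUnit (L 0)) : ∃ δ : ℝ, 0 < δ ∧ ∀ lam : ℝ → E, Continuous lam → ∀ T : ℝ, 0 < T →
      (∀ t ∈ Ioo (-T) T, ‖lam t‖ * T ≤ δ) → ∃ F F' : ℝ → E, F 0 = 0 ∧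
        (∀ t ∈ Ioo (-T) T, HasDerivAt F (F' t) t) ∧
        (∀ t ∈ Ioo (-T) T, L (F t) (F' t) = lam t) ∧
        ∀ y y' : ℝ → E, y 0 = 0 → (∀ t ∈ Ioo (-T) T, HasDerivAt y (y' t) t) →
          (∀ t ∈ Ioo (-T) T, L (y t) (y' t) = lam t) → EqOn y F (Ioo (-T) T) := by
  -- Near the origin the equation is `ẏ = g(y) λ(t)`, and `g` is locally Lipschitz because inversion
  -- is smooth on units.
  set g : E → E →L[ℝ] E := fun x => Ring.inverse (L x) with hgdef
  have hg : ContDiffAt ℝ 1 g 0 := by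
    obtain ⟨u, hu⟩ := h0
    have h1 := contDiffAt_ringInverse (n := 1) ℝ u
    rw [hu] at h1
    exact h1.comp 0 hL
  obtain ⟨K, s, hs, hK⟩ := hg.exists_lipschitzOnWith
  have hunit : ∀ᶠ x in 𝓝 (0 : E), IsUnit (L x) :=
    hL.continuousAt.eventually (Units.isOpen.mem_nhds h0)
  obtain ⟨r, hr, hball⟩ := Metric.nhds_basis_closedBall.mem_iff.1 (inter_mem hs hunit)
  have hKr : LipschitzOnWith K g (Metric.closedBall 0 r) := hK.mono fun x hx => (hball hx).1
  have hU : ∀ x ∈ Metric.closedBall (0 : E) r, IsUnit (L x) := fun x hx => (hball hx).2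
  set B : ℝ := ‖g 0‖ + K * r with hB
  have hB0 : 0 ≤ B := by positivity
  have hgB : ∀ x ∈ Metric.closedBall (0 : E) r, ‖g x‖ ≤ B := by
    intro x hx
    have h1 := hKr.dist_le_mul x hx 0 (Metric.mem_closedBall_self hr.le)
    rw [dist_eq_norm] at h1
    have h2 : (K : ℝ) * dist x 0 ≤ K * r := mul_le_mul_of_nonneg_left hx K.2
    have h3 : ‖g x‖ ≤ ‖g x - g 0‖ + ‖g 0‖ := by simpa using norm_add_le (g x - g 0) (g 0)
    linarith
  have hgL : ∀ x ∈ Metric.closedBall (0 : E) r, ∀ z, g x (L x z) = z := fun x hx z => by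
    rw [← mul_apply_eq_comp, hgdef]
    simp only
    rw [Ring.inverse_mul_cancel _ (hU x hx)]; rfl
  have hLg : ∀ x ∈ Metric.closedBall (0 : E) r, ∀ z, L x (g x z) = z := fun x hx z => by
    rw [← mul_apply_eq_comp, hgdef]
    simp only
    rw [Ring.mul_inverse_cancel _ (hU x hx)]; rfl
  -- With this `δ` the speed inside the ball is at most `r / (2T)`, strictly below the barrier slope
  -- `r / T`.
  refine ⟨r / (2 * (B + 1)), by positivity, fun lam hlam T hT hδ => ?_⟩
  -- The smallness is assumed on the open interval only; continuity of `lam` extends it to the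
  -- closed interval used by Picard-Lindelöf.
  have hlamB : ∀ t ∈ Icc (-T) T, ‖lam t‖ ≤ r / (2 * (B + 1)) / T := by
    have hcl : IsClosed {t | ‖lam t‖ ≤ r / (2 * (B + 1)) / T} :=
      isClosed_le hlam.norm continuous_const
    have h1 : Ioo (-T) T ⊆ {t | ‖lam t‖ ≤ r / (2 * (B + 1)) / T} := fun t ht =>
      (le_div_iff₀ hT).2 (hδ t ht)
    have h2 := hcl.closure_subset_iff.2 h1
    rwa [closure_Ioo (by linarith : -T ≠ T)] at h2
  have hv : ∀ t ∈ Icc (-T) T, ∀ x ∈ Metric.closedBall (0 : E) r, ‖g x (lam t)‖ ≤ r / (2 * T) := by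
    intro t ht x hx
    calc ‖g x (lam t)‖ ≤ ‖g x‖ * ‖lam t‖ := (g x).le_opNorm _
      _ ≤ (B + 1) * (r / (2 * (B + 1)) / T) :=
        mul_le_mul ((hgB x hx).trans (by linarith)) (hlamB t ht) (norm_nonneg _) (by positivity)
      _ = r / (2 * T) := by field_simp
  set Λ : ℝ := r / (2 * (B + 1)) / T with hΛ
  have hΛ0 : 0 ≤ Λ := by positivity
  have hlip : ∀ t ∈ Icc (-T) T, LipschitzOnWith (K * Λ.toNNReal) (fun x => g x (lam t))
      (Metric.closedBall 0 r) := by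
    intro t ht
    refine LipschitzOnWith.of_dist_le_mul fun x hx y hy => ?_
    rw [dist_eq_norm, ← _root_.sub_apply]
    calc ‖(g x - g y) (lam t)‖ ≤ ‖g x - g y‖ * ‖lam t‖ := (g x - g y).le_opNorm _
      _ ≤ (K * dist x y) * Λ := by
        refine mul_le_mul ?_ (hlamB t ht) (norm_nonneg _) (by positivity)
        rw [← dist_eq_norm]; exact hKr.dist_le_mul x hx y hy
      _ = _ := by
        rw [NNReal.coe_mul, Real.coe_toNNReal _ hΛ0]; ring
  have hT0 : (0 : ℝ) ∈ Icc (-T) T := ⟨by linarith, hT.le⟩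
  have hPL : IsPicardLindelof (fun t x => g x (lam t)) (tmin := -T) (tmax := T) ⟨0, hT0⟩ (0 : E)
      r.toNNReal 0 (r / (2 * T)).toNNReal (K * Λ.toNNReal) := by
    have hrr : ((r.toNNReal : NNReal) : ℝ) = r := Real.coe_toNNReal _ hr.le
    refine ⟨fun t ht => ?_, fun x hx => ?_, fun t ht x hx => ?_, ?_⟩
    · rw [hrr]; exact hlip t ht
    · exact ((g x).continuous.comp hlam).continuousOn
    · rw [hrr] at hx
      rw [Real.coe_toNNReal _ (by positivity)]; exact hv t ht x hx
    · rw [Real.coe_toNNReal _ (by positivity), hrr]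
      simp only [sub_zero, zero_sub, neg_neg, max_self, NNReal.coe_zero]
      rw [div_mul_eq_mul_div, div_le_iff₀ (by positivity)]
      nlinarith
  obtain ⟨F, hF0, hF⟩ := hPL.exists_eq_forall_mem_Icc_hasDerivWithinAt₀
  have hFd : ∀ t ∈ Ioo (-T) T, HasDerivAt F (g (F t) (lam t)) t := fun t ht =>
    (hF t ⟨ht.1.le, ht.2.le⟩).hasDerivAt (Icc_mem_nhds ht.1 ht.2)
  have hlt : r / (2 * T) < r / T := div_lt_div_of_pos_left hr hT (by linarith)
  have hFr : ∀ t ∈ Ioo (-T) T, F t ∈ Metric.closedBall (0 : E) r := fun t ht => by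
    rw [mem_closedBall_zero_iff]
    exact norm_le_of_norm_deriv_lt hr hT hF0 hFd (fun t ht hr => (hv t ⟨ht.1.le, ht.2.le⟩ _
      (mem_closedBall_zero_iff.2 hr)).trans_lt hlt) ht
  refine ⟨F, fun t => g (F t) (lam t), hF0, hFd, fun t ht => hLg _ (hFr t ht) _, ?_⟩
  intro y y' hy0 hyd hy
  have hy' : ∀ t ∈ Ioo (-T) T, y t ∈ Metric.closedBall (0 : E) r → y' t = g (y t) (lam t) :=
    fun t ht hr => by rw [← hy t ht, hgL _ hr]
  -- A competing solution cannot leave the ball either, so it obeys the explicit equation throughout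
  -- and Lipschitz uniqueness applies.
  have hyr : ∀ t ∈ Ioo (-T) T, y t ∈ Metric.closedBall (0 : E) r := fun t ht => by
    rw [mem_closedBall_zero_iff]
    refine norm_le_of_norm_deriv_lt hr hT hy0 hyd (fun t ht hr => ?_) ht
    rw [hy' t ht (mem_closedBall_zero_iff.2 hr)]
    exact (hv t ⟨ht.1.le, ht.2.le⟩ _ (mem_closedBall_zero_iff.2 hr)).trans_lt hlt
  refine ODE_solution_unique_of_mem_Ioo (v := fun t x => g x (lam t))
    (s := fun _ => Metric.closedBall 0 r) (K := K * Λ.toNNReal) (t₀ := 0)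
    (fun t ht => hlip t ⟨ht.1.le, ht.2.le⟩) ⟨by linarith, hT⟩ (fun t ht => ⟨?_, hyr t ht⟩)
    (fun t ht => ⟨hFd t ht, hFr t ht⟩) (by rw [hy0, hF0])
  rw [← hy' t ht (hyr t ht)]; exact hyd t ht

end ImplicitODE

/-! ### Coordinates in the generators and regularity of the coefficient matrix. -/

section GeneratorCoordinates
open Set Filter Topology
variable {N : ℕ}

theorem contDiff_sympExp_apply (H : ModeMatrix N) (m n : Fin N ⊕ Fin N) :
    ContDiff ℝ 1 (fun t => sympExp H t m n) := by
  rw [contDiff_one_iff_deriv]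
  have h := hasDerivAt_sympExp_apply H
  refine ⟨fun t => (h t m n).differentiableAt, ?_⟩
  have hc : ∀ m n, Continuous fun t => sympExp H t m n := fun m n =>
    continuous_iff_continuousAt.2 fun t => (h t m n).continuousAt
  rw [show deriv (fun t => sympExp H t m n) = _ from funext fun t => (h t m n).deriv]
  simp only [Matrix.mul_apply]
  fun_prop

theorem contDiff_leftProd_apply {m : ℕ} (G : Fin m → ModeMatrix N) (j : Fin m)
    (p q : Fin N ⊕ Fin N) : ContDiff ℝ 1 (fun f : Fin m → ℝ => leftProd G f j p q) := by
  induction m generalizing p q with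
  | zero => exact j.elim0
  | succ m ih =>
    refine Fin.cases ?_ (fun j => ?_) j
    · simp only [leftProd_zero]; exact contDiff_const
    · simp only [leftProd_succ, Matrix.mul_apply, conjTranspose_apply]
      refine ContDiff.sum fun k _ => ContDiff.mul ?_ ?_
      · refine (starL' ℝ (A := ℂ)).contDiff.comp ?_
        refine (contDiff_sympExp_apply (G 0) k p).comp ?_
        fun_prop
      · refine (ih (fun j => G j.succ) j k q).comp ?_
        fun_prop

theorem contDiff_transformedGen_apply {m : ℕ} (G : Fin m → ModeMatrix N) (j : Fin m)
    (p q : Fin N ⊕ Fin N) : ContDiff ℝ 1 (fun f : Fin m → ℝ => transformedGen G f j p q) := by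
  simp only [transformedGen, Matrix.mul_apply, conjTranspose_apply]
  refine ContDiff.sum fun k _ => ContDiff.mul (ContDiff.sum fun l _ => ?_) ?_
  · exact (contDiff_leftProd_apply G j p l).mul contDiff_const
  · exact (starL' ℝ (A := ℂ)).contDiff.comp (contDiff_leftProd_apply G j q k)

theorem transformedGen_zero {m : ℕ} (G : Fin m → ModeMatrix N) (j : Fin m) :
    transformedGen G 0 j = G j := by
  have h : leftProd G 0 j = 1 := by
    refine List.prod_eq_one fun x hx => ?_
    obtain ⟨i, rfl⟩ := List.mem_ofFn.1 (List.mem_of_mem_take hx)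
    simp [sympExp_zero]
  simp [transformedGen, h]

/-- The coordinate functionals are extended from quadratic matrices to all matrices, so that
regularity of coordinates follows from regularity of matrix entries. -/
theorem exists_coords {G : Fin (N * (2 * N + 1)) → ModeMatrix N} (hG : ∀ j, IsQuadMatrix (G j))
    (hli : LinearIndependent ℝ G) :
    ∃ g : Fin (N * (2 * N + 1)) → ModeMatrix N →ₗ[ℝ] ℝ,
      ∀ X, IsQuadMatrix X → X = ∑ i, g i X • G i := by
  obtain ⟨b, hb⟩ := exists_quadBasis hG hli
  choose g hg using fun i => LinearMap.exists_extend (b.coord i)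
  refine ⟨g, fun X hX => ?_⟩
  have h1 := congrArg (quadSubmodule N).subtype (b.sum_repr ⟨X, hX⟩)
  simp only [map_sum, map_smul, Submodule.subtype_apply, hb] at h1
  rw [← h1]
  refine Finset.sum_congr rfl fun i _ => ?_
  have h2 := LinearMap.congr_fun (hg i) ⟨X, hX⟩
  rw [h1]
  exact congrArg (· • G i) h2.symm

theorem sum_smul_injective {ι : Type*} [Fintype ι] {G : ι → ModeMatrix N}
    (hli : LinearIndependent ℝ G) {x y : ι → ℝ} (h : ∑ i, x i • G i = ∑ i, y i • G i) : x = y := by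
  have h1 : ∑ i, (x i - y i) • G i = 0 := by
    simp only [sub_smul, Finset.sum_sub_distrib, h, sub_self]
  funext i
  exact sub_eq_zero.1 (Fintype.linearIndependent_iff.1 hli _ h1 i)

/-- The matrix that expresses the transformed generators through the generators. -/
theorem exists_transformedGen_coeff {G : Fin (N * (2 * N + 1)) → ModeMatrix N}
    (hG : ∀ j, IsQuadMatrix (G j)) (hli : LinearIndependent ℝ G) :
    ∃ M : (Fin (N * (2 * N + 1)) → ℝ) →
        Matrix (Fin (N * (2 * N + 1))) (Fin (N * (2 * N + 1))) ℝ,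
      M 0 = 1 ∧ (∀ f j, transformedGen G f j = ∑ i, M f i j • G i) ∧
        ∀ i j, ContDiff ℝ 1 fun f => M f i j := by
  obtain ⟨g, hg⟩ := exists_coords hG hli
  refine ⟨fun f => Matrix.of fun i j => g i (transformedGen G f j), ?_, fun f j => ?_,
    fun i j => ?_⟩
  · ext i j
    have h1 : (fun i => g i (G j)) = fun i => if i = j then (1 : ℝ) else 0 :=
      sum_smul_injective hli (by rw [← hg _ (hG j)]; simp)
    simp only [of_apply, transformedGen_zero, Matrix.one_apply]
    exact congrFun h1 i
  · exact hg _ (isQuadMatrix_transformedGen hG f j)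
  · let φ : (Fin N ⊕ Fin N → Fin N ⊕ Fin N → ℂ) →ₗ[ℝ] ℝ := g i
    have h1 : ContDiff ℝ 1 φ := (LinearMap.toContinuousLinearMap φ).contDiff
    have h2 : ContDiff ℝ 1 (fun f p q => transformedGen G f j p q) :=
      contDiff_pi.2 fun p => contDiff_pi.2 fun q => contDiff_transformedGen_apply G j p q
    exact h1.comp h2

theorem sum_transformedGen_eq_iff {m : ℕ} {G : Fin m → ModeMatrix N}
    (hli : LinearIndependent ℝ G) {f : Fin m → ℝ} {M : Matrix (Fin m) (Fin m) ℝ}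
    (hM : ∀ j, transformedGen G f j = ∑ i, M i j • G i) (x l : Fin m → ℝ) :
    ∑ j, x j • transformedGen G f j = ∑ i, l i • G i ↔ ∀ i, ∑ j, M i j * x j = l i := by
  have h : ∑ j, x j • transformedGen G f j = ∑ i, (∑ j, M i j * x j) • G i := by
    simp only [hM, Finset.smul_sum, smul_smul, Finset.sum_smul]
    rw [Finset.sum_comm]
    simp only [mul_comm]
  rw [h]
  constructor
  · intro h1; exact congrFun (sum_smul_injective hli h1)
  · intro h1; simp only [h1]

theorem exists_unique_solution_matrix_ode {m : ℕ} (M : (Fin m → ℝ) → Matrix (Fin m) (Fin m) ℝ)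
    (h0 : M 0 = 1) (hM : ∀ i j, ContDiff ℝ 1 fun f => M f i j) :
    ∃ δ : ℝ, 0 < δ ∧ ∀ lam : ℝ → Fin m → ℝ, Continuous lam → ∀ T : ℝ, 0 < T →
      (∀ t ∈ Ioo (-T) T, ∀ j, |lam t j| * T ≤ δ) → ∃ F F' : ℝ → Fin m → ℝ, F 0 = 0 ∧
        (∀ t ∈ Ioo (-T) T, HasDerivAt F (F' t) t) ∧
        (∀ t ∈ Ioo (-T) T, ∀ i, ∑ j, M (F t) i j * F' t j = lam t i) ∧
        ∀ E E' : ℝ → Fin m → ℝ, E 0 = 0 → (∀ t ∈ Ioo (-T) T, HasDerivAt E (E' t) t) →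
          (∀ t ∈ Ioo (-T) T, ∀ i, ∑ j, M (E t) i j * E' t j = lam t i) →
          EqOn E F (Ioo (-T) T) := by
  let φ : (Fin m → Fin m → ℝ) →ₗ[ℝ] ((Fin m → ℝ) →L[ℝ] (Fin m → ℝ)) :=
    (LinearMap.toContinuousLinearMap.toLinearMap).comp (Matrix.toLin' (R := ℝ)).toLinearMap
  have hφ : ∀ (A : Matrix (Fin m) (Fin m) ℝ) x i, φ A x i = ∑ j, A i j * x j := fun A x i => rfl
  have hφ1 : φ (1 : Matrix (Fin m) (Fin m) ℝ) = 1 := by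
    ext x i; simp [hφ, Matrix.one_apply]
  have hL : ContDiff ℝ 1 (fun f => φ (M f)) :=
    (LinearMap.toContinuousLinearMap φ).contDiff.comp
      (contDiff_pi.2 fun i => contDiff_pi.2 fun j => hM i j)
  obtain ⟨δ, hδ, H⟩ := exists_unique_solution_implicit_ode (fun f => φ (M f)) hL.contDiffAt
    (by rw [h0, hφ1]; exact isUnit_one)
  refine ⟨δ, hδ, fun lam hlam T hT hb => ?_⟩
  obtain ⟨F, F', hF0, hF, he, hu⟩ := H lam hlam T hT fun t ht => by
    rw [← le_div_iff₀ hT, pi_norm_le_iff_of_nonneg (by positivity)]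
    intro j
    rw [le_div_iff₀ hT]; exact hb t ht j
  exact ⟨F, F', hF0, hF, fun t ht i => congrFun (he t ht) i,
    fun E E' hE0 hE hEe => hu E E' hE0 hE fun t ht => funext fun i => hEe t ht i⟩

end GeneratorCoordinates

/-! ### Local product form of the time-ordered exponential. -/

section LocalProduct
open Set Filter Topology
variable {N : ℕ}

theorem quadOp_sum_smul {ι : Type*} [Fintype ι] (G : ι → ModeMatrix N) (x : ι → ℝ) :
    quadOp (∑ j, x j • G j) = ∑ j, (x j : ℂ) • quadOp (G j) := by
  simp only [quadOp, Matrix.sum_apply, Matrix.smul_apply, Finset.sum_smul, Finset.smul_sum]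
  rw [eq_comm, Finset.sum_comm]
  refine Finset.sum_congr rfl fun m _ => ?_
  rw [Finset.sum_comm]
  refine Finset.sum_congr rfl fun n _ => Finset.sum_congr rfl fun j _ => ?_
  rw [smul_smul]; rfl

/-- For small times the time-ordered exponential is an ordered product of exponentials. -/
theorem exists_local_unitaryProd {G : Fin (N * (2 * N + 1)) → ModeMatrix N}
    (hG : ∀ j, IsQuadMatrix (G j)) (hli : LinearIndependent ℝ G)
    {lam : ℝ → Fin (N * (2 * N + 1)) → ℝ} (hlam : Continuous lam)
    {U : ℝ → Fock N →L[ℂ] Fock N}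
    (hU : IsTimeOrderedExp (fun t => quadOp (∑ j, lam t j • G j)) U) :
    ∃ T : ℝ, 0 < T ∧ ∃ F : ℝ → Fin (N * (2 * N + 1)) → ℝ, F 0 = 0 ∧
      (∀ t ∈ Ioo (-T) T, DifferentiableAt ℝ F t) ∧
      ∀ t ∈ Ioo (-T) T, U t = unitaryProd (fun j => quadOp (G j)) (F t) := by
  obtain ⟨M, hM0, hM, hMd⟩ := exists_transformedGen_coeff hG hli
  obtain ⟨δ, hδ, h⟩ := exists_unique_solution_matrix_ode M hM0 hMd
  obtain ⟨C, hC⟩ := isCompact_Icc.exists_bound_of_continuousOn (s := Icc (-1 : ℝ) 1)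
    hlam.continuousOn
  have hC0 : 0 ≤ C := (norm_nonneg _).trans (hC 0 (by simp))
  -- `C` bounds the coefficients on `[-1, 1]`; the minimum keeps time in that interval and makes
  -- `|λ| T ≤ δ`.
  have hT : 0 < min 1 (δ / (C + 1)) := by positivity
  obtain ⟨F, F', hF0, hF, he, -⟩ := h lam hlam _ hT fun t ht j => by
    have h1 : t ∈ Icc (-1 : ℝ) 1 :=
      ⟨by linarith [ht.1, min_le_left 1 (δ / (C + 1))], by linarith [ht.2, min_le_left 1 (δ / (C + 1))]⟩
    have h2 : |lam t j| ≤ C + 1 := ((norm_le_pi_norm (lam t) j).trans (hC t h1)).trans (by linarith)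
    calc |lam t j| * min 1 (δ / (C + 1)) ≤ (C + 1) * (δ / (C + 1)) :=
          mul_le_mul h2 (min_le_right _ _) hT.le (by positivity)
      _ = δ := by field_simp
  refine ⟨_, hT, F, hF0, fun t ht => (hF t ht).differentiableAt, ?_⟩
  rw [timeOrderedExp_eq_unitaryProd_iff hG (fun t => IsQuadMatrix.sum_smul hG (lam t)) hU isOpen_Ioo
    ordConnected_Ioo ⟨by linarith, hT⟩ hF0 hF]
  exact fun t ht => (sum_transformedGen_eq_iff hli (hM (F t)) (F' t) (lam t)).2 (he t ht)

end LocalProduct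

/-! ### Excitation numbers in the evolved vacuum. -/

section Vacuum
variable {N : ℕ}

variable (N) in
/-- The vacuum as a rapidly decreasing vector. -/
def rapidVacuum : rapid N := ⟨vacuum N, single_mem_rapid 0 1⟩

theorem mode_inl_rapidVacuum (k : Fin N) : mode (Sum.inl k) (rapidVacuum N) = 0 := by
  refine rapid_ext fun n => ?_
  rw [mode_inl_apply]
  have h : n + Pi.single k 1 ≠ 0 := fun h => by simpa using congrFun h k
  have : (vacuum N : Fock N) (n + Pi.single k 1) = 0 := by
    rw [vacuum, lp.single_apply_ne _ _ _ h]
  change _ * (vacuum N : Fock N) (n + Pi.single k 1) = 0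
  rw [this, mul_zero]

theorem inner_rapidVacuum : inner ℂ (rapidVacuum N) (rapidVacuum N) = 1 := by
  have h : ‖rapidVacuum N‖ = 1 := by
    change ‖vacuum N‖ = 1
    rw [vacuum, lp.norm_single (by norm_num)]; simp
  have h1 := inner_self_eq_norm_sq_to_K (𝕜 := ℂ) (rapidVacuum N)
  rw [h] at h1
  simpa using h1

theorem inner_mode_inr_rapidVacuum (j k : Fin N) :
    inner ℂ (mode (Sum.inr j) (rapidVacuum N)) (mode (Sum.inr k) (rapidVacuum N)) =
      if j = k then 1 else 0 := by
  rw [mode_adjoint]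
  change inner ℂ _ ((mode (Sum.inl j) * mode (Sum.inr k)) (rapidVacuum N)) = _
  rw [mode_annih_creat, LinearMap.add_apply, Module.End.mul_apply, mode_inl_rapidVacuum, map_zero,
    zero_add]
  split_ifs
  · exact inner_rapidVacuum
  · exact inner_zero_right (𝕜 := ℂ) _

/-- The mean number of excitations of a mode in a Gaussian state. -/
theorem ImplementsWith.hasExpectation {W : Fock N →L[ℂ] Fock N} {S : ModeMatrix N}
    {w v : Module.End ℂ (rapid N)} (h : ImplementsWith W S w v) (k : Fin N) {x : ℝ}
    (hx : ∑ j, star (S (Sum.inl k) (Sum.inr j)) * S (Sum.inl k) (Sum.inr j) = x) :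
    HasExpectation (creat k * annih k) (W (vacuum N)) x := by
  set Ω := rapidVacuum N
  have hW : W (vacuum N) = w Ω := h.coe Ω
  refine ⟨mode (Sum.inr k) (mode (Sum.inl k) (w Ω)), ?_, ?_⟩
  · rw [coe_mode, coe_mode, hW]; rfl
  · rw [hW]
    -- The vacuum is annihilated by all `a_j`, so only the creation coefficients of row `k` survive
    -- in `W† a_k W Ω`; its squared norm is the excitation number.
    set y := ∑ j, S (Sum.inl k) (Sum.inr j) • mode (Sum.inr j) Ω with hy
    have h1 : mode (Sum.inl k) (w Ω) = w y := by
      rw [← Module.End.mul_apply, h.mode_mul, Module.End.mul_apply, LinearMap.sum_apply,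
        Fintype.sum_sum_type]
      simp only [LinearMap.smul_apply]
      rw [Finset.sum_eq_zero fun j _ => by
        rw [show mode (Sum.inl j) Ω = 0 from mode_inl_rapidVacuum j, smul_zero], zero_add]
    have h2 := mode_adjoint (Sum.inl k) (w Ω) (mode (Sum.inl k) (w Ω))
    have h3 : inner ℂ (w y) (w y) = inner ℂ y y := by
      have e1 := inner_self_eq_norm_sq_to_K (𝕜 := ℂ) (w y)
      have e2 := inner_self_eq_norm_sq_to_K (𝕜 := ℂ) y
      have e3 : ‖w y‖ = ‖y‖ := by
        change ‖(w y : Fock N)‖ = ‖(y : Fock N)‖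
        rw [← h.coe]; exact unitary_norm_map h.isUnitary _
      rw [e3] at e1
      exact e1.trans e2.symm
    refine h2.symm.trans ?_
    rw [h1]
    refine h3.trans ?_
    rw [← hx]
    have h4 : inner ℂ y y = ∑ i, ∑ j, inner ℂ (S (Sum.inl k) (Sum.inr i) • mode (Sum.inr i) Ω)
        (S (Sum.inl k) (Sum.inr j) • mode (Sum.inr j) Ω) := by
      rw [hy]
      refine (sum_inner (𝕜 := ℂ) _ _ _).trans (Finset.sum_congr rfl fun i _ => ?_)
      exact inner_sum (𝕜 := ℂ) _ _ _
    rw [h4]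
    refine Finset.sum_congr rfl fun i _ => ?_
    simp only [rapid_inner_smul_left, rapid_inner_smul_right]
    rw [Finset.sum_eq_single i]
    · rw [inner_mode_inr_rapidVacuum]; simp [mul_comm]
    · intro j _ hj
      rw [inner_mode_inr_rapidVacuum, if_neg hj.symm]; simp
    · simp

end Vacuum

/-! ### Closed forms for squeezing and passive exponentials. -/

section ExponentialFormulas
variable {N : ℕ}

/-- By `Z³ = Z` the right side solves `A' = Z A` with `A(0) = 1`, hence `e^{-sZ} A(s)` is constant.
The squeezing generators used below satisfy this relation up to scale. -/
theorem exp_smul_of_mul_mul_self {𝔸 : Type*} [NormedRing 𝔸] [NormedAlgebra ℝ 𝔸] [CompleteSpace 𝔸]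
    {Z : 𝔸} (h : Z * Z * Z = Z) (s : ℝ) :
    NormedSpace.exp (s • Z) = 1 + Real.sinh s • Z + (Real.cosh s - 1) • (Z * Z) := by
  set A : ℝ → 𝔸 := fun s => 1 + Real.sinh s • Z + (Real.cosh s - 1) • (Z * Z) with hA
  have hA' : ∀ s, HasDerivAt A (Z * A s) s := by
    intro s
    have h1 := ((Real.hasDerivAt_sinh s).smul_const Z).const_add 1
    have h2 := ((Real.hasDerivAt_cosh s).sub_const 1).smul_const (Z * Z)
    refine (h1.add h2).congr_deriv ?_
    have e : Z * A s = Z + Real.sinh s • (Z * Z) + (Real.cosh s - 1) • Z := by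
      simp only [hA, mul_add, mul_one, mul_smul_comm, ← mul_assoc, h]
    rw [e]
    module
  have hE : ∀ s, HasDerivAt (fun s : ℝ => NormedSpace.exp (s • -Z)) (NormedSpace.exp (s • -Z) * -Z) s :=
    fun s => hasDerivAt_exp_smul_const (𝕂 := ℝ) (-Z) s
  have hP : ∀ s, HasDerivAt (fun s => NormedSpace.exp (s • -Z) * A s) 0 s := fun s => by
    refine ((hE s).mul (hA' s)).congr_deriv ?_
    simp only [mul_neg, neg_mul, mul_assoc]
    abel
  have hc := is_const_of_deriv_eq_zero (fun s => (hP s).differentiableAt) (fun s => (hP s).deriv) s 0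
  have h0 : A 0 = 1 := by simp [hA]
  simp only [zero_smul, NormedSpace.exp_zero, h0, mul_one] at hc
  let _ : NormedAlgebra ℚ 𝔸 := NormedAlgebra.restrictScalars ℚ ℝ 𝔸
  have h2 : NormedSpace.exp (s • Z) * NormedSpace.exp (s • -Z) = 1 := by
    rw [← NormedSpace.exp_add_of_commute, smul_neg, add_neg_cancel, NormedSpace.exp_zero]
    exact ((Commute.refl Z).neg_right.smul_right s).smul_left s
  calc NormedSpace.exp (s • Z) = NormedSpace.exp (s • Z) * (NormedSpace.exp (s • -Z) * A s) := by
        rw [hc, mul_one]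
    _ = A s := by rw [← mul_assoc, h2, one_mul]

section
attribute [local instance] Matrix.linftyOpNormedRing Matrix.linftyOpNormedAlgebra

theorem sympExp_of_mul_mul_self {G Z : ModeMatrix N} {θ : ℝ}
    (hG : -(2 * Complex.I) • (symK N * G) = θ • Z) (hZ : Z * Z * Z = Z) (f : ℝ) :
    sympExp G f = 1 + Real.sinh (θ * f) • Z + (Real.cosh (θ * f) - 1) • (Z * Z) := by
  rw [← exp_smul_of_mul_mul_self hZ, sympExp, mul_comm θ, mul_smul, ← hG]
  congr 1
  ext m n
  simp only [Matrix.smul_apply, smul_eq_mul, Complex.real_smul]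
  ring

end

/-- When `G` commutes with `K`, the product `KG` is Hermitian and the exponential is unitary:
passive transformations preserve the Euclidean norm of rows. -/
theorem sympExp_mul_conjTranspose_of_commute {G : ModeMatrix N} (hG : Gᴴ = G)
    (hc : symK N * G = G * symK N) (f : ℝ) : sympExp G f * (sympExp G f)ᴴ = 1 := by
  have h : (sympExp G f)ᴴ = sympExp G (-f) := by
    unfold sympExp
    rw [← exp_conjTranspose, conjTranspose_smul, conjTranspose_mul, hG, symK_conjTranspose, ← hc]
    congr 2
    simp
  rw [h, sympExp_mul_neg]

theorem sympProd_symplectic {m : ℕ} {G : Fin m → ModeMatrix N} (hG : ∀ j, IsQuadMatrix (G j))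
    (f : Fin m → ℝ) : sympProd G f * symK N * (sympProd G f)ᴴ = symK N := by
  induction m with
  | zero => simp [sympProd]
  | succ m ih =>
    rw [sympProd_succ, conjTranspose_mul]
    calc _ = sympExp (G 0) (f 0) * (sympProd (fun j => G j.succ) (fun j => f j.succ) * symK N *
          (sympProd (fun j => G j.succ) (fun j => f j.succ))ᴴ) * (sympExp (G 0) (f 0))ᴴ := by
          simp only [Matrix.mul_assoc]
      _ = _ := by rw [ih fun j => hG j.succ, sympExp_symplectic (hG 0)]

end ExponentialFormulas

/-! ### The ten generators of detector and field mode. -/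

section DetectorGenerators

/-- The generators are defined as operators on all sequences, so the commutation of modes is needed
there and not only on `rapid N`. -/
theorem annih_mul_annih_comm {N : ℕ} (k l : Fin N) :
    (annih k * annih l : SeqOp N) = annih l * annih k := by
  refine LinearMap.ext fun x => funext fun n => ?_
  simp only [Module.End.mul_apply, annih, LinearMap.coe_mk, AddHom.coe_mk]
  by_cases h : k = l
  · subst h; rfl
  · rw [add_right_comm]
    simp [h, Ne.symm h]
    ring

theorem creat_mul_creat_comm {N : ℕ} (k l : Fin N) :
    (creat k * creat l : SeqOp N) = creat l * creat k := by
  refine LinearMap.ext fun x => funext fun n => ?_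
  simp only [Module.End.mul_apply, creat, LinearMap.coe_mk, AddHom.coe_mk]
  by_cases h : k = l
  · subst h; rfl
  · rw [tsub_right_comm]
    simp [h, Ne.symm h]
    ring

theorem annih_mul_creat_comm {N : ℕ} {k l : Fin N} (h : k ≠ l) :
    (annih k * creat l : SeqOp N) = creat l * annih k := by
  refine LinearMap.ext fun x => funext fun n => ?_
  simp only [Module.End.mul_apply, annih, creat, LinearMap.coe_mk, AddHom.coe_mk]
  by_cases hl : n l = 0
  · simp [hl, h.symm]
  · have e : n + Pi.single k 1 - Pi.single l 1 = n - Pi.single l 1 + Pi.single k 1 := by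
      rw [tsub_add_eq_add_tsub]
      intro i
      by_cases hi : i = l
      · subst hi; simp; omega
      · simp [hi]
    rw [e]
    simp [h, h.symm]
    ring

/-- The quadratic matrix with blocks `A` and `B`. -/
def quadMat {N : ℕ} (A B : Matrix (Fin N) (Fin N) ℂ) : ModeMatrix N :=
  fromBlocks A B (B.map star) (A.map star)

/-- The matrices of the quadratic generators `detGen c`. -/
def detMat (c : ℝ) : Fin 10 → ModeMatrix 2
  | 0 => quadMat 0 !![0, 1 / 2; 1 / 2, 0]
  | 1 => quadMat 0 !![0, Complex.I / 2; Complex.I / 2, 0]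
  | 2 => quadMat 0 !![(c : ℂ), 0; 0, 0]
  | 3 => quadMat 0 !![-Complex.I * c, 0; 0, 0]
  | 4 => quadMat 0 !![0, 0; 0, (c : ℂ)]
  | 5 => quadMat 0 !![0, 0; 0, -Complex.I * c]
  | 6 => quadMat !![0, 1 / 2; 1 / 2, 0] 0
  | 7 => quadMat !![0, Complex.I / 2; -Complex.I / 2, 0] 0
  | 8 => quadMat !![1, 0; 0, 0] 0
  | 9 => quadMat !![0, 0; 0, 1] 0

theorem isQuadMatrix_detMat (c : ℝ) (j : Fin 10) : IsQuadMatrix (detMat c j) := by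
  fin_cases j <;> refine ⟨_, _, ?_, ?_, rfl⟩ <;> ext i k <;> fin_cases i <;> fin_cases k <;> simp

-- A product of operators of different modes occurs twice in the double sum, which is why the
-- two-mode entries of `detMat` carry `1 / 2` while the single-mode entries do not.
set_option maxHeartbeats 1000000 in
theorem quadOp_detMat (c : ℝ) (j : Fin 10) : quadOp (detMat c j) = detGen c j := by
  have h1 := annih_mul_annih_comm (1 : Fin 2) 0
  have h2 := creat_mul_creat_comm (1 : Fin 2) 0
  have h3 := annih_mul_creat_comm (k := (1 : Fin 2)) (l := 0) (by decide)
  have h4 := annih_mul_creat_comm (k := (0 : Fin 2)) (l := 1) (by decide)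
  simp only [quadOp, Fintype.sum_sum_type, Fin.sum_univ_two, modeOp, modeOpAdj, Sum.elim_inl,
    Sum.elim_inr, h1, h2, h3, h4]
  fin_cases j <;>
    simp [detMat, quadMat, detGen, detD, detDdag, fldD, fldDdag, h4, pow_two,
      Complex.conj_ofNat] <;> module

theorem linearIndependent_detMat {c : ℝ} (hc : c ≠ 0) : LinearIndependent ℝ (detMat c) := by
  rw [Fintype.linearIndependent_iff]
  intro g hg
  have e := fun m n => congrFun (congrFun hg m) n
  have e1 := e (Sum.inl 0) (Sum.inr 1)
  have e2 := e (Sum.inl 0) (Sum.inr 0)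
  have e3 := e (Sum.inl 1) (Sum.inr 1)
  have e4 := e (Sum.inl 0) (Sum.inl 1)
  have e5 := e (Sum.inl 0) (Sum.inl 0)
  have e6 := e (Sum.inl 1) (Sum.inl 1)
  clear e hg
  simp [Fin.sum_univ_succ, detMat, quadMat, Complex.ext_iff, hc] at e1 e2 e3 e4 e5 e6
  intro j
  fin_cases j
  all_goals tauto

theorem detHam_eq (Δ : ℝ) (h : ℝ → ℂ) (c τ : ℝ) :
    detHam Δ h τ = ∑ j, (detCoeff Δ h τ j : ℂ) • detGen c j := by
  have he : Complex.exp (Complex.I * τ * Δ) = star (Complex.exp (-(Complex.I * τ * Δ))) := by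
    rw [Complex.star_def, ← Complex.exp_conj]; simp
  simp only [Fin.sum_univ_succ, detCoeff, detGen, detHam, he]
  generalize Complex.exp (-(Complex.I * τ * Δ)) = z
  generalize h τ = y
  simp only [add_mul, mul_add, smul_mul_smul_comm]
  simp
  match_scalars <;> apply Complex.ext <;> simp <;> ring

end DetectorGenerators

/-! ### The detector row of the symplectic matrix. -/

section DetectorExcitations

/-- The row vector of the mode coefficients `(a₁, a₂ | b₁, b₂)`. -/
def modeRow (a₁ a₂ b₁ b₂ : ℂ) : Fin 2 ⊕ Fin 2 → ℂ := Sum.elim ![a₁, a₂] ![b₁, b₂]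

theorem modeRow_dotProduct_star (a₁ a₂ b₁ b₂ : ℂ) :
    modeRow a₁ a₂ b₁ b₂ ⬝ᵥ star (modeRow a₁ a₂ b₁ b₂) =
      a₁ * star a₁ + a₂ * star a₂ + b₁ * star b₁ + b₂ * star b₂ := by
  simp [modeRow, dotProduct, Fintype.sum_sum_type, Fin.sum_univ_two, add_assoc]

/-- Only the detector row is needed, so each squeezing factor is computed as a map of row vectors.
Here `-2iKG = 2c Z` with `Z³ = Z`. -/
theorem vecMul_sympExp_detMat_two (c f : ℝ) (a b : ℂ) :
    modeRow a 0 b 0 ᵥ* sympExp (detMat c 2) f =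
      modeRow (Real.cosh (2 * c * f) * a + Complex.I * Real.sinh (2 * c * f) * b) 0
        (Real.cosh (2 * c * f) * b - Complex.I * Real.sinh (2 * c * f) * a) 0 := by
  rw [sympExp_of_mul_mul_self (θ := 2 * c) (Z := fromBlocks 0 !![-Complex.I, 0; 0, 0] !![Complex.I, 0; 0, 0] 0)]
  · ext (i | i) <;> fin_cases i <;>
      simp [modeRow, fromBlocks_multiply, vecMul, dotProduct, Fintype.sum_sum_type,
        Fin.sum_univ_two, one_apply] <;> ring
  · ext (i | i) (j | j) <;> fin_cases i <;> fin_cases j <;>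
      simp [detMat, quadMat, symK, fromBlocks_multiply] <;> ring_nf
  · ext (i | i) (j | j) <;> fin_cases i <;> fin_cases j <;> simp [fromBlocks_multiply]

theorem vecMul_sympExp_detMat_three (c f : ℝ) (a b : ℂ) :
    modeRow a 0 b 0 ᵥ* sympExp (detMat c 3) f =
      modeRow (Real.cosh (2 * c * f) * a - Real.sinh (2 * c * f) * b) 0
        (Real.cosh (2 * c * f) * b - Real.sinh (2 * c * f) * a) 0 := by
  rw [sympExp_of_mul_mul_self (θ := 2 * c) (Z := fromBlocks 0 !![-1, 0; 0, 0] !![-1, 0; 0, 0] 0)]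
  · ext (i | i) <;> fin_cases i <;>
      simp [modeRow, fromBlocks_multiply, vecMul, dotProduct, Fintype.sum_sum_type,
        Fin.sum_univ_two, one_apply] <;> ring
  · ext (i | i) (j | j) <;> fin_cases i <;> fin_cases j <;>
      simp [detMat, quadMat, symK, fromBlocks_multiply] <;> ring_nf <;> simp
  · ext (i | i) (j | j) <;> fin_cases i <;> fin_cases j <;> simp [fromBlocks_multiply]

/-- In the chosen order the row has no field entries when it meets the field squeezers; therefore
`F_5` and `F_6` do not enter the excitation number. -/
theorem vecMul_sympExp_detMat_four (c f : ℝ) (a b : ℂ) :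
    modeRow a 0 b 0 ᵥ* sympExp (detMat c 4) f =
      modeRow a 0 b 0 := by
  rw [sympExp_of_mul_mul_self (θ := 2 * c) (Z := fromBlocks 0 !![0, 0; 0, -Complex.I] !![0, 0; 0, Complex.I] 0)]
  · ext (i | i) <;> fin_cases i <;>
      simp [modeRow, fromBlocks_multiply, vecMul, dotProduct, Fintype.sum_sum_type,
        Fin.sum_univ_two, one_apply]
  · ext (i | i) (j | j) <;> fin_cases i <;> fin_cases j <;>
      simp [detMat, quadMat, symK, fromBlocks_multiply] <;> ring_nf
  · ext (i | i) (j | j) <;> fin_cases i <;> fin_cases j <;> simp [fromBlocks_multiply]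

theorem vecMul_sympExp_detMat_five (c f : ℝ) (a b : ℂ) :
    modeRow a 0 b 0 ᵥ* sympExp (detMat c 5) f =
      modeRow a 0 b 0 := by
  rw [sympExp_of_mul_mul_self (θ := 2 * c) (Z := fromBlocks 0 !![0, 0; 0, -1] !![0, 0; 0, -1] 0)]
  · ext (i | i) <;> fin_cases i <;>
      simp [modeRow, fromBlocks_multiply, vecMul, dotProduct, Fintype.sum_sum_type,
        Fin.sum_univ_two, one_apply]
  · ext (i | i) (j | j) <;> fin_cases i <;> fin_cases j <;>
      simp [detMat, quadMat, symK, fromBlocks_multiply] <;> ring_nf <;> simp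
  · ext (i | i) (j | j) <;> fin_cases i <;> fin_cases j <;> simp [fromBlocks_multiply]

theorem vecMul_sympExp_detMat_zero (c f : ℝ) (a b : ℂ) :
    modeRow a 0 b 0 ᵥ* sympExp (detMat c 0) f =
      modeRow (Real.cosh f * a) (Complex.I * Real.sinh f * b) (Real.cosh f * b)
        (-(Complex.I * Real.sinh f * a)) := by
  rw [sympExp_of_mul_mul_self (θ := 1) (Z := fromBlocks 0 !![0, -Complex.I; -Complex.I, 0] !![0, Complex.I; Complex.I, 0] 0)]
  · ext (i | i) <;> fin_cases i <;>
      simp [modeRow, fromBlocks_multiply, vecMul, dotProduct, Fintype.sum_sum_type,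
        Fin.sum_univ_two, one_apply] <;> ring
  · ext (i | i) (j | j) <;> fin_cases i <;> fin_cases j <;>
      simp [detMat, quadMat, symK, fromBlocks_multiply, Complex.conj_ofNat] <;> ring_nf
  · ext (i | i) (j | j) <;> fin_cases i <;> fin_cases j <;> simp [fromBlocks_multiply]

theorem vecMul_sympExp_detMat_one (c f : ℝ) (a₁ a₂ b₁ b₂ : ℂ) :
    modeRow a₁ a₂ b₁ b₂ ᵥ* sympExp (detMat c 1) f =
      modeRow (Real.cosh f * a₁ + Real.sinh f * b₂) (Real.cosh f * a₂ + Real.sinh f * b₁)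
        (Real.cosh f * b₁ + Real.sinh f * a₂) (Real.cosh f * b₂ + Real.sinh f * a₁) := by
  rw [sympExp_of_mul_mul_self (θ := 1) (Z := fromBlocks 0 !![0, 1; 1, 0] !![0, 1; 1, 0] 0)]
  · ext (i | i) <;> fin_cases i <;>
      simp [modeRow, fromBlocks_multiply, vecMul, dotProduct, Fintype.sum_sum_type,
        Fin.sum_univ_two, one_apply] <;> ring
  · ext (i | i) (j | j) <;> fin_cases i <;> fin_cases j <;>
      simp [detMat, quadMat, symK, fromBlocks_multiply, Complex.conj_ofNat] <;> ring_nf <;> simp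
  · ext (i | i) (j | j) <;> fin_cases i <;> fin_cases j <;> simp [fromBlocks_multiply]

theorem vecMul_dotProduct_star_of_commute {N : ℕ} {G : ModeMatrix N} (hG : Gᴴ = G)
    (hc : symK N * G = G * symK N) (f : ℝ) (r : Fin N ⊕ Fin N → ℂ) :
    (r ᵥ* sympExp G f) ⬝ᵥ star (r ᵥ* sympExp G f) = r ⬝ᵥ star r := by
  rw [star_vecMul, dotProduct_mulVec, vecMul_vecMul, sympExp_mul_conjTranspose_of_commute hG hc,
    vecMul_one]

theorem quadMat_zero_commute {N : ℕ} (A : Matrix (Fin N) (Fin N) ℂ) :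
    symK N * quadMat A 0 = quadMat A 0 * symK N := by
  simp [symK, quadMat, fromBlocks_multiply]

theorem vecMul_detMat_passive (c f : ℝ) {j : Fin 10} (hj : 6 ≤ j) (r : Fin 2 ⊕ Fin 2 → ℂ) :
    (r ᵥ* sympExp (detMat c j) f) ⬝ᵥ star (r ᵥ* sympExp (detMat c j) f) = r ⬝ᵥ star r := by
  refine vecMul_dotProduct_star_of_commute (isQuadMatrix_detMat c j).isHermitian ?_ f r
  fin_cases j <;> first | exact absurd hj (by decide) | exact quadMat_zero_commute _

theorem sum_normSq_detector_row (c : ℝ) (f : Fin 10 → ℝ) :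
    let r := (sympProd (detMat c ∘ detOrder) (f ∘ detOrder)) (Sum.inl 0)
    r ⬝ᵥ star r = ((Real.cosh (2 * f 0) * Real.cosh (2 * f 1) * Real.cosh (4 * c * f 2) *
      Real.cosh (4 * c * f 3) : ℝ) : ℂ) := by
  intro r
  have hr : r = modeRow 1 0 0 0 ᵥ* sympProd (detMat c ∘ detOrder) (f ∘ detOrder) := by
    have h : modeRow 1 0 0 0 = Pi.single (Sum.inl 0) 1 := by
      ext (i | i) <;> fin_cases i <;> simp [modeRow]
    rw [h, single_one_vecMul]; rfl
  have hp : sympProd (detMat c ∘ detOrder) (f ∘ detOrder) =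
      sympExp (detMat c 2) (f 2) * (sympExp (detMat c 3) (f 3) * (sympExp (detMat c 4) (f 4) *
      (sympExp (detMat c 5) (f 5) * (sympExp (detMat c 0) (f 0) * (sympExp (detMat c 1) (f 1) *
      (sympExp (detMat c 6) (f 6) * (sympExp (detMat c 7) (f 7) * (sympExp (detMat c 8) (f 8) *
      sympExp (detMat c 9) (f 9))))))))) := by
    simp [sympProd, List.ofFn_succ, detOrder]
  rw [hr, hp]
  simp only [← vecMul_vecMul]
  -- The passive factors stand last, so they act on the finished row and preserve its norm.
  rw [vecMul_detMat_passive c _ (by decide), vecMul_detMat_passive c _ (by decide),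
    vecMul_detMat_passive c _ (by decide), vecMul_detMat_passive c _ (by decide),
    vecMul_sympExp_detMat_two, vecMul_sympExp_detMat_three, vecMul_sympExp_detMat_four,
    vecMul_sympExp_detMat_five, vecMul_sympExp_detMat_zero, vecMul_sympExp_detMat_one,
    modeRow_dotProduct_star]
  rw [show 4 * c * f 2 = 2 * (2 * c * f 2) by ring, show 4 * c * f 3 = 2 * (2 * c * f 3) by ring]
  -- Starting from `(1, 0 | 0, 0)`, consecutive squeezings differ in phase by `i`, so the cross
  -- terms cancel and each one multiplies the squared norm by `cosh² + sinh²`, the cosine of the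
  -- doubled argument.
  simp only [Real.cosh_two_mul]
  generalize Real.cosh (f 0) = x₀, Real.sinh (f 0) = y₀, Real.cosh (f 1) = x₁,
    Real.sinh (f 1) = y₁, Real.cosh (2 * c * f 2) = x₂, Real.sinh (2 * c * f 2) = y₂,
    Real.cosh (2 * c * f 3) = x₃, Real.sinh (2 * c * f 3) = y₃
  apply Complex.ext
  · simp [pow_two]
    ring
  · simp [pow_two]
    ring

/-- The mean number of detector excitations from the symplectic matrix. -/
theorem sum_star_mul_detector (c : ℝ) (f : Fin 10 → ℝ) :
    let S := sympProd (detMat c ∘ detOrder) (f ∘ detOrder)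
    ∑ j, star (S (Sum.inl 0) (Sum.inr j)) * S (Sum.inl 0) (Sum.inr j) =
      (((Real.cosh (2 * f 0) * Real.cosh (2 * f 1) * Real.cosh (4 * c * f 2) *
        Real.cosh (4 * c * f 3) - 1) / 2 : ℝ) : ℂ) := by
  intro S
  have h1 := sum_normSq_detector_row c f
  have h2 := congrFun (congrFun (sympProd_symplectic (G := detMat c ∘ detOrder)
    (fun j => isQuadMatrix_detMat c _) (f ∘ detOrder)) (Sum.inl 0)) (Sum.inl 0)
  change (S * symK 2 * Sᴴ) _ _ = _ at h2
  change S (Sum.inl 0) ⬝ᵥ star (S (Sum.inl 0)) = _ at h1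
  simp only [dotProduct, Fintype.sum_sum_type, Fin.sum_univ_two, Pi.star_apply] at h1
  simp [Matrix.mul_apply, Fintype.sum_sum_type, Fin.sum_univ_two, symK, one_apply] at h2
  rw [Fin.sum_univ_two]
  simp only [Complex.star_def] at h1 ⊢
  push_cast at h1 ⊢
  -- Half the difference of `∑|α|² + ∑|β|²`, the product of cosines, and `∑|α|² - ∑|β|² = 1`.
  linear_combination (1 / 2) * h1 - (1 / 2) * h2

end DetectorExcitations

/-! ### Application to the detector Hamiltonian and conclusion. -/

section MainTheorem
open Set Filter Topology

theorem detOrder_bijective : Function.Bijective detOrder := by decide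

theorem continuous_detCoeff (Δ : ℝ) {h : ℝ → ℂ} (hh : Continuous h) : Continuous (detCoeff Δ h) := by
  have h1 : Continuous fun τ : ℝ => Complex.exp (-(Complex.I * τ * Δ)) * h τ := by fun_prop
  have h2 : Continuous fun τ : ℝ => Complex.exp (-(Complex.I * τ * Δ)) * star (h τ) := by fun_prop
  refine continuous_pi fun j => ?_
  fin_cases j
  · exact Complex.continuous_re.comp h1
  · exact (Complex.continuous_im.comp h1).neg
  · exact continuous_const
  · exact continuous_const
  · exact continuous_const
  · exact continuous_const
  · exact Complex.continuous_re.comp h2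
  · exact (Complex.continuous_im.comp h2).neg
  · exact continuous_const
  · exact continuous_const

theorem detHam_eq_quadOp (Δ : ℝ) (h : ℝ → ℂ) (c τ : ℝ) :
    detHam Δ h τ = quadOp (∑ j, detCoeff Δ h τ j • detMat c j) := by
  rw [quadOp_sum_smul, detHam_eq Δ h c]
  simp only [quadOp_detMat]

theorem detHam_unitaryProd {c : ℝ} (hc : c ≠ 0) (Δ : ℝ) {h : ℝ → ℂ} (hh : Continuous h)
    {U : ℝ → Fock 2 →L[ℂ] Fock 2} (hU : IsTimeOrderedExp (detHam Δ h) U) :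
    ∃ T : ℝ, 0 < T ∧ ∃ F : ℝ → Fin 10 → ℝ, F 0 = 0 ∧
      (∀ τ ∈ Ioo (-T) T, DifferentiableAt ℝ F τ) ∧
      ∀ τ ∈ Ioo (-T) T, U τ = unitaryProd (detGen c ∘ detOrder) (F τ ∘ detOrder) := by
  let e : Fin 10 ≃ Fin 10 := Equiv.ofBijective detOrder detOrder_bijective
  have hU' : IsTimeOrderedExp
      (fun τ => quadOp (∑ j, detCoeff Δ h τ (detOrder j) • detMat c (detOrder j))) U := by
    have e1 : (fun τ => quadOp (∑ j, detCoeff Δ h τ (detOrder j) • detMat c (detOrder j))) =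
        detHam Δ h := funext fun τ => by
      rw [detHam_eq_quadOp Δ h c]
      exact congrArg quadOp (e.sum_comp fun j => detCoeff Δ h τ j • detMat c j)
    rwa [e1]
  obtain ⟨T, hT, F, hF0, hF, hFU⟩ := exists_local_unitaryProd (N := 2)
    (G := fun j => detMat c (detOrder j)) (lam := fun τ j => detCoeff Δ h τ (detOrder j))
    (fun j => isQuadMatrix_detMat c _)
    ((linearIndependent_detMat hc).comp _ detOrder_bijective.1)
    (continuous_pi fun j => (continuous_apply (detOrder j)).comp (continuous_detCoeff Δ hh)) hU'
  -- The solution was found with factors labelled by position; the inverse permutation restores the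
  -- labels of the generators.
  refine ⟨T, hT, fun τ k => F τ (e.symm k), ?_, fun τ hτ => ?_, fun τ hτ => ?_⟩
  · simp only [hF0]; rfl
  · exact differentiableAt_pi.2 fun k => differentiableAt_pi.1 (hF τ hτ) (e.symm k)
  · rw [hFU τ hτ]
    simp only [quadOp_detMat]
    congr 1
    funext j
    exact congrArg (F τ) (e.symm_apply_apply j).symm

theorem hasExpectation_detector (c : ℝ) (f : Fin 10 → ℝ) :
    HasExpectation (detDdag * detD)
      (unitaryProd (detGen c ∘ detOrder) (f ∘ detOrder) (vacuum 2))
      ((Real.cosh (2 * f 0) * Real.cosh (2 * f 1) * Real.cosh (4 * c * f 2) *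
        Real.cosh (4 * c * f 3) - 1) / 2) := by
  obtain ⟨w, v, h⟩ := exists_implementsWith_unitaryProd (G := detMat c ∘ detOrder)
    (fun j => isQuadMatrix_detMat c _) (f ∘ detOrder)
  have h1 := h.hasExpectation 0 (sum_star_mul_detector c f)
  have e : (fun j => quadOp ((detMat c ∘ detOrder) j)) = detGen c ∘ detOrder :=
    funext fun j => quadOp_detMat c _
  rw [e] at h1
  exact h1

end MainTheorem

end

theorem mainTheorem7 :
    -- a single quadratic Hamiltonian
    (∀ (N : ℕ) (H : ModeMatrix N), IsQuadMatrix H →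
      (∃! V : ℝ → Fock N →L[ℂ] Fock N, IsUnitaryGroup (quadOp H) V) ∧
      ∀ t : ℝ, IsComplexSymplectic (sympExp H t) ∧
        ActsOnModesAs (unitaryExp (quadOp H) t) (sympExp H t)) ∧
    -- time-dependent quadratic Hamiltonians
    (∀ (N : ℕ) (G : Fin (N * (2 * N + 1)) → ModeMatrix N),
      (∀ j, IsQuadMatrix (G j)) → LinearIndependent ℝ G →
      (∀ X : ModeMatrix N, IsQuadMatrix X →
        ∃! x : Fin (N * (2 * N + 1)) → ℝ, X = ∑ j, x j • G j) ∧
      (∀ lam : ℝ → Fin (N * (2 * N + 1)) → ℝ, Continuous lam →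
        ∃! U : ℝ → Fock N →L[ℂ] Fock N,
          IsTimeOrderedExp (fun t => quadOp (∑ j, lam t j • G j)) U) ∧
      ∃ M : (Fin (N * (2 * N + 1)) → ℝ) →
          Matrix (Fin (N * (2 * N + 1))) (Fin (N * (2 * N + 1))) ℝ,
        M 0 = 1 ∧
        (∀ f j, transformedGen G f j = ∑ i, M f i j • G i) ∧
        (∀ lam : ℝ → Fin (N * (2 * N + 1)) → ℝ, Continuous lam →
          ∀ U : ℝ → Fock N →L[ℂ] Fock N,
          IsTimeOrderedExp (fun t => quadOp (∑ j, lam t j • G j)) U →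
          ∀ I : Set ℝ, IsOpen I → I.OrdConnected → (0 : ℝ) ∈ I →
          ∀ F F' : ℝ → Fin (N * (2 * N + 1)) → ℝ, F 0 = 0 →
          (∀ t ∈ I, HasDerivAt F (F' t) t) →
          ((∀ t ∈ I, U t = unitaryProd (fun j => quadOp (G j)) (F t)) ↔
            ∀ t ∈ I, ∀ i, ∑ j, M (F t) i j * F' t j = lam t i) ∧
          ((∀ t ∈ I, U t = unitaryProd (fun j => quadOp (G j)) (F t)) →
            ∀ t ∈ I, ActsOnModesAs (U t) (sympProd G (F t)))) ∧
        ∃ δ : ℝ, 0 < δ ∧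
          ∀ lam : ℝ → Fin (N * (2 * N + 1)) → ℝ, Continuous lam →
          ∀ T : ℝ, 0 < T → (∀ t ∈ Set.Ioo (-T) T, ∀ j, |lam t j| * T ≤ δ) →
          ∃ F F' : ℝ → Fin (N * (2 * N + 1)) → ℝ, F 0 = 0 ∧
            (∀ t ∈ Set.Ioo (-T) T, HasDerivAt F (F' t) t) ∧
            (∀ t ∈ Set.Ioo (-T) T, ∀ i, ∑ j, M (F t) i j * F' t j = lam t i) ∧
            ∀ E E' : ℝ → Fin (N * (2 * N + 1)) → ℝ, E 0 = 0 →
              (∀ t ∈ Set.Ioo (-T) T, HasDerivAt E (E' t) t) →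
              (∀ t ∈ Set.Ioo (-T) T, ∀ i, ∑ j, M (E t) i j * E' t j = lam t i) →
              Set.EqOn E F (Set.Ioo (-T) T)) ∧
    -- a harmonic-oscillator detector coupled to one field mode, both starting in the vacuum
    (∀ c : ℝ, c ≠ 0 →
      (∃ G : Fin (2 * (2 * 2 + 1)) → ModeMatrix 2,
        (∀ j, IsQuadMatrix (G j)) ∧ LinearIndependent ℝ G ∧
        ∀ j, quadOp (G j) = detGen c j) ∧
      ∀ (Δ : ℝ) (h : ℝ → ℂ), Continuous h →
        (∀ τ : ℝ, detHam Δ h τ = ∑ j, (detCoeff Δ h τ j : ℂ) • detGen c j) ∧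
        ∃ U : ℝ → Fock 2 →L[ℂ] Fock 2, IsTimeOrderedExp (detHam Δ h) U ∧
          (∃ T : ℝ, 0 < T ∧ ∃ F : ℝ → Fin 10 → ℝ, F 0 = 0 ∧
            (∀ τ ∈ Set.Ioo (-T) T, DifferentiableAt ℝ F τ) ∧
            ∀ τ ∈ Set.Ioo (-T) T,
              U τ = unitaryProd (detGen c ∘ detOrder) (F τ ∘ detOrder)) ∧
          ∀ (τ : ℝ) (f : Fin 10 → ℝ),
            U τ = unitaryProd (detGen c ∘ detOrder) (f ∘ detOrder) →
            HasExpectation (detDdag * detD) (U τ (vacuum 2))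
              ((Real.cosh (2 * f 0) * Real.cosh (2 * f 1) * Real.cosh (4 * c * f 2) *
                Real.cosh (4 * c * f 3) - 1) / 2)) := by
  refine ⟨fun N H hH => ⟨existsUnique_unitaryGroup hH, fun t =>
    ⟨isComplexSymplectic_sympExp hH t, ?_⟩⟩, fun N G hG hli => ⟨fun X hX => ?_,
    fun lam hlam => ?_, ?_⟩, fun c hc => ⟨?_, fun Δ h hh => ⟨detHam_eq Δ h c, ?_⟩⟩⟩
  · obtain ⟨W, hW⟩ := exists_isRapidGroup hH
    exact (hW.implementsWith hH t).actsOnModesAs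
  · obtain ⟨g, hg⟩ := exists_coords hG hli
    exact ⟨fun i => g i X, hg X hX, fun y hy => sum_smul_injective hli (hy.symm.trans (hg X hX))⟩
  · refine existsUnique_timeOrderedExp ?_ fun t => IsQuadMatrix.sum_smul hG (lam t)
    exact continuous_finsetSum _ fun j _ => ((continuous_apply j).comp hlam).smul continuous_const
  · obtain ⟨M, hM0, hM, hMd⟩ := exists_transformedGen_coeff hG hli
    refine ⟨M, hM0, hM, fun lam hlam U hU I hIo hIc h0 F F' hF0 hF => ⟨?_, fun h t ht => ?_⟩,
      exists_unique_solution_matrix_ode M hM0 hMd⟩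
    · rw [timeOrderedExp_eq_unitaryProd_iff hG (fun t => IsQuadMatrix.sum_smul hG (lam t)) hU hIo
        hIc h0 hF0 hF]
      exact forall₂_congr fun t _ => sum_transformedGen_eq_iff hli (hM (F t)) (F' t) (lam t)
    · obtain ⟨w, v, hw⟩ := exists_implementsWith_unitaryProd hG (F t)
      rw [h t ht]
      exact hw.actsOnModesAs
  · exact ⟨detMat c, isQuadMatrix_detMat c, linearIndependent_detMat hc, quadOp_detMat c⟩
  · have hex : ∃! U, IsTimeOrderedExp (detHam Δ h) U := by
      have e : detHam Δ h = fun τ => quadOp (∑ j, detCoeff Δ h τ j • detMat c j) :=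
        funext (detHam_eq_quadOp Δ h c)
      rw [e]
      refine existsUnique_timeOrderedExp ?_ fun t =>
        IsQuadMatrix.sum_smul (isQuadMatrix_detMat c) _
      exact continuous_finsetSum _ fun j _ =>
        ((continuous_apply j).comp (continuous_detCoeff Δ hh)).smul continuous_const
    obtain ⟨U, hU, -⟩ := hex
    refine ⟨U, hU, detHam_unitaryProd hc Δ hh hU, fun τ f hf => ?_⟩
    rw [hf]
    exact hasExpectation_detector c f
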